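/- Let $\sigma\in\{-1,+1\}$. A curvature model $\mathfrak C=(V,\langle\cdot,\cdot\rangle,J,A)$ consists of a finite-dimensional real vector space $V$, a non-degenerate symmetric bilinear form $\langle\cdot,\cdot\rangle$ on $V$, an endomorphism $J$ of $V$ with $J^2=\sigma\,\mathrm{id}$ and $\langle Jx,Jy\rangle=-\sigma\langle x,y\rangle$, and an algebraic curvature tensor $A\in\otimes^4V^*$, i.e. $A(x,y,z,w)+A(y,z,x,w)+A(z,x,y,w)=0$ and $A(x,y,z,w)=-A(y,x,z,w)=A(z,w,x,y)$. For $\sigma=-1$ this is a (pseudo-)Hermitian curvature model (Hermitian if $\langle\cdot,\cdot\rangle$ is positive definite); for $\sigma=+1$ it is a para-Hermitian curvature model (the signature is then automatically neutral). The model satisfies the Gray identity ($\sigma=-1$), resp. the para-Gray identity ($\sigma=+1$), if for all $x,y,z,w\in V$ $$0=A(x,y,z,w)+A(Jx,Jy,Jz,Jw)+\sigma\{A(Jx,Jy,z,w)+A(Jx,y,Jz,w)+A(Jx,y,z,Jw)+A(x,Jy,Jz,w)+A(x,Jy,z,Jw)+A(x,y,Jz,Jw)\}.$$ Similarly, let $(M,g,\mathcal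 J)$ be a smooth manifold with a pseudo-Riemannian metric $g$ of constant signature and a smooth endomorphism field $\mathcal J$ of $TM$ with $\mathcal J^2=\sigma\,\mathrm{id}$ and $g(\mathcal Jx,\mathcal Jy)=-\sigma g(x,y)$: an almost (pseudo-)Hermitian manifold for $\sigma=-1$, an almost para-Hermitian manifold for $\sigma=+1$. The word "almost" is dropped if $\mathcal J$ is integrable, i.e. if its Nijenhuis tensor $\sigma[x,y]+[\mathcal Jx,\mathcal Jy]-\mathcal J[\mathcal Jx,y]-\mathcal J[x,\mathcal Jy]$ vanishes identically. Let $R$ be the curvature tensor of the Levi-Civita connection, $R(x,y)=\nabla_x\nabla_y-\nabla_y\nabla_x-\nabla_{[x,y]}$, $R(x,y,z,w)=g(R(x,y)z,w)$. In a local frame $\{e_i\}$ put $$\tau=g^{il}g^{jk}R(e_i,e_j,e_k,e_l),\qquad \tau^\star=-\sigma\, g^{il}g^{jk}R(e_i,e_j,\mathcal Je_k,\mathcal Je_l)$$ (the scalar and $\star$-scalar curvature), and let $\Omega(x,y)=g(x,\mathcal Jy)$ be the (para-)Kähler form. The model $\mathfrak C$ is geometrically realized by $(M,g,\mathcal J)$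 at $P\in M$ if there is a linear isomorphism $\phi:V\to T_PM$ with $\phi^*g_P=\langle\cdot,\cdot\rangle$, $\phi^*\mathcal J_P=J$ and $\phi^*R_P=A$. **Theorem.** Let $\mathfrak C$ be a curvature model as above, for $\sigma=-1$ or $\sigma=+1$. 1. $\mathfrak C$ is geometrically realized at some point $P$ of an almost (pseudo-)Hermitian manifold (if $\sigma=-1$), resp. almost para-Hermitian manifold (if $\sigma=+1$), such that $\tau$ and $\tau^\star$ are constant on $M$ and $d\Omega_P=0$. 2. If $\mathfrak C$ satisfies the Gray identity (if $\sigma=-1$), resp. the para-Gray identity (if $\sigma=+1$), then it is geometrically realized at some point $P$ of a (pseudo-)Hermitian, resp. para-Hermitian, manifold such that $\tau$ and $\tau^\star$ are constant on $M$ and $d\Omega_P=0$. 3. Conversely, if $\mathfrak C$ is geometrically realized by some (pseudo-)Hermitian, resp. para-Hermitian, manifold, then $\mathfrak C$ satisfies the Gray, resp. para-Gray, identity. In 1 and 2, if $\langle\cdot,\cdot\rangle$ is positive definite, then $g$ can be taken to be Riemannian. In particular, requiring $d\Omega=0$ at a single point imposes no additional curvature restriction. -/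

import Mathlib

open scoped Manifold ContDiff

/-! Throughout, the real number `σ` is `-1` or `1`. The value `σ = -1` is the (pseudo-)Hermitian
setting, where `J² = -id` and `J^*g = g`; the value `σ = 1` is the para-Hermitian setting, where
`J² = id` and `J^*g = -g`. Both cases read `J² = σ id` and `J^*g = -σ g`. -/

/-! ### Algebraic curvature models -/

/-- A (pseudo-)Hermitian (`σ = -1`) or para-Hermitian (`σ = 1`) curvature model on `V`: a
nondegenerate symmetric inner product, a compatible (para-)complex structure `J`, and an
algebraic curvature tensor `A`. For `σ = 1` the inner product automatically has neutral
signature. -/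
structure CurvatureModel (σ : ℝ) (V : Type*) [AddCommGroup V] [Module ℝ V] where
  /-- the inner product -/
  ip : V →ₗ[ℝ] V →ₗ[ℝ] ℝ
  ip_symm : ∀ x y, ip x y = ip y x
  ip_nondeg : ∀ x, (∀ y, ip x y = 0) → x = 0
  /-- the (para-)complex structure -/
  J : V →ₗ[ℝ] V
  J_sq : ∀ x, J (J x) = σ • x
  J_compat : ∀ x y, ip (J x) (J y) = -σ * ip x y
  /-- the algebraic curvature tensor -/
  A : V →ₗ[ℝ] V →ₗ[ℝ] V →ₗ[ℝ] V →ₗ[ℝ] ℝ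
  bianchi : ∀ x y z w, A x y z w + A y z x w + A z x y w = 0
  antisymm : ∀ x y z w, A x y z w = -A y x z w
  pair_symm : ∀ x y z w, A x y z w = A z w x y

/-- The inner product of the model is positive definite. -/
def CurvatureModel.PosDef {σ : ℝ} {V : Type*} [AddCommGroup V] [Module ℝ V]
    (C : CurvatureModel σ V) : Prop :=
  ∀ v, v ≠ 0 → 0 < C.ip v v

/-- The Gray identity (`σ = -1`), respectively the para-Gray identity (`σ = 1`). -/
def CurvatureModel.Gray {σ : ℝ} {V : Type*} [AddCommGroup V] [Module ℝ V]
    (C : CurvatureModel σ V) : Prop :=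
  ∀ x y z w : V,
    C.A x y z w + C.A (C.J x) (C.J y) (C.J z) (C.J w)
      + σ * (C.A (C.J x) (C.J y) z w + C.A (C.J x) y (C.J z) w + C.A (C.J x) y z (C.J w)
        + C.A x (C.J y) (C.J z) w + C.A x (C.J y) z (C.J w) + C.A x y (C.J z) (C.J w)) = 0

/-! ### Tensor calculus in local coordinates

A metric is given by its matrix `G u a b = g(∂_a, ∂_b)` at the point `u`, an endomorphism field
by the matrix `K u b a` with `J ∂_a = ∑ b, K u b a • ∂_b`. -/

/-- The model space `ℝ^m`. -/
abbrev CoordSpace (m : ℕ) : Type := EuclideanSpace ℝ (Fin m)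

namespace Coord

variable {m : ℕ}

/-- The partial derivative `∂f/∂u_a`. -/
noncomputable def partialD (f : CoordSpace m → ℝ) (a : Fin m) (u : CoordSpace m) : ℝ :=
  fderiv ℝ f u (EuclideanSpace.single a 1)

/-- Christoffel symbols of the first kind, `Γ_{abc} = (g_{bc/a} + g_{ac/b} - g_{ab/c}) / 2`. -/
noncomputable def christoffelLow (G : CoordSpace m → Matrix (Fin m) (Fin m) ℝ)
    (a b c : Fin m) (u : CoordSpace m) : ℝ :=
  (1 / 2) * (partialD (fun v => G v b c) a u + partialD (fun v => G v a c) b u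
    - partialD (fun v => G v a b) c u)

/-- Christoffel symbols `Γ_{ab}^d` of the Levi-Civita connection, `∇_a ∂_b = Γ_{ab}^d ∂_d`. -/
noncomputable def christoffel (G : CoordSpace m → Matrix (Fin m) (Fin m) ℝ)
    (a b d : Fin m) (u : CoordSpace m) : ℝ :=
  ∑ c, (G u)⁻¹ c d * christoffelLow G a b c u

/-- `R_{abc}^d`, the components of `R(∂_a, ∂_b) ∂_c`, for
`R(x, y) = ∇_x ∇_y - ∇_y ∇_x - ∇_{[x, y]}`. -/
noncomputable def curvUp (G : CoordSpace m → Matrix (Fin m) (Fin m) ℝ)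
    (a b c d : Fin m) (u : CoordSpace m) : ℝ :=
  partialD (christoffel G b c d) a u - partialD (christoffel G a c d) b u
    + ∑ e, (christoffel G a e d u * christoffel G b c e u
      - christoffel G b e d u * christoffel G a c e u)

/-- `R_{abcd} = g(R(∂_a, ∂_b) ∂_c, ∂_d)`. -/
noncomputable def curvLow (G : CoordSpace m → Matrix (Fin m) (Fin m) ℝ)
    (a b c d : Fin m) (u : CoordSpace m) : ℝ :=
  ∑ f, G u d f * curvUp G a b c f u

/-- The scalar curvature `τ = g^{il} g^{jk} R_{ijkl}`. -/
noncomputable def scalarCurv (G : CoordSpace m → Matrix (Fin m) (Fin m) ℝ)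
    (u : CoordSpace m) : ℝ :=
  ∑ i, ∑ j, ∑ k, ∑ l, (G u)⁻¹ i l * (G u)⁻¹ j k * curvLow G i j k l u

/-- The star-scalar curvature `τ^⋆ = -σ g^{il} g^{jk} R(∂_i, ∂_j, J ∂_k, J ∂_l)`. -/
noncomputable def starScalarCurv (σ : ℝ) (G K : CoordSpace m → Matrix (Fin m) (Fin m) ℝ)
    (u : CoordSpace m) : ℝ :=
  -σ * ∑ i, ∑ j, ∑ k, ∑ l, (G u)⁻¹ i l * (G u)⁻¹ j k *
    ∑ p, ∑ q, K u p k * K u q l * curvLow G i j p q u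

/-- The components `Ω_{ab} = g(∂_a, J ∂_b)` of the (para-)Kähler form. -/
def kaehlerForm (G K : CoordSpace m → Matrix (Fin m) (Fin m) ℝ)
    (a b : Fin m) (u : CoordSpace m) : ℝ :=
  ∑ c, G u a c * K u c b

/-- The components of `dΩ`: `(dΩ)_{abc} = Ω_{bc/a} + Ω_{ca/b} + Ω_{ab/c}`. -/
noncomputable def dKaehlerForm (G K : CoordSpace m → Matrix (Fin m) (Fin m) ℝ)
    (a b c : Fin m) (u : CoordSpace m) : ℝ :=
  partialD (kaehlerForm G K b c) a u + partialD (kaehlerForm G K c a) b u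
    + partialD (kaehlerForm G K a b) c u

/-- The `d`-th component of the Nijenhuis tensor
`N(x, y) = σ [x, y] + [J x, J y] - J ([J x, y] + [x, J y])` at `x = ∂_a`, `y = ∂_b`, where
`[∂_a, ∂_b] = 0`, `[J ∂_a, ∂_b]^c = -∂_b K_{ca}` and `[∂_a, J ∂_b]^c = ∂_a K_{cb}`. -/
noncomputable def nijenhuis (K : CoordSpace m → Matrix (Fin m) (Fin m) ℝ)
    (a b d : Fin m) (u : CoordSpace m) : ℝ :=
  (∑ c, (K u c a * partialD (fun v => K v d b) c u - K u c b * partialD (fun v => K v d a) c u))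
    - ∑ c, K u d c * (-partialD (fun v => K v c a) b u + partialD (fun v => K v c b) a u)

end Coord

/-! ### Manifolds -/

section Manifold

variable {m : ℕ} {M : Type*} [TopologicalSpace M] [ChartedSpace (CoordSpace m) M]

/-- The coordinate vector field `∂_a` of the preferred chart around `p`, at the point with
coordinates `u`. -/
noncomputable def coordVec (p : M) (u : CoordSpace m) (a : Fin m) :
    TangentSpace 𝓘(ℝ, CoordSpace m) ((extChartAt 𝓘(ℝ, CoordSpace m) p).symm u) :=
  mfderiv 𝓘(ℝ, CoordSpace m) 𝓘(ℝ, CoordSpace m) (extChartAt 𝓘(ℝ, CoordSpace m) p).symm u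
    (EuclideanSpace.single a (1 : ℝ) : CoordSpace m)

/-- The components, with respect to the `∂_a` of the preferred chart around `p`, of a tangent
vector at `q`. -/
noncomputable def coordComp (p q : M) (v : TangentSpace 𝓘(ℝ, CoordSpace m) q) :
    CoordSpace m :=
  mfderiv 𝓘(ℝ, CoordSpace m) 𝓘(ℝ, CoordSpace m) (extChartAt 𝓘(ℝ, CoordSpace m) p) q v

/-- The matrix of a bilinear form field in the preferred chart around `p`. -/
noncomputable def metricMatrix
    (g : ∀ q : M, TangentSpace 𝓘(ℝ, CoordSpace m) q →ₗ[ℝ]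
      TangentSpace 𝓘(ℝ, CoordSpace m) q →ₗ[ℝ] ℝ)
    (p : M) (u : CoordSpace m) : Matrix (Fin m) (Fin m) ℝ :=
  Matrix.of fun a b => g ((extChartAt 𝓘(ℝ, CoordSpace m) p).symm u)
    (coordVec p u a) (coordVec p u b)

/-- The matrix of an endomorphism field in the preferred chart around `p`. -/
noncomputable def endoMatrix
    (J : ∀ q : M, TangentSpace 𝓘(ℝ, CoordSpace m) q →ₗ[ℝ]
      TangentSpace 𝓘(ℝ, CoordSpace m) q)
    (p : M) (u : CoordSpace m) : Matrix (Fin m) (Fin m) ℝ :=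
  Matrix.of fun b a => coordComp p ((extChartAt 𝓘(ℝ, CoordSpace m) p).symm u)
    (J ((extChartAt 𝓘(ℝ, CoordSpace m) p).symm u) (coordVec p u a)) b

end Manifold

/-- An almost (pseudo-)Hermitian (`σ = -1`) or almost para-Hermitian (`σ = 1`) structure on the
smooth manifold `M`: a smooth pseudo-Riemannian metric `g` of constant signature (that is, all
tangent spaces are isometric) and a smooth compatible almost (para-)complex structure `J`. -/
structure AlmostHermitian (σ : ℝ) (m : ℕ) (M : Type*) [TopologicalSpace M]
    [ChartedSpace (CoordSpace m) M] where
  /-- the metric -/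
  g : ∀ p : M, TangentSpace 𝓘(ℝ, CoordSpace m) p →ₗ[ℝ]
    TangentSpace 𝓘(ℝ, CoordSpace m) p →ₗ[ℝ] ℝ
  g_symm : ∀ p x y, g p x y = g p y x
  g_nondeg : ∀ p x, (∀ y, g p x y = 0) → x = 0
  g_signature : ∀ p q : M, ∃ e : TangentSpace 𝓘(ℝ, CoordSpace m) p ≃ₗ[ℝ]
    TangentSpace 𝓘(ℝ, CoordSpace m) q, ∀ x y, g q (e x) (e y) = g p x y
  g_smooth : ∀ (p : M) (a b : Fin m), ContDiffOn ℝ ∞ (fun u => metricMatrix g p u a b)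
    (extChartAt 𝓘(ℝ, CoordSpace m) p).target
  /-- the almost (para-)complex structure -/
  J : ∀ p : M, TangentSpace 𝓘(ℝ, CoordSpace m) p →ₗ[ℝ] TangentSpace 𝓘(ℝ, CoordSpace m) p
  J_sq : ∀ p x, J p (J p x) = σ • x
  J_compat : ∀ p x y, g p (J p x) (J p y) = -σ * g p x y
  J_smooth : ∀ (p : M) (a b : Fin m), ContDiffOn ℝ ∞ (fun u => endoMatrix J p u a b)
    (extChartAt 𝓘(ℝ, CoordSpace m) p).target

namespace AlmostHermitian

variable {σ : ℝ} {m : ℕ} {M : Type*} [TopologicalSpace M] [ChartedSpace (CoordSpace m) M]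

/-- The Riemann curvature tensor `R_p(x, y, z, w)`, computed in the preferred chart around `p`. -/
noncomputable def curvature (H : AlmostHermitian σ m M) (p : M)
    (x y z w : TangentSpace 𝓘(ℝ, CoordSpace m) p) : ℝ :=
  ∑ a, ∑ b, ∑ c, ∑ d,
    Coord.curvLow (metricMatrix H.g p) a b c d (extChartAt 𝓘(ℝ, CoordSpace m) p p)
      * coordComp p p x a * coordComp p p y b * coordComp p p z c * coordComp p p w d

/-- The scalar curvature. -/
noncomputable def scalarCurvature (H : AlmostHermitian σ m M) (p : M) : ℝ :=
  Coord.scalarCurv (metricMatrix H.g p) (extChartAt 𝓘(ℝ, CoordSpace m) p p)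

/-- The star-scalar curvature. -/
noncomputable def starScalarCurvature (H : AlmostHermitian σ m M) (p : M) : ℝ :=
  Coord.starScalarCurv σ (metricMatrix H.g p) (endoMatrix H.J p)
    (extChartAt 𝓘(ℝ, CoordSpace m) p p)

/-- `dΩ = 0` at the point `p`, for the (para-)Kähler form `Ω(x, y) = g(x, J y)`. -/
def KaehlerAt (H : AlmostHermitian σ m M) (p : M) : Prop :=
  ∀ a b c, Coord.dKaehlerForm (metricMatrix H.g p) (endoMatrix H.J p) a b c
    (extChartAt 𝓘(ℝ, CoordSpace m) p p) = 0

/-- `J` is integrable, i.e. its Nijenhuis tensor vanishes identically: `H` is a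
(pseudo-)Hermitian, respectively para-Hermitian, structure. -/
def Integrable (H : AlmostHermitian σ m M) : Prop :=
  ∀ (p : M) (a b d : Fin m),
    Coord.nijenhuis (endoMatrix H.J p) a b d (extChartAt 𝓘(ℝ, CoordSpace m) p p) = 0

/-- The metric is Riemannian. -/
def Riemannian (H : AlmostHermitian σ m M) : Prop :=
  ∀ (p : M) (x : TangentSpace 𝓘(ℝ, CoordSpace m) p), x ≠ 0 → 0 < H.g p x x

/-- The scalar curvature and the star-scalar curvature are constant functions on `M`. -/
def ConstantScalarCurvatures (H : AlmostHermitian σ m M) : Prop :=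
  (∃ c : ℝ, ∀ p, H.scalarCurvature p = c) ∧ (∃ c : ℝ, ∀ p, H.starScalarCurvature p = c)

/-- The model `C` is geometrically realized by `(M, g, J)` at the point `P`. -/
def Realizes (H : AlmostHermitian σ m M) (P : M) {V : Type*} [AddCommGroup V] [Module ℝ V]
    (C : CurvatureModel σ V) : Prop :=
  ∃ φ : V ≃ₗ[ℝ] TangentSpace 𝓘(ℝ, CoordSpace m) P,
    (∀ x y, H.g P (φ x) (φ y) = C.ip x y) ∧
    (∀ x, H.J P (φ x) = φ (C.J x)) ∧
    (∀ x y z w, H.curvature P (φ x) (φ y) (φ z) (φ w) = C.A x y z w)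

end AlmostHermitian

/-! Sufficiency. In a basis of V orthogonal for the inner product, let γ be its Gram matrix and J₀
the matrix of J. Every field E of invertible matrices on a ball gives a compatible pair g = Eᵀ γ E,
𝒥 = E⁻¹ J₀ E, whose signature is that of γ. The proof uses E = 1 + ∑ z_c z_d Q_cd + u₀ N₀ + u₁ N₁,
where the 2-jets of u₀ and u₁ vanish at the origin. Then E has no first derivatives there, so dΩ = 0
at that point, and the curvature there depends linearly on the Hessian of g, which is fixed by Q
alone (`GoodFrame.curvLow_origin`). It remains to choose Q, and to choose u₀, u₁ making the scalar
curvatures constant.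

Choice of Q. In general the Hessian is the normal coordinate one, a symmetrization of A
(`potential_curvature`). If A satisfies the (para-)Gray identity there is another Hessian, with J
skew for each of its values (`grayPotential_J`, `grayPotential_curvature`). Then Q commutes with J₀.
So do N₀ and N₁, hence so does E, and 𝒥 is the constant matrix J₀ and therefore integrable.

Constant τ and τ⋆. With N₁ = 1 (a conformal change) and N₀ a rescaling of the 𝒥-invariant span of
the gradient of z_t and its image under 𝒥, constancy of τ and τ⋆ is a second order system for u₀,
u₁. After multiplication by a power of det E it is polynomial in the 2-jet (`scal_eq_scalarCurv`,
`scal_eq_starScalarCurv`). On jets whose only entries are ∂_t² u_j it is linear, with determinant a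
nonzero multiple of m - 2 when γ^{tt} ≠ 0 (`scalJet_metric_jetPure`, `scalJet_bivector_jetPure`). In
dimension two τ⋆ is a fixed multiple of τ, so one equation suffices (`CompatPair.scal_bivector`).
The system is then noncharacteristic, and a Cauchy–Kovalevskaya theorem solves it
(`exists_solution_of_polynomial_jet_equation`). That theorem is a contraction argument for v = ∂_t²
u in a weighted ℓ¹ algebra of power series, in which one integration in z_t compensates one
derivative in any direction (`wnorm_pderiv_integ_le`).

Necessity. If 𝒥 is integrable then ∇_{𝒥x} 𝒥 = 𝒥 ∇_x 𝒥 (`HermitianOn.contr_covD`). Differentiating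
once more and antisymmetrizing by the Ricci identity gives a relation between the commutators [R(x,
y), 𝒥] (`HermitianOn.curvM_identity`). Its scalar form is the (para-)Gray identity
(`HermitianOn.gray`). -/

namespace MvPowerSeries

open scoped NNReal ENNReal Nat
open _root_.Finset

variable {ι : Type*}

/-! ### Formal integration -/

/-- The formal integral `∫₀^{z_t} v dz_t`. -/
noncomputable def integ (t : ι) (v : MvPowerSeries ι ℝ) : MvPowerSeries ι ℝ :=
  -- When `β t = 0` the truncated subtraction returns a meaningless exponent; division by zero then
  -- makes the coefficient vanish, as it should.
  fun β => coeff (β - Finsupp.single t 1) v / β t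

theorem coeff_integ (t : ι) (v : MvPowerSeries ι ℝ) (β : ι →₀ ℕ) :
    coeff β (integ t v) = coeff (β - Finsupp.single t 1) v / β t := rfl

theorem coeff_integ_add (t : ι) (v : MvPowerSeries ι ℝ) (β : ι →₀ ℕ) :
    coeff (β + Finsupp.single t 1) (integ t v) = coeff β v / (β t + 1) := by
  simp [coeff_integ]

theorem coeff_integ_eq_zero (t : ι) (v : MvPowerSeries ι ℝ) (β : ι →₀ ℕ) (h : β t = 0) :
    coeff β (integ t v) = 0 := by
  simp [coeff_integ, h]

theorem pderiv_integ_self (t : ι) (v : MvPowerSeries ι ℝ) : pderiv ℝ t (integ t v) = v := by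
  ext β
  rw [coeff_pderiv, coeff_integ_add]
  field_simp

theorem integ_sub (t : ι) (v w : MvPowerSeries ι ℝ) :
    integ t (v - w) = integ t v - integ t w := by
  ext β
  simp [coeff_integ, sub_div]

theorem constantCoeff_integ (t : ι) (v : MvPowerSeries ι ℝ) :
    constantCoeff (integ t v) = 0 := by
  rw [← coeff_zero_eq_constantCoeff_apply]
  exact coeff_integ_eq_zero t v 0 rfl

theorem pderiv_integ_comm {t a : ι} (h : a ≠ t) (v : MvPowerSeries ι ℝ) :
    pderiv ℝ a (integ t v) = integ t (pderiv ℝ a v) := by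
  classical
  ext β
  rw [coeff_pderiv]
  by_cases hβ : β t = 0
  · rw [coeff_integ_eq_zero, coeff_integ_eq_zero t _ _ hβ, zero_mul]
    simp [hβ, h]
  · obtain ⟨γ, rfl⟩ : ∃ γ, β = γ + Finsupp.single t 1 :=
      ⟨β - Finsupp.single t 1, (tsub_add_cancel_of_le (by
        simpa using Nat.one_le_iff_ne_zero.mpr hβ)).symm⟩
    rw [add_right_comm, coeff_integ_add, coeff_integ_add, coeff_pderiv]
    simp [h, h.symm]
    ring

/-- The shift misses exactly the exponents with `β t = 0`, where `f` vanishes. Working in `ℝ≥0∞`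
removes all summability conditions. -/
theorem tsum_add_single_of_support {t : ι} (f : (ι →₀ ℕ) → ℝ≥0∞) (hf : ∀ β, β t = 0 → f β = 0) :
    ∑' β, f (β + Finsupp.single t 1) = ∑' β, f β := by
  classical
  refine Function.Injective.tsum_eq (g := fun β : ι →₀ ℕ => β + Finsupp.single t 1)
    (add_left_injective _) fun β hβ => ?_
  have : β t ≠ 0 := fun h => hβ (hf β h)
  exact ⟨β - Finsupp.single t 1, tsub_add_cancel_of_le (by
        simpa using Nat.one_le_iff_ne_zero.mpr this)⟩

/-- Choosing a prescribed number of elements inside each block is one way of choosing from the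
union; in the induction this is a single term of the Vandermonde sum. -/
theorem prod_choose_le_choose_sum (s : Finset ι) (f g : ι → ℕ) :
    ∏ a ∈ s, (f a + g a).choose (f a) ≤ (∑ a ∈ s, (f a + g a)).choose (∑ a ∈ s, f a) := by
  classical
  induction s using Finset.induction_on with
  | empty => simp
  | insert a s ha ih =>
    rw [prod_insert ha, sum_insert ha, sum_insert ha, Nat.add_choose_eq (f a + g a)]
    refine le_trans (Nat.mul_le_mul_left _ ih) ?_
    exact Finset.single_le_sum (s := antidiagonal (f a + ∑ x ∈ s, f x))
      (f := fun ij : ℕ × ℕ => (f a + g a).choose ij.1 * (∑ x ∈ s, (f x + g x)).choose ij.2)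
      (fun _ _ => Nat.zero_le _) (a := (f a, ∑ x ∈ s, f x)) (by simp)

/-! ### A weighted `ℓ¹` norm on multivariate power series -/

variable [Fintype ι]

/-- The weight `R^β β! / |β|!` of the monomial `z^β`. -/
noncomputable def wt (R : ι → ℝ≥0) (β : ι →₀ ℕ) : ℝ≥0 :=
  (∏ a, R a ^ β a * ((β a)! : ℝ≥0)) / ((∑ a, β a)! : ℝ≥0)

/-- The weighted `ℓ¹` norm, possibly infinite. -/
noncomputable def wnorm (R : ι → ℝ≥0) (c : MvPowerSeries ι ℝ) : ℝ≥0∞ :=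
  ∑' β, ((‖coeff β c‖₊ * wt R β : ℝ≥0) : ℝ≥0∞)

theorem wt_zero (R : ι → ℝ≥0) : wt R 0 = 1 := by simp [wt]

theorem wt_pos {R : ι → ℝ≥0} (hR : ∀ a, R a ≠ 0) (β : ι →₀ ℕ) : 0 < wt R β := by
  have h : ∀ a, 0 < R a := fun a => pos_iff_ne_zero.mpr (hR a)
  have : 0 < ∏ a, R a ^ β a * ((β a)! : ℝ≥0) :=
    prod_pos fun a _ => mul_pos (pow_pos (h a) _) (by positivity)
  unfold wt
  positivity

/-- The factorial part of the weight is an inverse multinomial coefficient, so submultiplicativity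
is the binomial inequality above. It makes `wnorm` an algebra norm. -/
theorem wt_add_le (R : ι → ℝ≥0) (β γ : ι →₀ ℕ) : wt R (β + γ) ≤ wt R β * wt R γ := by
  unfold wt
  rw [div_mul_div_comm, div_le_div_iff₀ (by positivity) (by positivity)]
  have key : (∏ a, ((β a + γ a)! : ℝ≥0)) * (((∑ a, β a)! : ℝ≥0) * ((∑ a, γ a)! : ℝ≥0))
      ≤ (∏ a, ((β a)! : ℝ≥0)) * (∏ a, ((γ a)! : ℝ≥0)) * ((∑ a, (β a + γ a))! : ℝ≥0) := by
    have h := prod_choose_le_choose_sum univ (fun a => β a) (fun a => γ a)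
    have hfac : ∀ i j : ℕ, (i + j)! = (i + j).choose i * (i ! * j !) := fun i j => by
      rw [← mul_assoc, Nat.choose_symm_add, Nat.add_choose_mul_factorial_mul_factorial]
    have h1 : ∀ a, (β a + γ a)! = (β a + γ a).choose (β a) * ((β a)! * (γ a)!) := fun a => hfac _ _
    have h2 : (∑ a, (β a + γ a))! = (∑ a, (β a + γ a)).choose (∑ a, β a) *
        ((∑ a, β a)! * (∑ a, γ a)!) := by
      rw [sum_add_distrib, hfac]
    norm_cast
    rw [h2, prod_congr rfl fun a _ => h1 a, prod_mul_distrib, prod_mul_distrib]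
    calc _ = (∏ a, (β a + γ a).choose (β a)) * ((∏ a, (β a)!) * (∏ a, (γ a)!) *
          ((∑ a, β a)! * (∑ a, γ a)!)) := by ring
      _ ≤ (∑ a, (β a + γ a)).choose (∑ a, β a) * ((∏ a, (β a)!) * (∏ a, (γ a)!) *
          ((∑ a, β a)! * (∑ a, γ a)!)) := Nat.mul_le_mul_right _ h
      _ = _ := by ring
  simp only [Finsupp.add_apply, prod_mul_distrib, pow_add]
  calc _ = (∏ a, R a ^ β a) * (∏ a, R a ^ γ a) * ((∏ a, ((β a + γ a)! : ℝ≥0)) *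
        (((∑ a, β a)! : ℝ≥0) * ((∑ a, γ a)! : ℝ≥0))) := by ring
    _ ≤ (∏ a, R a ^ β a) * (∏ a, R a ^ γ a) * ((∏ a, ((β a)! : ℝ≥0)) *
        (∏ a, ((γ a)! : ℝ≥0)) * ((∑ a, (β a + γ a))! : ℝ≥0)) := mul_le_mul_right key _
    _ = _ := by ring

/-- This identity is why the factor β!/|β|! is present: the factor `β a + 1` produced by
differentiating in direction `a` turns into `|β| + 1`, which no longer depends on the direction. -/
theorem wt_add_single [DecidableEq ι] (R : ι → ℝ≥0) (β : ι →₀ ℕ) (a : ι) :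
    wt R (β + Finsupp.single a 1) * ((∑ b, β b : ℕ) + 1) = wt R β * R a * (β a + 1) := by
  have hs : ∑ b, (β + Finsupp.single a 1 : ι →₀ ℕ) b = (∑ b, β b) + 1 := by
    simp [sum_add_distrib, Finsupp.single_apply]
  have hp : ∏ b, R b ^ (β + Finsupp.single a 1 : ι →₀ ℕ) b *
      (((β + Finsupp.single a 1 : ι →₀ ℕ) b)! : ℝ≥0)
      = (∏ b, R b ^ β b * ((β b)! : ℝ≥0)) * (R a * (β a + 1)) := by
    rw [← mul_prod_erase univ _ (mem_univ a), ← mul_prod_erase univ (fun b => R b ^ β b * _)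
      (mem_univ a)]
    have : ∀ b ∈ univ.erase a, R b ^ (β + Finsupp.single a 1 : ι →₀ ℕ) b *
        (((β + Finsupp.single a 1 : ι →₀ ℕ) b)! : ℝ≥0) = R b ^ β b * ((β b)! : ℝ≥0) := by
      intro b hb
      have : a ≠ b := (ne_of_mem_erase hb).symm
      simp [this]
    rw [prod_congr rfl this]
    simp only [Finsupp.add_apply, Finsupp.single_eq_same, Nat.factorial_succ, pow_succ]
    push_cast
    ring
  unfold wt
  rw [hs, hp, Nat.factorial_succ]
  have : (((∑ b, β b)! : ℕ) : ℝ≥0) ≠ 0 := by positivity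
  push_cast
  field_simp

theorem wnorm_add_le (R : ι → ℝ≥0) (c d : MvPowerSeries ι ℝ) :
    wnorm R (c + d) ≤ wnorm R c + wnorm R d := by
  unfold wnorm
  rw [← ENNReal.tsum_add]
  refine ENNReal.tsum_le_tsum fun β => ?_
  rw [map_add, ← ENNReal.coe_add, ← add_mul]
  exact_mod_cast mul_le_mul_left (nnnorm_add_le _ _) _

theorem wnorm_neg (R : ι → ℝ≥0) (c : MvPowerSeries ι ℝ) : wnorm R (-c) = wnorm R c := by
  simp [wnorm]

theorem wnorm_zero (R : ι → ℝ≥0) : wnorm R 0 = 0 := by simp [wnorm]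

/-- The double series for the product of the norms is regrouped along antidiagonals and compared
with the Cauchy product through `wt_add_le`. -/
theorem wnorm_mul_le [DecidableEq ι] (R : ι → ℝ≥0) (c d : MvPowerSeries ι ℝ) :
    wnorm R (c * d) ≤ wnorm R c * wnorm R d := by
  have h1 : wnorm R c * wnorm R d = ∑' p : (ι →₀ ℕ) × (ι →₀ ℕ),
      ((‖coeff p.1 c‖₊ * wt R p.1 * (‖coeff p.2 d‖₊ * wt R p.2) : ℝ≥0) : ℝ≥0∞) := by
    unfold wnorm
    rw [ENNReal.tsum_prod', ← ENNReal.tsum_mul_right]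
    refine tsum_congr fun β => ?_
    rw [← ENNReal.tsum_mul_left]
    exact tsum_congr fun γ => (ENNReal.coe_mul _ _).symm
  rw [h1, ← (HasAntidiagonal.sigmaAntidiagonalEquivProd (A := ι →₀ ℕ)).tsum_eq, ENNReal.tsum_sigma']
  refine ENNReal.tsum_le_tsum fun β => ?_
  simp only [HasAntidiagonal.sigmaAntidiagonalEquivProd_apply]
  rw [tsum_fintype, Finset.sum_coe_sort (antidiagonal β) (fun p =>
    ((‖coeff p.1 c‖₊ * wt R p.1 * (‖coeff p.2 d‖₊ * wt R p.2) : ℝ≥0) : ℝ≥0∞)),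
    ← ENNReal.ofNNReal_finsetSum, ENNReal.coe_le_coe, coeff_mul]
  calc _ ≤ (∑ p ∈ antidiagonal β, ‖coeff p.1 c‖₊ * ‖coeff p.2 d‖₊) * wt R β := by
        gcongr
        refine (nnnorm_sum_le _ _).trans (sum_le_sum fun p _ => (nnnorm_mul _ _).le)
    _ ≤ _ := by
        rw [sum_mul]
        refine sum_le_sum fun p hp => ?_
        rw [HasAntidiagonal.mem_antidiagonal] at hp
        calc _ ≤ ‖coeff p.1 c‖₊ * ‖coeff p.2 d‖₊ * (wt R p.1 * wt R p.2) := by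
              rw [← hp]; gcongr; exact wt_add_le R _ _
          _ = _ := by ring

theorem wnorm_C [DecidableEq ι] (R : ι → ℝ≥0) (r : ℝ) : wnorm R (C r) = ‖r‖₊ := by
  unfold wnorm
  rw [tsum_eq_single 0 (fun β hβ => by simp [coeff_C, hβ])]
  simp [wt_zero]

theorem wnorm_X [DecidableEq ι] (R : ι → ℝ≥0) (a : ι) : wnorm R (X a) = R a := by
  unfold wnorm
  rw [tsum_eq_single (Finsupp.single a 1) (fun β hβ => by simp [coeff_X, hβ])]
  have := wt_add_single R 0 a
  simp [wt_zero] at this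
  simp [this, coeff_X]

/-! ### Norm estimates for formal integration -/

theorem wnorm_integ_le (R : ι → ℝ≥0) (t : ι) (v : MvPowerSeries ι ℝ) :
    wnorm R (integ t v) ≤ R t * wnorm R v := by
  classical
  unfold wnorm
  rw [← tsum_add_single_of_support (t := t) _ (fun β hβ => by simp [coeff_integ_eq_zero t v β hβ]),
    ← ENNReal.tsum_mul_left]
  refine ENNReal.tsum_le_tsum fun β => ?_
  rw [← ENNReal.coe_mul, ENNReal.coe_le_coe, coeff_integ_add]
  have h := wt_add_single R β t
  have hw : wt R (β + Finsupp.single t 1) = wt R β * R t * (β t + 1) / ((∑ b, β b : ℕ) + 1) := by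
    rw [eq_div_iff (by positivity), h]
  have hn : ‖coeff β v / ((β t : ℝ) + 1)‖₊ = ‖coeff β v‖₊ / (β t + 1) := by
    rw [nnnorm_div]
    congr 1
    ext
    simp only [coe_nnnorm, NNReal.coe_add, NNReal.coe_natCast, NNReal.coe_one]
    exact Real.norm_of_nonneg (by positivity)
  rw [hn, hw]
  calc _ = R t * (‖coeff β v‖₊ * wt R β) * (1 / ((∑ b, β b : ℕ) + 1)) := by field_simp
    _ ≤ R t * (‖coeff β v‖₊ * wt R β) * 1 := by
        gcongr
        exact div_le_one_of_le₀ (by simp) (by positivity)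
    _ = _ := mul_one _

/-- The estimate behind Cauchy–Kovalevskaya: an integration in `z_t` pays for a derivative in any
direction, without shrinking the domain of convergence. With the auxiliary family `f`, the left side
sums `f` over shifts by the `a`-th unit exponent and the right side over shifts by the `t`-th. The
latter exhaust the support of `f`, so the former sum is no larger. -/
theorem wnorm_pderiv_integ_le (R : ι → ℝ≥0) (t a : ι) (ha : R a ≠ 0) (v : MvPowerSeries ι ℝ) :
    wnorm R (pderiv ℝ a (integ t v)) ≤ (R t / R a : ℝ≥0) * wnorm R v := by
  classical
  have hsucc : ∀ n : ℕ, ‖((n : ℝ) + 1)‖₊ = (n : ℝ≥0) + 1 := fun n => by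
    ext
    simp only [coe_nnnorm, NNReal.coe_add, NNReal.coe_natCast, NNReal.coe_one]
    exact Real.norm_of_nonneg (by positivity)
  set f : (ι →₀ ℕ) → ℝ≥0∞ := fun γ =>
    ((‖coeff γ (integ t v)‖₊ * ((∑ b, γ b : ℕ) * wt R γ / R a) : ℝ≥0) : ℝ≥0∞) with hf
  have h1 : wnorm R (pderiv ℝ a (integ t v)) = ∑' β, f (β + Finsupp.single a 1) := by
    refine tsum_congr fun β => ?_
    rw [coeff_pderiv, nnnorm_mul, hsucc, hf]
    have h := wt_add_single R β a
    have hs : ∑ b, (β + Finsupp.single a 1 : ι →₀ ℕ) b = (∑ b, β b) + 1 := by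
      simp [sum_add_distrib, Finsupp.single_apply]
    simp only [hs]
    congr 1
    rw [mul_assoc]
    congr 1
    rw [eq_div_iff ha]
    push_cast at h ⊢
    rw [mul_comm _ (wt R (β + _)), h]
    ring
  have h2 : ∑' β, f (β + Finsupp.single t 1) = (R t / R a : ℝ≥0) * wnorm R v := by
    unfold wnorm
    rw [← ENNReal.tsum_mul_left]
    refine tsum_congr fun β => ?_
    rw [← ENNReal.coe_mul, hf]
    have h := wt_add_single R β t
    have hs : ∑ b, (β + Finsupp.single t 1 : ι →₀ ℕ) b = (∑ b, β b) + 1 := by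
      simp [sum_add_distrib, Finsupp.single_apply]
    simp only [hs, coeff_integ_add, nnnorm_div, hsucc]
    congr 1
    push_cast at h ⊢
    rw [mul_comm _ (wt R (β + _)), h]
    field_simp
  rw [h1, ← h2, tsum_add_single_of_support (t := t) f
    (fun β hβ => by simp [hf, coeff_integ_eq_zero t v β hβ])]
  exact ENNReal.tsum_comp_le_tsum_of_injective (f := fun β : ι →₀ ℕ => β + Finsupp.single a 1)
    (add_left_injective _) f

/-! ### Completeness -/

/-- A weighted coefficient is bounded by the norm, so each coefficient sequence is Cauchy; the tail
bound for the limit then follows by exchanging the sums over steps and exponents. -/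
theorem exists_limit (R : ι → ℝ≥0) (hR : ∀ a, R a ≠ 0) (v : ℕ → MvPowerSeries ι ℝ)
    (ε : ℕ → ℝ≥0∞) (hε : ∑' n, ε n ≠ ⊤) (hv : ∀ n, wnorm R (v (n + 1) - v n) ≤ ε n) :
    ∃ w : MvPowerSeries ι ℝ, (∀ n, wnorm R (w - v n) ≤ ∑' k, ε (k + n)) ∧
      ∀ β, Filter.Tendsto (fun n => coeff β (v n)) Filter.atTop (nhds (coeff β w)) := by
  have hwt : ∀ β, wt R β ≠ 0 := fun β => (wt_pos hR β).ne'
  have hterm : ∀ β n, edist (coeff β (v n)) (coeff β (v (n + 1))) ≤ ε n / wt R β := by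
    intro β n
    rw [ENNReal.le_div_iff_mul_le (by simp [hwt β]) (by simp), edist_comm, edist_eq_enorm_sub,
      ← map_sub]
    refine le_trans ?_ (hv n)
    refine le_trans (le_of_eq ?_) (ENNReal.le_tsum β)
    rw [ENNReal.coe_mul]; rfl
  have hsum : ∀ β, ∑' n, ε n / wt R β ≠ ⊤ := fun β => by
    simp only [div_eq_mul_inv, ENNReal.tsum_mul_right]
    exact ENNReal.mul_ne_top hε (by simp [hwt β])
  choose w' hw using fun β => cauchySeq_tendsto_of_complete
    (cauchySeq_of_edist_le_of_tsum_ne_top _ (hterm β) (hsum β))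
  obtain ⟨w, rfl⟩ : ∃ w : MvPowerSeries ι ℝ, (fun β => coeff β w) = w' := ⟨w', rfl⟩
  refine ⟨w, fun n => ?_, hw⟩
  have hle : ∀ β, ((‖coeff β (w - v n)‖₊ * wt R β : ℝ≥0) : ℝ≥0∞) ≤
      ∑' k, ((‖coeff β (v (k + n + 1) - v (k + n))‖₊ * wt R β : ℝ≥0) : ℝ≥0∞) := by
    intro β
    have h1 := edist_le_tsum_of_edist_le_of_tendsto (f := fun k => coeff β (v (k + n)))
      (fun k => ((‖coeff β (v (k + n + 1) - v (k + n))‖₊ : ℝ≥0) : ℝ≥0∞))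
      (fun k => by
        rw [edist_comm, edist_eq_enorm_sub, ← map_sub, add_right_comm]; rfl)
      ((Filter.tendsto_add_atTop_iff_nat n).mpr (hw β)) 0
    rw [edist_comm, edist_eq_enorm_sub] at h1
    simp only [zero_add] at h1
    simp only [ENNReal.coe_mul, ENNReal.tsum_mul_right]
    gcongr
    exact h1
  refine (ENNReal.tsum_le_tsum hle).trans ?_
  rw [ENNReal.tsum_comm]
  exact ENNReal.tsum_le_tsum fun k => hv (k + n)

end MvPowerSeries

namespace MvPowerSeries

open scoped NNReal ENNReal Nat
open _root_.Finset

/-! ### Evaluation of power series -/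

section Eval

variable {ι : Type*} [Fintype ι]

/-- The value of the monomial `z^β`. -/
def mono (z : ι → ℝ) (β : ι →₀ ℕ) : ℝ := ∏ a, z a ^ β a

/-- The sum of a power series at `z`. -/
noncomputable def evalAt (z : ι → ℝ) (c : MvPowerSeries ι ℝ) : ℝ := ∑' β, coeff β c * mono z β

/-- Absolute convergence at all points of the polydisk of radius `ρ`. -/
def Conv (ρ : ℝ) (c : MvPowerSeries ι ℝ) : Prop :=
  Summable fun β : ι →₀ ℕ => |coeff β c| * ρ ^ (∑ a, β a)

theorem mono_add (z : ι → ℝ) (β γ : ι →₀ ℕ) : mono z (β + γ) = mono z β * mono z γ := by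
  simp [mono, pow_add, prod_mul_distrib]

theorem mono_zero (z : ι → ℝ) : mono z 0 = 1 := by simp [mono]

theorem mono_single [DecidableEq ι] (z : ι → ℝ) (a : ι) : mono z (Finsupp.single a 1) = z a := by
  unfold mono
  rw [prod_eq_single a (fun b _ hb => by simp [hb.symm]) (by simp)]
  simp

theorem abs_mono_le {z : ι → ℝ} {ρ : ℝ} (hz : ∀ a, |z a| ≤ ρ) (β : ι →₀ ℕ) :
    |mono z β| ≤ ρ ^ (∑ a, β a) := by
  rw [mono, abs_prod, ← prod_pow_eq_pow_sum]
  exact prod_le_prod (fun _ _ => abs_nonneg _) fun a _ => by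
    rw [abs_pow]; exact pow_le_pow_left₀ (abs_nonneg _) (hz a) _

theorem Conv.summable_norm {ρ : ℝ} {c : MvPowerSeries ι ℝ} (hc : Conv ρ c) {z : ι → ℝ}
    (hz : ∀ a, |z a| ≤ ρ) : Summable fun β => ‖coeff β c * mono z β‖ :=
  Summable.of_nonneg_of_le (fun _ => norm_nonneg _) (fun β => by
    rw [norm_mul, Real.norm_eq_abs, Real.norm_eq_abs]
    exact mul_le_mul_of_nonneg_left (abs_mono_le hz β) (abs_nonneg _)) hc

/-- A multinomial coefficient is one term in the expansion of (1 + ⋯ + 1)^n. -/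
theorem factorial_sum_le (β : ι →₀ ℕ) :
    (∑ a, β a)! ≤ (Fintype.card ι) ^ (∑ a, β a) * ∏ a, (β a)! := by
  classical
  rw [← Nat.multinomial_spec, mul_comm]
  refine Nat.mul_le_mul_right _ ?_
  have h := Finset.sum_pow_eq_sum_piAntidiag (univ : Finset ι) (fun _ => (1 : ℕ)) (∑ a, β a)
  simp only [sum_const, smul_eq_mul, mul_one, one_pow, prod_const_one, card_univ,
    Nat.cast_id] at h
  rw [h]
  exact single_le_sum (f := fun k => Nat.multinomial univ k) (fun _ _ => Nat.zero_le _)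
    (mem_piAntidiag.mpr ⟨rfl, fun _ _ => mem_univ _⟩)

/-- Replacing β!/|β|! by its lower bound card^(-|β|) turns the weighted norm into plain absolute
convergence, on a polydisk smaller by the number of variables. -/
theorem conv_of_wnorm {R : ι → ℝ≥0} {c : MvPowerSeries ι ℝ} (hc : wnorm R c ≠ ⊤) {ρ : ℝ≥0}
    (hρ : ∀ a, Fintype.card ι * ρ ≤ R a) : Conv (ρ : ℝ) c := by
  have h1 : Summable fun β => ‖coeff β c‖₊ * wt R β := ENNReal.tsum_coe_ne_top_iff_summable.mp hc
  have h2 : Summable fun β : ι →₀ ℕ => ‖coeff β c‖₊ * ρ ^ (∑ a, β a) := by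
    refine NNReal.summable_of_le (fun β => mul_le_mul_right ?_ _) h1
    unfold wt
    rw [le_div_iff₀ (by positivity)]
    have h3 : ((∑ a, β a)! : ℝ≥0) ≤ (Fintype.card ι : ℝ≥0) ^ (∑ a, β a) * ∏ a, ((β a)! : ℝ≥0) := by
      exact_mod_cast factorial_sum_le β
    calc _ ≤ ρ ^ (∑ a, β a) * ((Fintype.card ι : ℝ≥0) ^ (∑ a, β a) * ∏ a, ((β a)! : ℝ≥0)) :=
          mul_le_mul_right h3 _
      _ = (∏ a, (Fintype.card ι * ρ) ^ β a) * ∏ a, ((β a)! : ℝ≥0) := by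
          rw [← mul_assoc, ← mul_pow, mul_comm ρ, prod_pow_eq_pow_sum]
      _ ≤ _ := by
          rw [← prod_mul_distrib]
          gcongr with a
          exact hρ a
  have h4 := NNReal.summable_coe.mpr h2
  unfold Conv
  convert h4 using 2
  simp

theorem evalAt_add {ρ : ℝ} {c d : MvPowerSeries ι ℝ} (hc : Conv ρ c) (hd : Conv ρ d) {z : ι → ℝ}
    (hz : ∀ a, |z a| ≤ ρ) : evalAt z (c + d) = evalAt z c + evalAt z d := by
  unfold evalAt
  rw [← (hc.summable_norm hz).of_norm.tsum_add (hd.summable_norm hz).of_norm]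
  simp [add_mul]

theorem evalAt_mul [DecidableEq ι] {ρ : ℝ} {c d : MvPowerSeries ι ℝ} (hc : Conv ρ c)
    (hd : Conv ρ d) {z : ι → ℝ} (hz : ∀ a, |z a| ≤ ρ) :
    evalAt z (c * d) = evalAt z c * evalAt z d := by
  unfold evalAt
  have h1 := hc.summable_norm hz
  have h2 := hd.summable_norm hz
  rw [h1.of_norm.tsum_mul_tsum_eq_tsum_sum_antidiagonal h2.of_norm
    (summable_mul_of_summable_norm h1 h2)]
  refine tsum_congr fun β => ?_
  rw [coeff_mul, sum_mul]
  refine sum_congr rfl fun p hp => ?_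
  rw [HasAntidiagonal.mem_antidiagonal] at hp
  rw [← hp, mono_add]
  ring

theorem evalAt_C [DecidableEq ι] (z : ι → ℝ) (r : ℝ) : evalAt z (C r) = r := by
  unfold evalAt
  rw [tsum_eq_single 0 (fun β hβ => by simp [coeff_C, hβ])]
  simp [mono_zero]

theorem evalAt_X [DecidableEq ι] (z : ι → ℝ) (a : ι) : evalAt z (X a) = z a := by
  unfold evalAt
  rw [tsum_eq_single (Finsupp.single a 1) (fun β hβ => by simp [coeff_X, hβ])]
  simp [mono_single, coeff_X]

theorem evalAt_origin (c : MvPowerSeries ι ℝ) : evalAt 0 c = constantCoeff c := by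
  classical
  unfold evalAt
  rw [tsum_eq_single 0 (fun β hβ => ?_)]
  · simp [mono_zero]
  · obtain ⟨a, ha⟩ := Finsupp.ne_iff.mp hβ
    rw [mono, prod_eq_zero (mem_univ a) (by simpa using ha), mul_zero]

theorem exists_succ_mul_pow_le {ρ ρ' : ℝ} (h0 : 0 < ρ') (h : ρ' < ρ) :
    ∃ K, ∀ n : ℕ, ((n : ℝ) + 1) * ρ' ^ n ≤ K * ρ ^ (n + 1) := by
  have hρ : 0 < ρ := h0.trans h
  have h1 : ‖ρ' / ρ‖ < 1 := by
    rw [Real.norm_of_nonneg (by positivity), div_lt_one hρ]; exact h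
  have h2 : Summable fun n : ℕ => ((n : ℝ) ^ 1) * (ρ' / ρ) ^ n :=
    summable_pow_mul_geometric_of_norm_lt_one 1 h1
  have h3 : Summable fun n : ℕ => ((n : ℝ) + 1) * (ρ' / ρ) ^ n := by
    have := h2.add (summable_geometric_of_norm_lt_one h1)
    refine this.congr fun n => by ring
  refine ⟨(∑' n : ℕ, ((n : ℝ) + 1) * (ρ' / ρ) ^ n) / ρ, fun n => ?_⟩
  have h4 := h3.le_tsum n fun _ _ => by positivity
  rw [div_pow, ← mul_div_assoc, div_le_iff₀ (by positivity)] at h4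
  rw [pow_succ]
  calc _ ≤ _ := h4
    _ = _ := by field_simp

theorem sum_add_single [DecidableEq ι] (γ : ι →₀ ℕ) (a : ι) :
    ∑ b, (γ + Finsupp.single a 1 : ι →₀ ℕ) b = (∑ b, γ b) + 1 := by
  simp [sum_add_distrib, Finsupp.single_apply]

theorem Conv.pderiv [DecidableEq ι] {ρ ρ' : ℝ} {c : MvPowerSeries ι ℝ} (hc : Conv ρ c)
    (h0 : 0 < ρ') (h : ρ' < ρ) (a : ι) : Conv ρ' (MvPowerSeries.pderiv ℝ a c) := by
  obtain ⟨K, hK⟩ := exists_succ_mul_pow_le h0 h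
  have h1 := (hc.comp_injective (add_left_injective (Finsupp.single a 1))).mul_left K
  refine Summable.of_nonneg_of_le (fun _ => by positivity) (fun γ => ?_) h1
  have hle : ((γ a : ℝ) + 1) ≤ ((∑ b, γ b : ℕ) : ℝ) + 1 := by
    have := single_le_sum (f := fun b => γ b) (fun _ _ => Nat.zero_le _) (mem_univ a)
    exact_mod_cast Nat.succ_le_succ this
  simp only [Function.comp]
  rw [coeff_pderiv, abs_mul, abs_of_nonneg (by positivity : (0 : ℝ) ≤ (γ a : ℝ) + 1),
    sum_add_single]
  calc _ = |coeff (γ + Finsupp.single a 1) c| * (((γ a : ℝ) + 1) * ρ' ^ (∑ b, γ b)) := by ring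
    _ ≤ |coeff (γ + Finsupp.single a 1) c| * (K * ρ ^ ((∑ b, γ b) + 1)) := by
        refine mul_le_mul_of_nonneg_left (le_trans ?_ (hK _)) (abs_nonneg _)
        exact mul_le_mul_of_nonneg_right hle (by positivity)
    _ = _ := by ring

end Eval

/-! ### Termwise differentiation -/

section Calculus

variable {m : ℕ}

theorem hasFDerivAt_mono (β : Fin m →₀ ℕ) (z : CoordSpace m) :
    HasFDerivAt (fun z : CoordSpace m => mono z β)
      (∑ a, ((β a : ℝ) * mono z (β - Finsupp.single a 1)) •
        (EuclideanSpace.proj a : CoordSpace m →L[ℝ] ℝ)) z := by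
  have h1 : ∀ a ∈ (univ : Finset (Fin m)), HasFDerivAt (fun z : CoordSpace m => z a ^ β a)
      (((β a : ℝ) * z a ^ (β a - 1)) • (EuclideanSpace.proj a : CoordSpace m →L[ℝ] ℝ)) z := by
    intro a _
    have := (hasDerivAt_pow (β a) (z a)).comp_hasFDerivAt z
      ((EuclideanSpace.proj a : CoordSpace m →L[ℝ] ℝ).hasFDerivAt)
    exact this
  have h2 := HasFDerivAt.finsetProd h1
  unfold mono
  refine h2.congr_fderiv (sum_congr rfl fun a _ => ?_)
  rw [smul_smul]
  congr 1
  rw [← mul_prod_erase univ _ (mem_univ a)]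
  have : ∀ b ∈ univ.erase a, z b ^ ((β - Finsupp.single a 1 : Fin m →₀ ℕ) b) = z b ^ β b := by
    intro b hb
    simp [(ne_of_mem_erase hb).symm]
  rw [prod_congr rfl this]
  simp
  ring

theorem tsum_coeff_pderiv (c : MvPowerSeries (Fin m) ℝ) (a : Fin m) (f : (Fin m →₀ ℕ) → ℝ) :
    ∑' β : Fin m →₀ ℕ, coeff β c * (β a * f (β - Finsupp.single a 1)) =
      ∑' γ, coeff γ (pderiv ℝ a c) * f γ := by
  rw [← Function.Injective.tsum_eq (add_left_injective (Finsupp.single a 1))]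
  · refine tsum_congr fun γ => ?_
    simp [coeff_pderiv]
    ring
  · intro β hβ
    have : β a ≠ 0 := fun h => hβ (by simp [h])
    exact ⟨β - Finsupp.single a 1, tsub_add_cancel_of_le (by
      simpa using Nat.one_le_iff_ne_zero.mpr this)⟩

theorem summable_coeff_pderiv (c : MvPowerSeries (Fin m) ℝ) (a : Fin m) (f : (Fin m →₀ ℕ) → ℝ)
    (h : Summable fun γ => coeff γ (pderiv ℝ a c) * f γ) :
    Summable fun β : Fin m →₀ ℕ => coeff β c * (β a * f (β - Finsupp.single a 1)) := by
  rw [← (add_left_injective (Finsupp.single a 1)).summable_iff]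
  · refine h.congr fun γ => ?_
    simp [coeff_pderiv]
    ring
  · intro β hβ
    have : β a = 0 := by
      by_contra h0
      exact hβ ⟨β - Finsupp.single a 1, tsub_add_cancel_of_le (by
        simpa using Nat.one_le_iff_ne_zero.mpr h0)⟩
    simp [this]

theorem hasFDerivAt_evalAt {ρ : ℝ} {c : MvPowerSeries (Fin m) ℝ} (hc : Conv ρ c)
    {z : CoordSpace m} (hz : ‖z‖ < ρ) :
    HasFDerivAt (fun z : CoordSpace m => evalAt z c)
      (∑ a, evalAt z (pderiv ℝ a c) • (EuclideanSpace.proj a : CoordSpace m →L[ℝ] ℝ)) z := by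
  -- The differentiated series is only known to converge absolutely on radii strictly below `ρ`, so
  -- the uniform majorant is taken at an intermediate radius.
  obtain ⟨ρ', hz', hρ'⟩ := exists_between hz
  have h0 : 0 < ρ' := (norm_nonneg z).trans_lt hz'
  have hcoord : ∀ w ∈ Metric.ball (0 : CoordSpace m) ρ', ∀ a, |w a| ≤ ρ' := fun w hw a => by
    have h1 := PiLp.norm_apply_le w a
    rw [mem_ball_zero_iff] at hw
    exact (h1.trans hw.le)
  have hpd := fun a => hc.pderiv h0 hρ' a
  have hsum : Summable fun β : Fin m →₀ ℕ => ∑ a, |coeff β c * (β a *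
      ρ' ^ (∑ b, (β - Finsupp.single a 1 : Fin m →₀ ℕ) b))| := by
    refine summable_sum fun a _ => (summable_coeff_pderiv c a
      (fun γ => ρ' ^ (∑ b, γ b)) (Summable.of_norm ?_)).abs
    refine (hpd a).congr fun β => ?_
    rw [norm_mul, Real.norm_eq_abs, Real.norm_of_nonneg (by positivity)]
  have key := hasFDerivAt_tsum_of_isPreconnected (𝕜 := ℝ) (u := fun β : Fin m →₀ ℕ => ∑ a,
      |coeff β c * (β a * ρ' ^ (∑ b, (β - Finsupp.single a 1 : Fin m →₀ ℕ) b))|)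
    (f := fun β (z : CoordSpace m) => coeff β c * mono z β)
    (f' := fun β z => coeff β c • ∑ a, ((β a : ℝ) * mono z (β - Finsupp.single a 1)) •
        (EuclideanSpace.proj a : CoordSpace m →L[ℝ] ℝ)) hsum
    Metric.isOpen_ball (convex_ball (0 : CoordSpace m) ρ').isPreconnected
    (fun β w _ => (hasFDerivAt_mono β w).const_mul (coeff β c))
    (fun β w hw => by
      rw [smul_sum]
      refine (norm_sum_le _ _).trans (sum_le_sum fun a _ => ?_)
      rw [smul_smul, norm_smul, ← mul_assoc, norm_mul, norm_mul, abs_mul, abs_mul,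
        Real.norm_eq_abs, Real.norm_eq_abs, Real.norm_eq_abs, mul_assoc, mul_assoc]
      refine mul_le_mul_of_nonneg_left ?_ (abs_nonneg _)
      refine mul_le_mul_of_nonneg_left ?_ (abs_nonneg _)
      rw [abs_of_nonneg (by positivity : 0 ≤ ρ' ^ _)]
      have hn : ‖(EuclideanSpace.proj a : CoordSpace m →L[ℝ] ℝ)‖ ≤ 1 :=
        ContinuousLinearMap.opNorm_le_bound _ zero_le_one fun v => by
          rw [one_mul]; exact PiLp.norm_apply_le v a
      calc _ ≤ |mono w (β - Finsupp.single a 1)| * 1 :=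
            mul_le_mul_of_nonneg_left hn (abs_nonneg _)
        _ ≤ _ := by rw [mul_one]; exact abs_mono_le (hcoord w hw) _)
    (x₀ := z) (x := z) (mem_ball_zero_iff.mpr hz')
    ((hc.summable_norm fun a => (hcoord z (mem_ball_zero_iff.mpr hz') a).trans hρ'.le).of_norm)
    (mem_ball_zero_iff.mpr hz')
  have hz'' := hcoord z (mem_ball_zero_iff.mpr hz')
  refine key.congr_fderiv ?_
  have hsa : ∀ a, Summable fun β : Fin m →₀ ℕ =>
      coeff β c * (β a * mono z (β - Finsupp.single a 1)) := fun a =>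
    summable_coeff_pderiv c a _ ((hpd a).summable_norm hz'').of_norm
  simp only [smul_sum, smul_smul]
  rw [Summable.tsum_finsetSum fun a _ => (hsa a).smul_const _]
  refine sum_congr rfl fun a _ => ?_
  rw [(hsa a).tsum_smul_const, tsum_coeff_pderiv]
  rfl

theorem partialD_evalAt {ρ : ℝ} {c : MvPowerSeries (Fin m) ℝ} (hc : Conv ρ c)
    {z : CoordSpace m} (hz : ‖z‖ < ρ) (a : Fin m) :
    Coord.partialD (fun z : CoordSpace m => evalAt z c) a z = evalAt z (pderiv ℝ a c) := by
  unfold Coord.partialD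
  rw [(hasFDerivAt_evalAt hc hz).fderiv]
  simp

/-- Induction on the order of smoothness, for all series and radii at once: the derivative consists
of other series, known to converge only on smaller balls. -/
theorem contDiffOn_evalAt (n : ℕ) : ∀ (c : MvPowerSeries (Fin m) ℝ) (ρ : ℝ), Conv ρ c →
    ContDiffOn ℝ n (fun z : CoordSpace m => evalAt z c) (Metric.ball 0 ρ) := by
  induction n with
  | zero =>
    intro c ρ hc
    exact contDiffOn_zero.mpr fun z hz => (hasFDerivAt_evalAt hc
      (mem_ball_zero_iff.mp hz)).continuousAt.continuousWithinAt
  | succ n ih =>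
    intro c ρ hc
    rw [Nat.cast_add, Nat.cast_one, contDiffOn_succ_iff_fderiv_of_isOpen Metric.isOpen_ball]
    refine ⟨fun z hz => (hasFDerivAt_evalAt hc
      (mem_ball_zero_iff.mp hz)).differentiableAt.differentiableWithinAt, by simp, ?_⟩
    intro z hz
    rw [mem_ball_zero_iff] at hz
    obtain ⟨ρ', hz', hρ'⟩ := exists_between hz
    have h0 : 0 < ρ' := (norm_nonneg z).trans_lt hz'
    have h1 : ContDiffOn ℝ n (fun z : CoordSpace m => ∑ a, evalAt z (pderiv ℝ a c) •
        (EuclideanSpace.proj a : CoordSpace m →L[ℝ] ℝ)) (Metric.ball 0 ρ') :=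
      ContDiffOn.sum fun a _ => (ih _ ρ' (hc.pderiv h0 hρ' a)).smul contDiffOn_const
    have h2 := (h1.contDiffAt (Metric.isOpen_ball.mem_nhds (mem_ball_zero_iff.mpr hz')))
    refine (h2.congr_of_eventuallyEq ?_).contDiffWithinAt
    filter_upwards [Metric.isOpen_ball.mem_nhds (mem_ball_zero_iff.mpr hz)] with w hw
    exact (hasFDerivAt_evalAt hc (mem_ball_zero_iff.mp hw)).fderiv

theorem contDiffOn_infty_evalAt {c : MvPowerSeries (Fin m) ℝ} {ρ : ℝ} (hc : Conv ρ c) :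
    ContDiffOn ℝ ∞ (fun z : CoordSpace m => evalAt z c) (Metric.ball 0 ρ) :=
  contDiffOn_infty.mpr fun n => contDiffOn_evalAt n c ρ hc

end Calculus

end MvPowerSeries

/-! ### Lipschitz estimates for polynomials in normed algebras -/

section PolyEstimate

open scoped NNReal ENNReal

/-- A submultiplicative extended norm on a commutative real algebra. -/
structure IsAlgNorm {A : Type} [CommRing A] [Algebra ℝ A] (N : A → ℝ≥0∞) : Prop where
  add_le : ∀ x y, N (x + y) ≤ N x + N y
  mul_le : ∀ x y, N (x * y) ≤ N x * N y
  neg : ∀ x, N (-x) = N x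
  algebraMap_le : ∀ r : ℝ, N (algebraMap ℝ A r) ≤ ‖r‖₊

namespace IsAlgNorm

variable {A : Type} [CommRing A] [Algebra ℝ A] {N : A → ℝ≥0∞}

theorem zero (hN : IsAlgNorm N) : N 0 = 0 := by
  have := hN.algebraMap_le 0
  simpa using this

theorem sub_le (hN : IsAlgNorm N) (x y : A) : N (x - y) ≤ N x + N y := by
  rw [sub_eq_add_neg]
  exact (hN.add_le _ _).trans (by rw [hN.neg])

theorem smul_le (hN : IsAlgNorm N) (r : ℝ) (x : A) : N (r • x) ≤ ‖r‖₊ * N x := by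
  rw [Algebra.smul_def]
  exact (hN.mul_le _ _).trans (mul_le_mul_left (hN.algebraMap_le r) _)

theorem sum_le (hN : IsAlgNorm N) {ι : Type*} (s : Finset ι) (f : ι → A) :
    N (∑ i ∈ s, f i) ≤ ∑ i ∈ s, N (f i) := by
  classical
  induction s using Finset.induction_on with
  | empty => simp [hN.zero]
  | insert a s ha ih =>
    rw [Finset.sum_insert ha, Finset.sum_insert ha]
    exact (hN.add_le _ _).trans (by gcongr)

end IsAlgNorm

open MvPolynomial in
-- Here `l` is the linear part of `F`, and the last bound says that what remains is quadratic. Both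
-- `l` and `C` are chosen before the algebra and the norm: this allows `l` to be identified by
-- testing in ℝ and then used for power series. The bounds are proved together because the product
-- step for the last one needs the other two.
theorem MvPolynomial.exists_norm_estimate {σ : Type*} (F : MvPolynomial σ ℝ) :
    ∃ (l : σ →₀ ℝ) (C : ℝ≥0), ∀ (A : Type) [CommRing A] [Algebra ℝ A] (N : A → ℝ≥0∞),
      IsAlgNorm N → ∀ δ : ℝ≥0, δ ≤ 1 → ∀ (x y : σ → A) (D : ℝ≥0∞), (∀ i, N (x i) ≤ δ) →
      (∀ i, N (y i) ≤ δ) → (∀ i, N (x i - y i) ≤ D) →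
      N (aeval x F - aeval y F) ≤ C * D ∧
      N (aeval x F - algebraMap ℝ A (constantCoeff F)) ≤ C * δ ∧
      N (aeval x F - aeval y F - l.sum fun i a => a • (x i - y i)) ≤ C * δ * D := by
  classical
  induction F using MvPolynomial.induction_on with
  | C a =>
    refine ⟨0, 0, fun A _ _ N hN δ _ x y D _ _ _ => ?_⟩
    simp [hN.zero]
  | add F G hF hG =>
    obtain ⟨l₁, C₁, h₁⟩ := hF
    obtain ⟨l₂, C₂, h₂⟩ := hG
    refine ⟨l₁ + l₂, C₁ + C₂, fun A _ _ N hN δ hδ x y D hx hy hD => ?_⟩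
    obtain ⟨a₁, b₁, c₁⟩ := h₁ A N hN δ hδ x y D hx hy hD
    obtain ⟨a₂, b₂, c₂⟩ := h₂ A N hN δ hδ x y D hx hy hD
    rw [Finsupp.sum_add_index' (by simp) (by intro i a b; rw [add_smul])]
    simp only [map_add, ENNReal.coe_add, add_mul]
    refine ⟨?_, ?_, ?_⟩
    · rw [add_sub_add_comm]
      exact (hN.add_le _ _).trans (add_le_add a₁ a₂)
    · rw [add_sub_add_comm]
      exact (hN.add_le _ _).trans (add_le_add b₁ b₂)
    · rw [add_sub_add_comm, add_sub_add_comm]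
      exact (hN.add_le _ _).trans (add_le_add c₁ c₂)
  | mul_X F j hF =>
    obtain ⟨l, C, h⟩ := hF
    set c := constantCoeff F with hc
    -- Beyond its constant term `F` contributes at least one more small factor, so the linear part
    -- of `F * X j` is the constant term of `F` times `X j`.
    refine ⟨Finsupp.single j c, 2 * C + ‖c‖₊, fun A _ _ N hN δ hδ x y D hx hy hD => ?_⟩
    obtain ⟨a₁, b₁, -⟩ := h A N hN δ hδ x y D hx hy hD
    obtain ⟨-, b₂, -⟩ := h A N hN δ hδ y x D hy hx (fun i => by
      rw [← neg_sub, hN.neg]; exact hD i)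
    rw [Finsupp.sum_single_index (by simp)]
    simp only [map_mul, aeval_X, constantCoeff_X, mul_zero, map_zero, sub_zero]
    set f := aeval x F
    set g := aeval y F
    have hδ' : (δ : ℝ≥0∞) ≤ 1 := by exact_mod_cast hδ
    have hbd : ∀ f' : A, N (f' - algebraMap ℝ A c) ≤ C * δ → N f' ≤ C + ‖c‖₊ := fun f' hf' => by
      calc N f' = N ((f' - algebraMap ℝ A c) + algebraMap ℝ A c) := by rw [sub_add_cancel]
        _ ≤ C * δ + ‖c‖₊ := (hN.add_le _ _).trans (add_le_add hf' (hN.algebraMap_le c))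
        _ ≤ C * 1 + ‖c‖₊ := by gcongr
        _ = _ := by rw [mul_one]
    push_cast
    refine ⟨?_, ?_, ?_⟩
    · calc N (f * x j - g * y j) = N ((f - g) * x j + g * (x j - y j)) := by congr 1; ring
        _ ≤ N (f - g) * N (x j) + N g * N (x j - y j) :=
            (hN.add_le _ _).trans (add_le_add (hN.mul_le _ _) (hN.mul_le _ _))
        _ ≤ (C * D) * 1 + (C + ‖c‖₊) * D := by
            gcongr
            · exact (hx j).trans hδ'
            · exact hbd g b₂
            · exact hD j
        _ = _ := by ring
    · calc N (f * x j) ≤ N f * N (x j) := hN.mul_le _ _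
        _ ≤ (C + ‖c‖₊) * δ := by
            gcongr
            · exact hbd f b₁
            · exact hx j
        _ ≤ (2 * C + ‖c‖₊) * δ := by
            gcongr
            exact le_mul_of_one_le_left' one_le_two
    · calc N (f * x j - g * y j - c • (x j - y j))
          = N ((f - g) * x j + (g - algebraMap ℝ A c) * (x j - y j)) := by
            congr 1; rw [Algebra.smul_def]; ring
        _ ≤ N (f - g) * N (x j) + N (g - algebraMap ℝ A c) * N (x j - y j) :=
            (hN.add_le _ _).trans (add_le_add (hN.mul_le _ _) (hN.mul_le _ _))
        _ ≤ (C * D) * δ + (C * δ) * D := by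
            gcongr
            · exact hx j
            · exact hD j
        _ = 2 * C * δ * D := by ring
        _ ≤ _ := by
            gcongr
            exact le_self_add

theorem isAlgNorm_nnnorm : IsAlgNorm (A := ℝ) fun x => (‖x‖₊ : ℝ≥0∞) where
  add_le x y := by exact_mod_cast nnnorm_add_le x y
  mul_le x y := by rw [nnnorm_mul, ENNReal.coe_mul]
  neg x := by rw [nnnorm_neg]
  algebraMap_le r := le_rfl

theorem MvPowerSeries.isAlgNorm_wnorm {m : ℕ} (R : Fin m → ℝ≥0) :
    IsAlgNorm (wnorm R) where
  add_le := wnorm_add_le R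
  mul_le := wnorm_mul_le R
  neg := wnorm_neg R
  algebraMap_le r := by
    rw [MvPowerSeries.algebraMap_apply]
    exact (wnorm_C R _).le

end PolyEstimate

/-! ### Jets and the Cauchy–Kovalevskaya theorem for polynomial equations -/

/-- The coordinates on the space of second order jets of `k` functions of `m` variables. -/
inductive JetVar (m k : ℕ)
  /-- the coordinate `z_a` -/
  | pt (a : Fin m)
  /-- the value `u_j` -/
  | val (j : Fin k)
  /-- the derivative `∂_a u_j` -/
  | d1 (j : Fin k) (a : Fin m)
  /-- the derivative `∂_b ∂_a u_j` -/
  | d2 (j : Fin k) (a b : Fin m)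

/-- Assemble a jet from its components. -/
def jetOf {A : Type*} {m k : ℕ} (z : Fin m → A) (u : Fin k → A) (p : Fin k → Fin m → A)
    (s : Fin k → Fin m → Fin m → A) : JetVar m k → A
  | .pt a => z a
  | .val j => u j
  | .d1 j a => p j a
  | .d2 j a b => s j a b

/-- The 2-jet of the functions `u` at the point `z`. -/
noncomputable def jetAt {m k : ℕ} (u : Fin k → CoordSpace m → ℝ) (z : CoordSpace m) :
    JetVar m k → ℝ :=
  jetOf z (fun j => u j z) (fun j a => Coord.partialD (u j) a z)
    (fun j a b => Coord.partialD (Coord.partialD (u j) a) b z)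

/-- The jet at the origin whose only nonzero components are `∂_t ∂_t u_j = w_j`. -/
def jetPure {m k : ℕ} (t : Fin m) (w : Fin k → ℝ) : JetVar m k → ℝ :=
  jetOf 0 0 0 fun j a b => if a = t ∧ b = t then w j else 0

namespace MvPowerSeries

open scoped NNReal ENNReal

variable {m k : ℕ}

/-- The formal 2-jet of the twofold integrals, in direction `t`, of the series `v`. -/
noncomputable def formalJet (t : Fin m) (v : Fin k → MvPowerSeries (Fin m) ℝ) :
    JetVar m k → MvPowerSeries (Fin m) ℝ :=
  jetOf X (fun j => integ t (integ t (v j))) (fun j a => pderiv ℝ a (integ t (integ t (v j))))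
    (fun j a b => pderiv ℝ b (pderiv ℝ a (integ t (integ t (v j)))))

theorem formalJet_sub (t : Fin m) (v w : Fin k → MvPowerSeries (Fin m) ℝ) (i : JetVar m k) :
    formalJet t v i - formalJet t w i =
      match i with
      | .pt _ => 0
      | i => formalJet t (fun j => v j - w j) i := by
  cases i <;> simp [formalJet, jetOf, integ_sub, map_sub]

/-- The radii `r`, except for `r²` in direction `t`. -/
def radii (t : Fin m) (r : ℝ≥0) (a : Fin m) : ℝ≥0 := if a = t then r * r else r

theorem radii_ne_zero (t : Fin m) {r : ℝ≥0} (hr : r ≠ 0) (a : Fin m) : radii t r a ≠ 0 := by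
  unfold radii; split_ifs <;> simp [hr]

theorem radii_le (t : Fin m) {r : ℝ≥0} (hr : r ≤ 1) (a : Fin m) : radii t r a ≤ r := by
  unfold radii; split_ifs
  · exact mul_le_of_le_one_left' hr
  · exact le_rfl

theorem wnorm_pderiv_integ_le_self (t : Fin m) {r : ℝ≥0} (hr0 : r ≠ 0) (hr : r ≤ 1) (a : Fin m)
    (v : MvPowerSeries (Fin m) ℝ) :
    wnorm (radii t r) (pderiv ℝ a (integ t v)) ≤ wnorm (radii t r) v := by
  refine (wnorm_pderiv_integ_le _ t a (radii_ne_zero t hr0 a) v).trans ?_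
  have h : radii t r t / radii t r a ≤ 1 := by
    refine div_le_one_of_le₀ ?_ (by positivity)
    unfold radii
    split_ifs <;> simp_all
    exact mul_le_of_le_one_left' hr
  calc _ ≤ (1 : ℝ≥0∞) * wnorm (radii t r) v := by gcongr; exact_mod_cast h
    _ = _ := one_mul _

/-- The purpose of the anisotropic radii: the ratio r²/r leaves a gain of `r` whenever the
derivative is not along `t`. -/
theorem wnorm_pderiv_integ_le_mul (t : Fin m) {r : ℝ≥0} (hr0 : r ≠ 0) {a : Fin m}
    (ha : a ≠ t) (v : MvPowerSeries (Fin m) ℝ) :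
    wnorm (radii t r) (pderiv ℝ a (integ t v)) ≤ r * wnorm (radii t r) v := by
  refine (wnorm_pderiv_integ_le _ t a (radii_ne_zero t hr0 a) v).trans (le_of_eq ?_)
  congr 2
  simp [radii, ha, hr0]

theorem wnorm_integ_le_mul (t : Fin m) {r : ℝ≥0} (hr : r ≤ 1)
    (v : MvPowerSeries (Fin m) ℝ) :
    wnorm (radii t r) (integ t v) ≤ r * wnorm (radii t r) v :=
  (wnorm_integ_le _ t v).trans (by gcongr; exact_mod_cast radii_le t hr t)

theorem wnorm_integ_le_self (t : Fin m) {r : ℝ≥0} (hr : r ≤ 1)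
    (v : MvPowerSeries (Fin m) ℝ) :
    wnorm (radii t r) (integ t v) ≤ wnorm (radii t r) v :=
  (wnorm_integ_le_mul t hr v).trans (mul_le_of_le_one_left' (by exact_mod_cast hr))

/-- Two integrations stand against at most two derivatives, and at least one integration is either
uncompensated or paired with a derivative transverse to `t`. Either case gives a factor `r`. Only
the entry ∂_t∂_t, which is `v` itself, gains nothing. -/
theorem wnorm_formalJet_le_mul (t : Fin m) {r : ℝ≥0} (hr0 : r ≠ 0) (hr : r ≤ 1)
    (v : Fin k → MvPowerSeries (Fin m) ℝ) {D : ℝ≥0∞} (hD : ∀ j, wnorm (radii t r) (v j) ≤ D)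
    (i : JetVar m k) (hi : ∀ j, i ≠ .d2 j t t) (hi' : ∀ a, i ≠ .pt a) :
    wnorm (radii t r) (formalJet t v i) ≤ r * D := by
  have hstep : ∀ j, wnorm (radii t r) (integ t (v j)) ≤ r * D := fun j =>
    (wnorm_integ_le_mul t hr _).trans (by gcongr; exact hD j)
  cases i with
  | pt a => exact absurd rfl (hi' a)
  | val j => exact (wnorm_integ_le_self t hr _).trans (hstep j)
  | d1 j a => exact (wnorm_pderiv_integ_le_self t hr0 hr a _).trans (hstep j)
  | d2 j a b =>
    change wnorm (radii t r) (pderiv ℝ b (pderiv ℝ a (integ t (integ t (v j))))) ≤ _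
    by_cases ha : a = t
    · subst ha
      have hb : b ≠ a := fun h => hi j (by rw [h])
      rw [pderiv_integ_self]
      exact (wnorm_pderiv_integ_le_mul a hr0 hb _).trans (by gcongr; exact hD j)
    · rw [pderiv_integ_comm ha]
      refine (wnorm_pderiv_integ_le_self t hr0 hr b _).trans ?_
      exact (wnorm_pderiv_integ_le_mul t hr0 ha _).trans (by gcongr; exact hD j)

theorem formalJet_d2_self (t : Fin m) (v : Fin k → MvPowerSeries (Fin m) ℝ) (j : Fin k) :
    formalJet t v (.d2 j t t) = v j := by
  simp [formalJet, jetOf, pderiv_integ_self]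

theorem wnorm_formalJet_le (t : Fin m) {r ρ : ℝ≥0} (hr0 : r ≠ 0) (hr : r ≤ 1) (hrρ : r ≤ ρ)
    (v : Fin k → MvPowerSeries (Fin m) ℝ) (hv : ∀ j, wnorm (radii t r) (v j) ≤ ρ)
    (i : JetVar m k) : wnorm (radii t r) (formalJet t v i) ≤ ρ := by
  by_cases hpt : ∃ a, i = .pt a
  · obtain ⟨a, rfl⟩ := hpt
    change wnorm (radii t r) (X a) ≤ _
    rw [wnorm_X]
    exact_mod_cast (radii_le t hr a).trans hrρ
  by_cases hd : ∃ j, i = .d2 j t t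
  · obtain ⟨j, rfl⟩ := hd
    rw [formalJet_d2_self]
    exact hv j
  push Not at hpt hd
  refine (wnorm_formalJet_le_mul t hr0 hr v hv i hd hpt).trans ?_
  exact mul_le_of_le_one_left' (by exact_mod_cast hr)

theorem wnorm_formalJet_sub_le_mul (t : Fin m) {r : ℝ≥0} (hr0 : r ≠ 0) (hr : r ≤ 1)
    (v w : Fin k → MvPowerSeries (Fin m) ℝ) {D : ℝ≥0∞}
    (hD : ∀ j, wnorm (radii t r) (v j - w j) ≤ D)
    (i : JetVar m k) (hi : ∀ j, i ≠ .d2 j t t) :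
    wnorm (radii t r) (formalJet t v i - formalJet t w i) ≤ r * D := by
  rw [formalJet_sub]
  cases i with
  | pt a => simp [wnorm_zero]
  | _ => exact wnorm_formalJet_le_mul t hr0 hr _ hD _ hi (by simp)

theorem wnorm_formalJet_sub_le (t : Fin m) {r : ℝ≥0} (hr0 : r ≠ 0) (hr : r ≤ 1)
    (v w : Fin k → MvPowerSeries (Fin m) ℝ) {D : ℝ≥0∞}
    (hD : ∀ j, wnorm (radii t r) (v j - w j) ≤ D) (i : JetVar m k) :
    wnorm (radii t r) (formalJet t v i - formalJet t w i) ≤ D := by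
  by_cases hd : ∃ j, i = .d2 j t t
  · obtain ⟨j, rfl⟩ := hd
    rw [formalJet_d2_self, formalJet_d2_self]
    exact hD j
  · push Not at hd
    refine (wnorm_formalJet_sub_le_mul t hr0 hr v w hD i hd).trans ?_
    exact mul_le_of_le_one_left' (by exact_mod_cast hr)

theorem constantCoeff_formalJet (t : Fin m) (v : Fin k → MvPowerSeries (Fin m) ℝ)
    (hv : ∀ j, constantCoeff (v j) = 0) (i : JetVar m k) :
    constantCoeff (formalJet t v i) = 0 := by
  cases i with
  | pt a => exact constantCoeff_X a
  | val j => exact constantCoeff_integ t _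
  | d1 j a =>
    change constantCoeff (pderiv ℝ a (integ t (integ t (v j)))) = 0
    by_cases ha : a = t
    · subst ha; rw [pderiv_integ_self]; exact constantCoeff_integ a _
    · rw [pderiv_integ_comm ha]; exact constantCoeff_integ t _
  | d2 j a b =>
    change constantCoeff (pderiv ℝ b (pderiv ℝ a (integ t (integ t (v j))))) = 0
    by_cases ha : a = t
    · subst ha
      rw [pderiv_integ_self]
      by_cases hb : b = a
      · subst hb; rw [pderiv_integ_self]; exact hv j
      · rw [pderiv_integ_comm hb]; exact constantCoeff_integ a _
    · rw [pderiv_integ_comm ha]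
      by_cases hb : b = t
      · subst hb
        rw [pderiv_integ_self, pderiv_integ_comm ha]
        exact constantCoeff_integ b _
      · rw [pderiv_integ_comm hb]
        exact constantCoeff_integ t _

theorem wnorm_eq_zero {R : Fin m → ℝ≥0} (hR : ∀ a, R a ≠ 0) {c : MvPowerSeries (Fin m) ℝ}
    (hc : wnorm R c = 0) : c = 0 := by
  ext β
  have h := ENNReal.tsum_eq_zero.mp hc β
  have hwt : wt R β ≠ 0 := (wt_pos hR β).ne'
  simpa [hwt] using h

theorem constantCoeff_aeval {σ : Type*} (x : σ → MvPowerSeries (Fin m) ℝ)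
    (F : MvPolynomial σ ℝ) :
    constantCoeff (MvPolynomial.aeval x F) =
      MvPolynomial.eval (fun i => constantCoeff (x i)) F := by
  induction F using MvPolynomial.induction_on with
  | C a => simp [MvPowerSeries.algebraMap_apply]
  | add F G hF hG => simp [hF, hG]
  | mul_X F j hF => simp [hF]

end MvPowerSeries

/-! ### Contraction argument for the formal equation. -/

namespace MvPowerSeries

open scoped NNReal ENNReal

variable {m k : ℕ}

/-- A polynomial map of the 2-jet without linear terms in the variables `∂_t ∂_t u_j`, with
vanishing constant terms, has a fixed point in `v = ∂_t ∂_t u`. -/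
theorem exists_formal_fixedPoint (t : Fin m) (F : Fin k → MvPolynomial (JetVar m k) ℝ)
    (hF0 : ∀ i, MvPolynomial.constantCoeff (F i) = 0)
    (hF : ∀ (w : Fin k → ℝ) i, MvPolynomial.eval (jetPure t w) (F i) = 0) :
    ∃ (r : ℝ≥0) (v : Fin k → MvPowerSeries (Fin m) ℝ), r ≠ 0 ∧ r ≤ 1 ∧
      (∀ j, wnorm (radii t r) (v j) ≤ 1) ∧ (∀ j, constantCoeff (v j) = 0) ∧
      ∀ i, MvPolynomial.aeval (formalJet t v) (F i) = v i := by
  classical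
  choose l C hest using fun i => (F i).exists_norm_estimate
  -- On the pure jet with single entry `x` the polynomial vanishes, so the quadratic remainder bound
  -- reads |l| x ≤ C x². Letting `x` become small removes from the linear part the entries that gain
  -- no factor `r`.
  have hl : ∀ i j, l i (.d2 j t t) = 0 := by
    intro i j
    have hx : ∀ x : ℝ≥0, x ≤ 1 → 0 < x → ‖l i (.d2 j t t)‖₊ ≤ C i * x := by
      intro x hx hx0
      have hb : ∀ i' : JetVar m k, (‖jetPure t (Pi.single j (x : ℝ)) i'‖₊ : ℝ≥0∞) ≤ x := by
        intro i'
        rw [ENNReal.coe_le_coe]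
        cases i' <;> simp [jetPure, jetOf]
        split_ifs
        · by_cases hj : ‹Fin k› = j
          · subst hj; simp
          · simp [hj]
        · simp
      have h := (hest i ℝ _ isAlgNorm_nnnorm x hx (jetPure t (Pi.single j (x : ℝ))) 0 x hb
        (by simp) (by simpa using hb)).2.2
      have h0 : MvPolynomial.eval 0 (F i) = 0 := by
        rw [← hF0 i]; exact RingHom.congr_fun MvPolynomial.eval_zero _
      have hsum : ((l i).sum fun i' a => a • (jetPure t (Pi.single j (x : ℝ)) i' -
          (0 : JetVar m k → ℝ) i')) = l i (.d2 j t t) * x := by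
        rw [Finsupp.sum, Finset.sum_eq_single (.d2 j t t)]
        · simp [jetPure, jetOf]
        · intro i' _ hi'
          suffices jetPure t (Pi.single j (x : ℝ)) i' = 0 by simp [this]
          cases i' <;> simp [jetPure, jetOf]
          rintro rfl rfl
          rw [Pi.single_eq_of_ne]
          rintro rfl
          exact hi' rfl
        · intro hn
          simp [Finsupp.notMem_support_iff.mp hn]
      simp only [hsum, MvPolynomial.aeval_eq_eval, hF, h0] at h
      rw [sub_zero, zero_sub, nnnorm_neg, nnnorm_mul, ← ENNReal.coe_mul, ← ENNReal.coe_mul,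
        ENNReal.coe_le_coe] at h
      simp only [NNReal.nnnorm_eq] at h
      exact le_of_mul_le_mul_right h hx0
    rw [← nnnorm_eq_zero]
    by_contra hne
    have hpos : 0 < ‖l i (.d2 j t t)‖₊ := pos_iff_ne_zero.mpr hne
    have hCp : 0 < C i := by
      by_contra hC
      have := hx 1 le_rfl one_pos
      rw [not_lt.mp hC |>.antisymm zero_le] at this
      simp at this
      simp [this] at hpos
    -- At this value of `x` the bound becomes |l| ≤ |l|/2.
    have := hx (min 1 (‖l i (.d2 j t t)‖₊ / (2 * C i))) (min_le_left _ _) (by positivity)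
    have h2 : ‖l i (.d2 j t t)‖₊ ≤ ‖l i (.d2 j t t)‖₊ / 2 := by
      calc _ ≤ _ := this
        _ ≤ C i * (‖l i (.d2 j t t)‖₊ / (2 * C i)) := by gcongr; exact min_le_right _ _
        _ = _ := by field_simp
    exact absurd (NNReal.half_lt_self hne) (not_lt.mpr h2)
  obtain ⟨K, hK1, hK⟩ : ∃ K : ℝ≥0, 1 ≤ K ∧ ∀ i, C i ≤ K ∧ ∑ i' ∈ (l i).support, ‖l i i'‖₊ ≤ K := by
    refine ⟨1 + ∑ i, (C i + ∑ i' ∈ (l i).support, ‖l i i'‖₊), by simp, fun i => ?_⟩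
    have h : C i + ∑ i' ∈ (l i).support, ‖l i i'‖₊ ≤
        1 + ∑ i, (C i + ∑ i' ∈ (l i).support, ‖l i i'‖₊) :=
      (Finset.single_le_sum (f := fun i => C i + ∑ i' ∈ (l i).support, ‖l i i'‖₊)
        (fun _ _ => zero_le) (Finset.mem_univ i)).trans le_add_self
    exact ⟨le_self_add.trans h, le_add_self.trans h⟩
  have hK0 : K ≠ 0 := (zero_lt_one.trans_le hK1).ne'
  -- The quadratic remainder has Lipschitz constant at most Kρ = 1/4 on the ball of radius `ρ`, and
  -- the linear part at most Kr ≤ Kρ; together they give 1/2. The further choice r = ρ/(2K) bounds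
  -- the image of zero by Kr = ρ/2, so the ball is preserved.
  obtain ⟨ρ, hρ⟩ : ∃ ρ : ℝ≥0, ρ = 1 / (4 * K) := ⟨_, rfl⟩
  obtain ⟨r, hr⟩ : ∃ r : ℝ≥0, r = ρ / (2 * K) := ⟨_, rfl⟩
  have hρ1 : ρ ≤ 1 := by
    rw [hρ]
    refine div_le_one_of_le₀ (hK1.trans ?_) (by positivity)
    exact le_mul_of_one_le_left' (by norm_num)
  have hρ0 : ρ ≠ 0 := by rw [hρ]; positivity
  have hr0 : r ≠ 0 := by rw [hr]; positivity
  have hrρ : r ≤ ρ := by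
    rw [hr]
    exact div_le_self zero_le (hK1.trans (le_mul_of_one_le_left' (by norm_num)))
  have hr1 : r ≤ 1 := hrρ.trans hρ1
  have hKr : (K : ℝ≥0∞) * r = ρ / 2 := by
    rw [hr, ← ENNReal.coe_ofNat, ← ENNReal.coe_mul, ← ENNReal.coe_div (by norm_num)]
    congr 1
    field_simp
  have hKρ : (K : ℝ≥0∞) * ρ = 1 / 4 := by
    rw [hρ, ← ENNReal.coe_ofNat, ← ENNReal.coe_one, ← ENNReal.coe_mul,
      ← ENNReal.coe_div (by norm_num)]
    congr 1
    field_simp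
  set R := radii t r with hR
  have hN := isAlgNorm_wnorm R
  set Φ : (Fin k → MvPowerSeries (Fin m) ℝ) → Fin k → MvPowerSeries (Fin m) ℝ := fun v i =>
    MvPolynomial.aeval (formalJet t v) (F i) with hΦ
  -- `Φ` is a contraction
  have hlip : ∀ v w (D : ℝ≥0∞), (∀ j, wnorm R (v j) ≤ ρ) → (∀ j, wnorm R (w j) ≤ ρ) →
      (∀ j, wnorm R (v j - w j) ≤ D) → ∀ i, wnorm R (Φ v i - Φ w i) ≤ D / 2 := by
    intro v w D hv hw hD i
    have h := (hest i _ _ hN ρ hρ1 (formalJet t v) (formalJet t w) D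
      (wnorm_formalJet_le t hr0 hr1 hrρ v hv) (wnorm_formalJet_le t hr0 hr1 hrρ w hw)
      (wnorm_formalJet_sub_le t hr0 hr1 v w hD)).2.2
    have h2 : wnorm R ((l i).sum fun i' a => a • (formalJet t v i' - formalJet t w i')) ≤
        K * (r * D) := by
      refine (hN.sum_le _ _).trans ?_
      calc _ ≤ ∑ i' ∈ (l i).support, (‖l i i'‖₊ : ℝ≥0∞) * (r * D) := by
            refine Finset.sum_le_sum fun i' hi' => (hN.smul_le _ _).trans ?_
            gcongr
            refine wnorm_formalJet_sub_le_mul t hr0 hr1 v w hD i' fun j hj => ?_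
            rw [hj] at hi'
            exact (Finsupp.mem_support_iff.mp hi') (hl i j)
        _ ≤ _ := by
            rw [← Finset.sum_mul, ← ENNReal.ofNNReal_finsetSum]
            gcongr
            exact (hK i).2
    calc wnorm R (Φ v i - Φ w i) = wnorm R ((Φ v i - Φ w i -
          (l i).sum fun i' a => a • (formalJet t v i' - formalJet t w i')) +
          (l i).sum fun i' a => a • (formalJet t v i' - formalJet t w i')) := by
          rw [sub_add_cancel]
      _ ≤ C i * ρ * D + K * (r * D) := (hN.add_le _ _).trans (add_le_add h h2)
      _ ≤ K * ρ * D + K * ρ * D := by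
          rw [← mul_assoc]
          gcongr
          exact (hK i).1
      _ = D / 2 := by
          rw [hKρ, ← add_mul, ENNReal.div_add_div_same, mul_comm, div_eq_mul_inv D]
          congr 1
          rw [one_add_one_eq_two, show (4 : ℝ≥0∞) = 2 * 2 by norm_num,
            ENNReal.div_eq_inv_mul, ENNReal.mul_inv (by simp) (by simp), mul_assoc,
            ENNReal.inv_mul_cancel (by simp) (by simp), mul_one]
  -- The formal jet of zero contains only the coordinate functions, whose norms are the radii and
  -- hence at most `r`.
  have hzero : ∀ i, wnorm R (Φ 0 i) ≤ ρ / 2 := by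
    intro i
    have hj : ∀ i', wnorm R (formalJet t (0 : Fin k → MvPowerSeries (Fin m) ℝ) i') ≤ r :=
      wnorm_formalJet_le t hr0 hr1 le_rfl 0 (by simp [wnorm_zero])
    have h := (hest i _ _ hN r hr1 (formalJet t 0) (formalJet t 0) 0 hj hj
      (by simp [wnorm_zero])).2.1
    rw [hF0, map_zero, sub_zero] at h
    refine h.trans ?_
    rw [← hKr]
    gcongr
    exact (hK i).1
  have hball : ∀ v, (∀ j, wnorm R (v j) ≤ ρ) → ∀ i, wnorm R (Φ v i) ≤ ρ := by
    intro v hv i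
    have h1 := hlip v 0 ρ hv (by simp [wnorm_zero]) (by simpa using hv) i
    calc _ = wnorm R ((Φ v i - Φ 0 i) + Φ 0 i) := by rw [sub_add_cancel]
      _ ≤ ρ / 2 + ρ / 2 := (hN.add_le _ _).trans (add_le_add h1 (hzero i))
      _ = ρ := ENNReal.add_halves _
  set v : ℕ → Fin k → MvPowerSeries (Fin m) ℝ := fun n => Φ^[n] 0 with hv
  have hsucc : ∀ n, v (n + 1) = Φ (v n) := fun n => Function.iterate_succ_apply' Φ n 0
  have hvρ : ∀ n j, wnorm R (v n j) ≤ ρ := by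
    intro n
    induction n with
    | zero => intro j; simp [hv, wnorm_zero]
    | succ n ih => rw [hsucc]; exact hball _ ih
  have hvc : ∀ n j, constantCoeff (v n j) = 0 := by
    intro n
    induction n with
    | zero => intro j; simp [hv]
    | succ n ih =>
      intro j
      rw [hsucc, hΦ, constantCoeff_aeval]
      simp only [constantCoeff_formalJet t _ ih]
      exact (RingHom.congr_fun MvPolynomial.eval_zero (F j)).trans (hF0 j)
  set ε : ℕ → ℝ≥0∞ := fun n => ρ / 2 * (1 / 2) ^ n with hε
  have hdiff : ∀ n j, wnorm R (v (n + 1) j - v n j) ≤ ε n := by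
    intro n
    induction n with
    | zero =>
      intro j
      have : v 0 j = 0 := rfl
      rw [this, sub_zero, hsucc]
      simpa [hε, hv] using hzero j
    | succ n ih =>
      intro j
      rw [hsucc (n + 1), hsucc n]
      rw [hsucc n] at ih
      refine (hlip _ _ _ (hball _ (hvρ n)) (hvρ n) ih j).trans (le_of_eq ?_)
      simp only [hε, pow_succ, div_eq_mul_inv, one_mul, mul_assoc]
  have hεsum : ∑' n, ε n = ρ := by
    rw [hε, ENNReal.tsum_mul_left, ENNReal.tsum_geometric]
    simp only [one_div, ENNReal.one_sub_inv_two, inv_inv]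
    exact ENNReal.div_mul_cancel (by simp) (by simp)
  have hεtop : ∑' n, ε n ≠ ⊤ := by rw [hεsum]; simp
  choose w hw1 hw2 using fun j =>
    exists_limit R (radii_ne_zero t hr0) (fun n => v n j) ε hεtop (fun n => hdiff n j)
  have hwρ : ∀ j, wnorm R (w j) ≤ ρ := fun j => by
    have := hw1 j 0
    simpa [hv, hεsum] using this
  refine ⟨r, w, hr0, hr1, fun j => (hwρ j).trans (by exact_mod_cast hρ1), fun j => ?_,
    fun i => ?_⟩
  · have h := hw2 j 0
    simp only [coeff_zero_eq_constantCoeff_apply, hvc] at h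
    exact tendsto_nhds_unique h tendsto_const_nhds
  · rw [← sub_eq_zero]
    refine wnorm_eq_zero (radii_ne_zero t hr0) ?_
    have htail := ENNReal.tendsto_sum_nat_add ε hεtop
    have hle : ∀ n, wnorm R (Φ w i - w i) ≤ (∑' j, ε (j + n)) / 2 + ∑' j, ε (j + (n + 1)) := by
      intro n
      calc _ = wnorm R ((Φ w i - Φ (v n) i) - (w i - v (n + 1) i)) := by
            rw [hsucc]; congr 1; ring
        _ ≤ _ := (hN.sub_le _ _).trans (add_le_add
            (hlip w (v n) _ hwρ (hvρ n) (fun j => hw1 j n) i) (hw1 i (n + 1)))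
    have hlim := (ENNReal.Tendsto.div_const htail (b := 2) (by simp)).add
      ((Filter.tendsto_add_atTop_iff_nat 1).mpr htail)
    simp only [ENNReal.zero_div, add_zero] at hlim
    exact le_antisymm (ge_of_tendsto' hlim hle) zero_le

theorem evalAt_aeval {R : Fin m → ℝ≥0} {ρ : ℝ≥0} (hρ : ∀ a, Fintype.card (Fin m) * ρ ≤ R a)
    {σ : Type*} (x : σ → MvPowerSeries (Fin m) ℝ) (hx : ∀ i, wnorm R (x i) ≤ 1)
    {z : Fin m → ℝ} (hz : ∀ a, |z a| ≤ ρ) (F : MvPolynomial σ ℝ) :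
    evalAt z (MvPolynomial.aeval x F) = MvPolynomial.eval (fun i => evalAt z (x i)) F := by
  -- Evaluation is multiplicative only on convergent series, so every intermediate polynomial needs
  -- a finite norm; the estimate with δ = 1 supplies it.
  have hfin : ∀ F : MvPolynomial σ ℝ, Conv (ρ : ℝ) (MvPolynomial.aeval x F) := by
    intro F
    refine conv_of_wnorm (R := R) (ne_of_lt ?_) hρ
    obtain ⟨l, C, h⟩ := F.exists_norm_estimate
    have hN := isAlgNorm_wnorm R
    have h2 := (h _ _ hN 1 le_rfl x x 0 (by simpa using hx) (by simpa using hx)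
      (by simp [wnorm_zero])).2.1
    calc _ = wnorm R ((MvPolynomial.aeval x F -
          algebraMap ℝ _ (MvPolynomial.constantCoeff F)) +
          algebraMap ℝ _ (MvPolynomial.constantCoeff F)) := by rw [sub_add_cancel]
      _ ≤ _ := (hN.add_le _ _).trans (add_le_add h2 (hN.algebraMap_le _))
      _ < ⊤ := by
        rw [← ENNReal.coe_mul, ← ENNReal.coe_add]
        exact ENNReal.coe_lt_top
  induction F using MvPolynomial.induction_on with
  | C a => simp [MvPowerSeries.algebraMap_apply, evalAt_C]
  | add F G hF hG => rw [map_add, evalAt_add (hfin F) (hfin G) hz, hF, hG, map_add]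
  | mul_X F j hF =>
    have := hfin (MvPolynomial.X j)
    rw [MvPolynomial.aeval_X] at this
    rw [map_mul, MvPolynomial.aeval_X, evalAt_mul (hfin F) this hz, hF, map_mul,
      MvPolynomial.eval_X]

end MvPowerSeries

open MvPowerSeries in
open scoped NNReal in
/-- **Cauchy–Kovalevskaya theorem** for second order equations that are polynomial in the
2-jet, with the normalization that `F_i` reduces to `w_i` on the pure jet `∂_t ∂_t u = w`. -/
theorem exists_solution_of_polynomial_jet_equation {m k : ℕ} (t : Fin m)
    (F : Fin k → MvPolynomial (JetVar m k) ℝ)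
    (hF : ∀ (w : Fin k → ℝ) i, MvPolynomial.eval (jetPure t w) (F i) = w i) :
    ∃ r > 0, ∃ u : Fin k → CoordSpace m → ℝ,
      (∀ j, ContDiffOn ℝ ∞ (u j) (Metric.ball 0 r)) ∧ jetAt u 0 = jetPure t 0 ∧
      ∀ z ∈ Metric.ball (0 : CoordSpace m) r, ∀ i, MvPolynomial.eval (jetAt u z) (F i) = 0 := by
  classical
  have hpure0 : (jetPure t 0 : JetVar m k → ℝ) = 0 := by
    funext i; cases i <;> simp [jetPure, jetOf]
  -- A fixed point v = F'(jet) is a solution of F = 0, since the variable subtracted from is `v`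
  -- itself. The normalization of `F` makes `F'` vanish on pure jets.
  set F' : Fin k → MvPolynomial (JetVar m k) ℝ := fun i => MvPolynomial.X (.d2 i t t) - F i
    with hF'
  have hF'p : ∀ (w : Fin k → ℝ) i, MvPolynomial.eval (jetPure t w) (F' i) = 0 := fun w i => by
    simp only [hF', map_sub, MvPolynomial.eval_X, hF]
    simp [jetPure, jetOf]
  obtain ⟨r, v, hr0, hr1, hv, hvc, hfix⟩ := exists_formal_fixedPoint t F'
    (fun i => by rw [← hF'p 0 i, hpure0]; exact (RingHom.congr_fun MvPolynomial.eval_zero _).symm) hF'p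
  have hm : (0 : ℝ≥0) < m := by exact_mod_cast t.pos
  -- The smallest of the radii is r², and passing from the weighted norm to absolute convergence
  -- costs a factor `m`, which is positive because `t` exists.
  set ρ : ℝ≥0 := r * r / m with hρ
  have hρ0 : 0 < ρ := by have := pos_iff_ne_zero.mpr hr0; positivity
  have hρR : ∀ a, (Fintype.card (Fin m) : ℝ≥0) * ρ ≤ radii t r a := fun a => by
    rw [Fintype.card_fin, hρ, mul_div_cancel₀ _ hm.ne']
    unfold radii
    split_ifs
    · exact le_rfl
    · exact mul_le_of_le_one_left' hr1
  have hjet := wnorm_formalJet_le (k := k) t hr0 hr1 hr1 v (by simpa using hv)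
  have hconv : ∀ i, Conv (ρ : ℝ) (formalJet t v i) := fun i =>
    conv_of_wnorm (ne_of_lt ((hjet i).trans_lt (by simp))) hρR
  set u : Fin k → CoordSpace m → ℝ := fun j z => evalAt z (integ t (integ t (v j))) with hu
  have hd1 : ∀ j a, ∀ z ∈ Metric.ball (0 : CoordSpace m) ρ, Coord.partialD (u j) a z =
      evalAt z (formalJet t v (.d1 j a)) := fun j a z hz =>
    partialD_evalAt (hconv (.val j)) (mem_ball_zero_iff.mp hz) a
  have hd2 : ∀ j a b, ∀ z ∈ Metric.ball (0 : CoordSpace m) ρ,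
      Coord.partialD (Coord.partialD (u j) a) b z = evalAt z (formalJet t v (.d2 j a b)) := by
    intro j a b z hz
    rw [show evalAt z (formalJet t v (.d2 j a b)) =
        evalAt z (pderiv ℝ b (formalJet t v (.d1 j a))) from rfl,
      ← partialD_evalAt (hconv (.d1 j a)) (mem_ball_zero_iff.mp hz) b]
    unfold Coord.partialD
    congr 1
    refine Filter.EventuallyEq.fderiv_eq ?_
    filter_upwards [Metric.isOpen_ball.mem_nhds hz] with y hy
    exact hd1 j a y hy
  have hjetAt : ∀ z ∈ Metric.ball (0 : CoordSpace m) ρ, jetAt u z =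
      fun i => evalAt z (formalJet t v i) := by
    intro z hz
    funext i
    cases i with
    | pt a => exact (evalAt_X (z : Fin m → ℝ) a).symm
    | val j => rfl
    | d1 j a => exact hd1 j a z hz
    | d2 j a b => exact hd2 j a b z hz
  refine ⟨ρ, by exact_mod_cast hρ0, u, fun j => contDiffOn_infty_evalAt (hconv (.val j)), ?_, ?_⟩
  · rw [hjetAt 0 (Metric.mem_ball_self (by exact_mod_cast hρ0)), hpure0]
    funext i
    exact (evalAt_origin _).trans (constantCoeff_formalJet t v hvc i)
  · intro z hz i
    have hz' : ∀ a, |z a| ≤ ρ := fun a =>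
      (PiLp.norm_apply_le z a).trans (mem_ball_zero_iff.mp hz).le
    have h := evalAt_aeval hρR (formalJet t v) (by simpa using hjet) hz' (F' i)
    rw [hfix i, ← hjetAt z hz, hF', map_sub, MvPolynomial.eval_X] at h
    have h3 : jetAt u z (.d2 i t t) = evalAt z (v i) := by
      rw [hjetAt z hz, ← formalJet_d2_self t v i]
    rw [h3] at h
    linarith

/-! ### Calculus of matrix valued functions in coordinates -/

namespace Coord

open scoped Topology

variable {m : ℕ}

section PartialD

theorem partialD_congr {f g : CoordSpace m → ℝ} {z : CoordSpace m} (h : f =ᶠ[𝓝 z] g)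
    (a : Fin m) : partialD f a z = partialD g a z := by
  unfold partialD; rw [h.fderiv_eq]

theorem partialD_const (c : ℝ) (a : Fin m) (z : CoordSpace m) :
    partialD (fun _ => c) a z = 0 := by
  simp [partialD]

theorem partialD_add {f g : CoordSpace m → ℝ} {z : CoordSpace m} (hf : DifferentiableAt ℝ f z)
    (hg : DifferentiableAt ℝ g z) (a : Fin m) :
    partialD (fun v => f v + g v) a z = partialD f a z + partialD g a z := by
  unfold partialD; rw [fderiv_fun_add hf hg]; rfl

theorem partialD_sub {f g : CoordSpace m → ℝ} {z : CoordSpace m} (hf : DifferentiableAt ℝ f z)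
    (hg : DifferentiableAt ℝ g z) (a : Fin m) :
    partialD (fun v => f v - g v) a z = partialD f a z - partialD g a z := by
  unfold partialD; rw [fderiv_fun_sub hf hg]; rfl

theorem partialD_mul {f g : CoordSpace m → ℝ} {z : CoordSpace m} (hf : DifferentiableAt ℝ f z)
    (hg : DifferentiableAt ℝ g z) (a : Fin m) :
    partialD (fun v => f v * g v) a z = partialD f a z * g z + f z * partialD g a z := by
  unfold partialD; rw [fderiv_fun_mul hf hg]; simp; ring

theorem partialD_const_mul {f : CoordSpace m → ℝ} {z : CoordSpace m}
    (hf : DifferentiableAt ℝ f z) (c : ℝ) (a : Fin m) :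
    partialD (fun v => c * f v) a z = c * partialD f a z := by
  unfold partialD; rw [fderiv_const_mul hf]; rfl

theorem partialD_sum {ι : Type*} (s : Finset ι) {f : ι → CoordSpace m → ℝ} {z : CoordSpace m}
    (hf : ∀ i ∈ s, DifferentiableAt ℝ (f i) z) (a : Fin m) :
    partialD (fun v => ∑ i ∈ s, f i v) a z = ∑ i ∈ s, partialD (f i) a z := by
  unfold partialD; rw [fderiv_fun_sum hf]; simp

theorem partialD_coord (c a : Fin m) (z : CoordSpace m) :
    partialD (fun v => v c) a z = if c = a then 1 else 0 := by
  have h : HasFDerivAt (fun v : CoordSpace m => v c)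
      (EuclideanSpace.proj c : CoordSpace m →L[ℝ] ℝ) z :=
    (EuclideanSpace.proj c : CoordSpace m →L[ℝ] ℝ).hasFDerivAt
  unfold partialD
  rw [h.fderiv]
  simp

theorem contDiffOn_partialD {f : CoordSpace m → ℝ} {s : Set (CoordSpace m)} (hs : IsOpen s)
    (hf : ContDiffOn ℝ ∞ f s) (a : Fin m) : ContDiffOn ℝ ∞ (partialD f a) s :=
  (hf.fderiv_of_isOpen hs (by simp)).clm_apply contDiffOn_const

end PartialD

section MatrixCalculus

/-- The entrywise partial derivative of a matrix valued function. -/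
noncomputable def partialM (E : CoordSpace m → Matrix (Fin m) (Fin m) ℝ) (a : Fin m)
    (z : CoordSpace m) : Matrix (Fin m) (Fin m) ℝ :=
  Matrix.of fun i j => partialD (fun v => E v i j) a z

/-- The entries of `E` are smooth on `s`. -/
def SmoothM (E : CoordSpace m → Matrix (Fin m) (Fin m) ℝ) (s : Set (CoordSpace m)) : Prop :=
  ∀ i j, ContDiffOn ℝ ∞ (fun v => E v i j) s

variable {E F : CoordSpace m → Matrix (Fin m) (Fin m) ℝ} {s : Set (CoordSpace m)}

theorem SmoothM.differentiableAt (hE : SmoothM E s) (hs : IsOpen s) {z : CoordSpace m}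
    (hz : z ∈ s) (i j : Fin m) : DifferentiableAt ℝ (fun v => E v i j) z :=
  ((hE i j).contDiffAt (hs.mem_nhds hz)).differentiableAt (by simp)

theorem SmoothM.const (X : Matrix (Fin m) (Fin m) ℝ) : SmoothM (fun _ => X) s :=
  fun _ _ => contDiffOn_const

theorem SmoothM.add (hE : SmoothM E s) (hF : SmoothM F s) : SmoothM (fun v => E v + F v) s :=
  fun i j => (hE i j).add (hF i j)

theorem SmoothM.mul (hE : SmoothM E s) (hF : SmoothM F s) : SmoothM (fun v => E v * F v) s := by
  intro i j
  simp only [Matrix.mul_apply]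
  exact ContDiffOn.sum fun k _ => (hE i k).mul (hF k j)

theorem SmoothM.transpose (hE : SmoothM E s) : SmoothM (fun v => (E v).transpose) s :=
  fun i j => hE j i

theorem SmoothM.det (hE : SmoothM E s) : ContDiffOn ℝ ∞ (fun v => (E v).det) s := by
  simp only [Matrix.det_apply']
  exact ContDiffOn.sum fun p _ => contDiffOn_const.mul (contDiffOn_prod fun i _ => hE _ _)

theorem SmoothM.adjugate (hE : SmoothM E s) : SmoothM (fun v => (E v).adjugate) s := by
  intro i j
  simp only [Matrix.adjugate_apply]
  refine SmoothM.det fun k l => ?_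
  by_cases hk : k = j
  · subst hk; simpa using contDiffOn_const
  · simpa [Matrix.updateRow_ne hk] using hE k l

theorem SmoothM.inv (hE : SmoothM E s) (hdet : ∀ v ∈ s, (E v).det ≠ 0) :
    SmoothM (fun v => (E v)⁻¹) s := by
  intro i j
  simp only [Matrix.inv_def, Matrix.smul_apply, Ring.inverse_eq_inv', smul_eq_mul]
  exact (hE.det.inv hdet).mul (hE.adjugate i j)

theorem SmoothM.partialM (hE : SmoothM E s) (hs : IsOpen s) (a : Fin m) :
    SmoothM (partialM E a) s :=
  fun i j => contDiffOn_partialD hs (hE i j) a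

theorem SmoothM.congr (hE : SmoothM E s) (h : ∀ v ∈ s, F v = E v) : SmoothM F s :=
  fun i j => (hE i j).congr fun v hv => by rw [h v hv]

theorem partialM_congr {z : CoordSpace m} (h : E =ᶠ[𝓝 z] F) (a : Fin m) :
    partialM E a z = partialM F a z := by
  ext i j
  exact partialD_congr (h.mono fun v hv => by simp only [hv]) a

theorem partialM_const (X : Matrix (Fin m) (Fin m) ℝ) (a : Fin m) (z : CoordSpace m) :
    partialM (fun _ => X) a z = 0 := by
  ext i j; exact partialD_const _ _ _

theorem partialM_add (hE : SmoothM E s) (hF : SmoothM F s) (hs : IsOpen s) {z : CoordSpace m}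
    (hz : z ∈ s) (a : Fin m) :
    partialM (fun v => E v + F v) a z = partialM E a z + partialM F a z := by
  ext i j
  exact partialD_add (hE.differentiableAt hs hz i j) (hF.differentiableAt hs hz i j) a

theorem partialM_mul (hE : SmoothM E s) (hF : SmoothM F s) (hs : IsOpen s) {z : CoordSpace m}
    (hz : z ∈ s) (a : Fin m) :
    partialM (fun v => E v * F v) a z = partialM E a z * F z + E z * partialM F a z := by
  ext i j
  simp only [partialM, Matrix.add_apply, Matrix.mul_apply, Matrix.of_apply]
  rw [partialD_sum _ fun k _ => (hE.differentiableAt hs hz i k).fun_mul (hF.differentiableAt hs hz k j),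
    ← Finset.sum_add_distrib]
  exact Finset.sum_congr rfl fun k _ =>
    partialD_mul (hE.differentiableAt hs hz i k) (hF.differentiableAt hs hz k j) a

theorem partialM_transpose (a : Fin m) (z : CoordSpace m) :
    partialM (fun v => (E v).transpose) a z = (partialM E a z).transpose := rfl

end MatrixCalculus

/-! ### The curvature in terms of Christoffel symbols of the first kind -/

section Curvature

variable {G : CoordSpace m → Matrix (Fin m) (Fin m) ℝ} {s : Set (CoordSpace m)}

theorem contDiffOn_christoffelLow (hG : SmoothM G s) (hs : IsOpen s) (a b c : Fin m) :
    ContDiffOn ℝ ∞ (christoffelLow G a b c) s :=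
  contDiffOn_const.mul (((contDiffOn_partialD hs (hG b c) a).add
    (contDiffOn_partialD hs (hG a c) b)).sub (contDiffOn_partialD hs (hG a b) c))

theorem contDiffOn_christoffel (hG : SmoothM G s) (hs : IsOpen s)
    (hdet : ∀ v ∈ s, (G v).det ≠ 0) (a b d : Fin m) :
    ContDiffOn ℝ ∞ (christoffel G a b d) s :=
  ContDiffOn.sum fun c _ => (hG.inv hdet c d).mul (contDiffOn_christoffelLow hG hs a b c)

theorem sum_mul_christoffel (hsym : ∀ v ∈ s, (G v).IsSymm) (hdet : ∀ v ∈ s, (G v).det ≠ 0)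
    {z : CoordSpace m} (hz : z ∈ s) (a b d : Fin m) :
    ∑ f, G z d f * christoffel G a b f z = christoffelLow G a b d z := by
  have h : (G z)⁻¹ * G z = 1 := Matrix.nonsing_inv_mul _ (isUnit_iff_ne_zero.mpr (hdet z hz))
  have h2 : ∀ e, ∑ f, G z d f * (G z)⁻¹ e f = if e = d then 1 else 0 := fun e => by
    rw [← Matrix.one_apply, ← h, Matrix.mul_apply]
    exact Finset.sum_congr rfl fun f _ => by rw [mul_comm, (hsym z hz).apply]
  simp only [christoffel, Finset.mul_sum]
  rw [Finset.sum_comm]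
  simp only [← mul_assoc, ← Finset.sum_mul, h2]
  simp

theorem partialD_metric (hsym : ∀ v ∈ s, (G v).IsSymm) (hs : IsOpen s) {z : CoordSpace m}
    (hz : z ∈ s) (a d f : Fin m) : partialD (fun v => G v d f) a z =
      christoffelLow G a d f z + christoffelLow G a f d z := by
  have : partialD (fun v => G v f d) a z = partialD (fun v => G v d f) a z :=
    partialD_congr (by
      filter_upwards [hs.mem_nhds hz] with v hv
      exact (hsym v hv).apply _ _) a
  simp only [christoffelLow]
  rw [this]
  ring

/-- Differentiating the relation between the two kinds of Christoffel symbols, and using that ∂g is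
a sum of two first kind symbols, removes all derivatives of the inverse metric. The outcome is
polynomial in the 2-jet of the metric and its inverse. -/
theorem curvLow_eq (hG : SmoothM G s) (hs : IsOpen s) (hsym : ∀ v ∈ s, (G v).IsSymm)
    (hdet : ∀ v ∈ s, (G v).det ≠ 0) {z : CoordSpace m} (hz : z ∈ s) (a b c d : Fin m) :
    curvLow G a b c d z = partialD (christoffelLow G b c d) a z
      - partialD (christoffelLow G a c d) b z
      - ∑ e, ∑ f, (G z)⁻¹ e f * (christoffelLow G b c e z * christoffelLow G a d f z
        - christoffelLow G a c e z * christoffelLow G b d f z) := by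
  have hΓ : ∀ a b d, DifferentiableAt ℝ (christoffel G a b d) z := fun a b d =>
    ((contDiffOn_christoffel hG hs hdet a b d).contDiffAt (hs.mem_nhds hz)).differentiableAt
      (by simp)
  have hder : ∀ a b, ∑ f, G z d f * partialD (christoffel G b c f) a z =
      partialD (christoffelLow G b c d) a z - ∑ f, (christoffelLow G a d f z +
        christoffelLow G a f d z) * christoffel G b c f z := by
    intro a b
    have h1 : partialD (christoffelLow G b c d) a z =
        partialD (fun v => ∑ f, G v d f * christoffel G b c f v) a z :=
      partialD_congr (by
        filter_upwards [hs.mem_nhds hz] with v hv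
        exact (sum_mul_christoffel hsym hdet hv b c d).symm) a
    rw [h1, partialD_sum _ fun f _ => (hG.differentiableAt hs hz d f).fun_mul (hΓ b c f),
      ← Finset.sum_sub_distrib]
    refine Finset.sum_congr rfl fun f _ => ?_
    rw [partialD_mul (hG.differentiableAt hs hz d f) (hΓ b c f), partialD_metric hsym hs hz]
    ring
  have hquad : ∀ a b, ∑ f, G z d f * ∑ e, christoffel G a e f z * christoffel G b c e z =
      ∑ e, christoffelLow G a e d z * christoffel G b c e z := by
    intro a b
    simp only [Finset.mul_sum]
    rw [Finset.sum_comm]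
    refine Finset.sum_congr rfl fun e _ => ?_
    rw [← sum_mul_christoffel hsym hdet hz a e d, Finset.sum_mul]
    exact Finset.sum_congr rfl fun f _ => by ring
  have hlast : ∀ a b, ∑ f, christoffelLow G a d f z * christoffel G b c f z =
      ∑ e, ∑ f, (G z)⁻¹ e f * (christoffelLow G b c e z * christoffelLow G a d f z) := by
    intro a b
    rw [Finset.sum_comm]
    refine Finset.sum_congr rfl fun f _ => ?_
    rw [christoffel, Finset.mul_sum]
    exact Finset.sum_congr rfl fun e _ => by ring
  have hexp : curvLow G a b c d z = ∑ f, G z d f * partialD (christoffel G b c f) a z -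
      ∑ f, G z d f * partialD (christoffel G a c f) b z +
      (∑ f, G z d f * ∑ e, christoffel G a e f z * christoffel G b c e z -
       ∑ f, G z d f * ∑ e, christoffel G b e f z * christoffel G a c e z) := by
    simp only [curvLow, curvUp, Finset.sum_sub_distrib, mul_sub, mul_add, Finset.sum_add_distrib]
  rw [hexp, hder, hder, hquad, hquad]
  simp only [mul_sub, Finset.sum_sub_distrib, add_mul, Finset.sum_add_distrib]
  rw [← hlast a b, ← hlast b a]
  ring

end Curvature

end Coord

/-! ### Curvature expressions in the 2-jet of a frame -/

namespace FrameJet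

open Matrix

section Generic

variable {A B : Type*} [CommRing A] [CommRing B] {m : ℕ}

/-- The metric `Eᵀ γ E`. -/
def met (γ E₀ : Matrix (Fin m) (Fin m) A) : Matrix (Fin m) (Fin m) A := E₀ᵀ * γ * E₀

/-- The first derivatives of `Eᵀ γ E` in terms of the jet of `E`. -/
def met₁ (γ E₀ : Matrix (Fin m) (Fin m) A) (E₁ : Fin m → Matrix (Fin m) (Fin m) A)
    (a : Fin m) : Matrix (Fin m) (Fin m) A :=
  (E₁ a)ᵀ * γ * E₀ + E₀ᵀ * γ * E₁ a

/-- The second derivatives of `Eᵀ γ E` in terms of the jet of `E`. -/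
def met₂ (γ E₀ : Matrix (Fin m) (Fin m) A) (E₁ : Fin m → Matrix (Fin m) (Fin m) A)
    (E₂ : Fin m → Fin m → Matrix (Fin m) (Fin m) A) (a b : Fin m) :
    Matrix (Fin m) (Fin m) A :=
  (E₂ a b)ᵀ * γ * E₀ + (E₁ a)ᵀ * γ * E₁ b + ((E₁ b)ᵀ * γ * E₁ a + E₀ᵀ * γ * E₂ a b)

/-- Twice the Christoffel symbols of the first kind. -/
def chr (γ E₀ : Matrix (Fin m) (Fin m) A) (E₁ : Fin m → Matrix (Fin m) (Fin m) A)
    (a b c : Fin m) : A :=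
  met₁ γ E₀ E₁ a b c + met₁ γ E₀ E₁ b a c - met₁ γ E₀ E₁ c a b

/-- The derivatives in direction `d` of `chr`. -/
def chr₁ (γ E₀ : Matrix (Fin m) (Fin m) A) (E₁ : Fin m → Matrix (Fin m) (Fin m) A)
    (E₂ : Fin m → Fin m → Matrix (Fin m) (Fin m) A) (d a b c : Fin m) : A :=
  met₂ γ E₀ E₁ E₂ a d b c + met₂ γ E₀ E₁ E₂ b d a c - met₂ γ E₀ E₁ E₂ c d a b

/-- `(det E)² E⁻¹ X E⁻ᵀ`. -/
def conj (X E₀ : Matrix (Fin m) (Fin m) A) : Matrix (Fin m) (Fin m) A :=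
  E₀.adjugate * X * E₀.adjugateᵀ

/-- `4 (det E)²` times the curvature tensor, where `η` is the inverse of `γ`. -/
def riem (γ η E₀ : Matrix (Fin m) (Fin m) A) (E₁ : Fin m → Matrix (Fin m) (Fin m) A)
    (E₂ : Fin m → Fin m → Matrix (Fin m) (Fin m) A) (a b c d : Fin m) : A :=
  2 * E₀.det ^ 2 * (chr₁ γ E₀ E₁ E₂ a b c d - chr₁ γ E₀ E₁ E₂ b a c d)
    - ∑ e, ∑ f, conj η E₀ e f * (chr γ E₀ E₁ b c e * chr γ E₀ E₁ a d f
      - chr γ E₀ E₁ a c e * chr γ E₀ E₁ b d f)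

/-- The contraction of `riem` with two copies of `conj X`. -/
def scal (γ η X E₀ : Matrix (Fin m) (Fin m) A) (E₁ : Fin m → Matrix (Fin m) (Fin m) A)
    (E₂ : Fin m → Fin m → Matrix (Fin m) (Fin m) A) : A :=
  ∑ i, ∑ j, ∑ k, ∑ l, conj X E₀ l i * conj X E₀ k j * riem γ η E₀ E₁ E₂ i j k l

variable (φ : A →+* B) (γ η X E₀ : Matrix (Fin m) (Fin m) A)
  (E₁ : Fin m → Matrix (Fin m) (Fin m) A) (E₂ : Fin m → Fin m → Matrix (Fin m) (Fin m) A)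

theorem map_met₁ (a b c : Fin m) : φ (met₁ γ E₀ E₁ a b c) =
    met₁ (γ.map φ) (E₀.map φ) (fun a => (E₁ a).map φ) a b c := by
  simp only [met₁, ← transpose_map, ← Matrix.map_mul, Matrix.add_apply, map_add, Matrix.map_apply]

theorem map_met₂ (a b c d : Fin m) : φ (met₂ γ E₀ E₁ E₂ a b c d) =
    met₂ (γ.map φ) (E₀.map φ) (fun a => (E₁ a).map φ) (fun a b => (E₂ a b).map φ) a b c d := by
  simp only [met₂, ← transpose_map, ← Matrix.map_mul, Matrix.add_apply, map_add, Matrix.map_apply]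

theorem map_chr (a b c : Fin m) : φ (chr γ E₀ E₁ a b c) =
    chr (γ.map φ) (E₀.map φ) (fun a => (E₁ a).map φ) a b c := by
  simp only [chr, map_add, map_sub, map_met₁]

theorem map_chr₁ (a b c d : Fin m) : φ (chr₁ γ E₀ E₁ E₂ a b c d) =
    chr₁ (γ.map φ) (E₀.map φ) (fun a => (E₁ a).map φ) (fun a b => (E₂ a b).map φ) a b c d := by
  simp only [chr₁, map_add, map_sub, map_met₂]

theorem map_det_apply : φ E₀.det = (E₀.map φ).det := by
  rw [RingHom.map_det, RingHom.mapMatrix_apply]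

theorem map_conj (a b : Fin m) : φ (conj X E₀ a b) = conj (X.map φ) (E₀.map φ) a b := by
  have : (E₀.map φ).adjugate = E₀.adjugate.map φ := by
    rw [← RingHom.mapMatrix_apply, ← RingHom.mapMatrix_apply, RingHom.map_adjugate]
  simp only [conj, this, ← transpose_map, ← Matrix.map_mul, Matrix.map_apply]

theorem map_riem (a b c d : Fin m) : φ (riem γ η E₀ E₁ E₂ a b c d) =
    riem (γ.map φ) (η.map φ) (E₀.map φ) (fun a => (E₁ a).map φ) (fun a b => (E₂ a b).map φ)
      a b c d := by
  simp only [riem, map_sub, map_mul, map_pow, map_sum, map_chr, map_chr₁, map_conj,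
    map_det_apply, map_ofNat]

/-- Naturality under ring homomorphisms: the same expression serves as a polynomial in formal jet
variables and as the actual contraction after evaluation. -/
theorem map_scal : φ (scal γ η X E₀ E₁ E₂) =
    scal (γ.map φ) (η.map φ) (X.map φ) (E₀.map φ) (fun a => (E₁ a).map φ)
      (fun a b => (E₂ a b).map φ) := by
  simp only [scal, map_mul, map_sum, map_riem, map_conj]

end Generic

/-! ### Relation to the curvature of the metric -/

section Analytic

open Coord

variable {m : ℕ} {E : CoordSpace m → Matrix (Fin m) (Fin m) ℝ} {s : Set (CoordSpace m)}
  {γ : Matrix (Fin m) (Fin m) ℝ}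

theorem smoothM_met (hE : SmoothM E s) (γ : Matrix (Fin m) (Fin m) ℝ) :
    SmoothM (fun v => met γ (E v)) s :=
  (hE.transpose.mul (SmoothM.const γ)).mul hE

theorem partialM_met (hE : SmoothM E s) (hs : IsOpen s) {z : CoordSpace m} (hz : z ∈ s)
    (a : Fin m) :
    partialM (fun v => met γ (E v)) a z = met₁ γ (E z) (fun a => partialM E a z) a := by
  unfold met
  rw [partialM_mul (hE.transpose.mul (SmoothM.const γ)) hE hs hz,
    partialM_mul hE.transpose (SmoothM.const γ) hs hz, partialM_transpose, partialM_const]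
  simp [met₁]

theorem partialM_partialM_met (hE : SmoothM E s) (hs : IsOpen s) {z : CoordSpace m}
    (hz : z ∈ s) (a b : Fin m) :
    partialM (partialM (fun v => met γ (E v)) a) b z =
      met₂ γ (E z) (fun a => partialM E a z) (fun a b => partialM (partialM E a) b z) a b := by
  have h1 : partialM (fun v => met γ (E v)) a =ᶠ[nhds z] fun v =>
      (partialM E a v)ᵀ * γ * E v + (E v)ᵀ * γ * partialM E a v := by
    filter_upwards [hs.mem_nhds hz] with v hv
    exact partialM_met hE hs hv a
  have hEa := hE.partialM hs a
  rw [partialM_congr h1, partialM_add ((hEa.transpose.mul (SmoothM.const γ)).mul hE)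
    ((hE.transpose.mul (SmoothM.const γ)).mul hEa) hs hz,
    partialM_mul (hEa.transpose.mul (SmoothM.const γ)) hE hs hz,
    partialM_mul hEa.transpose (SmoothM.const γ) hs hz,
    partialM_mul (hE.transpose.mul (SmoothM.const γ)) hEa hs hz,
    partialM_mul hE.transpose (SmoothM.const γ) hs hz, partialM_transpose, partialM_transpose,
    partialM_const]
  simp only [mul_zero, add_zero]
  rfl

theorem two_mul_christoffelLow_met (hE : SmoothM E s) (hs : IsOpen s) {z : CoordSpace m}
    (hz : z ∈ s) (a b c : Fin m) :
    christoffelLow (fun v => met γ (E v)) a b c z =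
      1 / 2 * chr γ (E z) (fun a => partialM E a z) a b c := by
  have h : ∀ a b c, partialD (fun v => met γ (E v) b c) a z =
      met₁ γ (E z) (fun a => partialM E a z) a b c := fun a b c => by
    rw [← partialM_met hE hs hz]; rfl
  simp only [christoffelLow, h, chr]

theorem partialD_christoffelLow_met (hE : SmoothM E s) (hs : IsOpen s) {z : CoordSpace m}
    (hz : z ∈ s) (a b c d : Fin m) :
    partialD (christoffelLow (fun v => met γ (E v)) a b c) d z =
      1 / 2 * chr₁ γ (E z) (fun a => partialM E a z) (fun a b => partialM (partialM E a) b z)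
        d a b c := by
  have hG := smoothM_met hE γ
  have hd : ∀ a b c, DifferentiableAt ℝ (partialD (fun v => met γ (E v) b c) a) z :=
    fun a b c => (hG.partialM hs a).differentiableAt hs hz b c
  have h : ∀ a b c d, partialD (partialD (fun v => met γ (E v) b c) a) d z =
      met₂ γ (E z) (fun a => partialM E a z) (fun a b => partialM (partialM E a) b z) a d b c :=
    fun a b c d => by
      rw [← partialM_partialM_met hE hs hz]; rfl
  unfold christoffelLow
  rw [partialD_const_mul (((hd a b c).fun_add (hd b a c)).fun_sub (hd c a b)),
    partialD_sub ((hd a b c).fun_add (hd b a c)) (hd c a b), partialD_add (hd a b c) (hd b a c)]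
  rw [h, h, h]
  rfl

theorem inv_eq_smul_adjugate (E₀ : Matrix (Fin m) (Fin m) ℝ) :
    E₀⁻¹ = (E₀.det)⁻¹ • E₀.adjugate := by
  rw [inv_def, Ring.inverse_eq_inv']

theorem met_inv {E₀ : Matrix (Fin m) (Fin m) ℝ} (hE₀ : E₀.det ≠ 0) :
    (met γ E₀)⁻¹ = ((E₀.det) ^ 2)⁻¹ • conj γ⁻¹ E₀ := by
  rw [met, Matrix.mul_inv_rev, Matrix.mul_inv_rev, ← transpose_nonsing_inv, conj,
    inv_eq_smul_adjugate E₀]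
  simp only [transpose_smul, Matrix.smul_mul, Matrix.mul_smul, smul_smul, Matrix.mul_assoc]
  congr 1
  field_simp

theorem det_met_ne_zero (hγ : γ.det ≠ 0) {E₀ : Matrix (Fin m) (Fin m) ℝ} (hE₀ : E₀.det ≠ 0) :
    (met γ E₀).det ≠ 0 := by
  rw [met, det_mul, det_mul, det_transpose]
  exact mul_ne_zero (mul_ne_zero hE₀ hγ) hE₀

theorem isSymm_met (hsym : γ.IsSymm) (E₀ : Matrix (Fin m) (Fin m) ℝ) : (met γ E₀).IsSymm := by
  unfold Matrix.IsSymm met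
  simp only [transpose_mul, transpose_transpose, hsym.eq, Matrix.mul_assoc]

/-- The 4 clears the halves in the Christoffel symbols, and det² clears the one inverse metric in
the quadratic term. -/
theorem riem_eq (hE : SmoothM E s) (hs : IsOpen s) (hsym : γ.IsSymm) (hγ : γ.det ≠ 0)
    (hdet : ∀ v ∈ s, (E v).det ≠ 0) {z : CoordSpace m} (hz : z ∈ s) (a b c d : Fin m) :
    riem γ γ⁻¹ (E z) (fun a => partialM E a z) (fun a b => partialM (partialM E a) b z) a b c d =
      4 * (E z).det ^ 2 * curvLow (fun v => met γ (E v)) a b c d z := by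
  rw [curvLow_eq (smoothM_met hE γ) hs (fun v _ => isSymm_met hsym (E v))
    (fun v hv => det_met_ne_zero hγ (hdet v hv)) hz, partialD_christoffelLow_met hE hs hz,
    partialD_christoffelLow_met hE hs hz, met_inv (hdet z hz)]
  simp only [two_mul_christoffelLow_met hE hs hz, riem, Matrix.smul_apply, smul_eq_mul]
  have h0 := hdet z hz
  have hq : ∀ (η : Matrix (Fin m) (Fin m) ℝ) (C : Fin m → Fin m → Fin m → ℝ),
      ∑ e, ∑ f, ((E z).det ^ 2)⁻¹ * η e f * (1 / 2 * C b c e * (1 / 2 * C a d f) -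
        1 / 2 * C a c e * (1 / 2 * C b d f)) = ((E z).det ^ 2)⁻¹ * (1 / 4) *
        ∑ e, ∑ f, η e f * (C b c e * C a d f - C a c e * C b d f) := by
    intro η C
    simp only [Finset.mul_sum]
    exact Finset.sum_congr rfl fun e _ => Finset.sum_congr rfl fun f _ => by ring
  rw [hq]
  field_simp
  ring

/-- The sixth power arises as det² from the curvature and det² from each of the two contracting
inverse metrics. -/
theorem scal_eq_scalarCurv (hE : SmoothM E s) (hs : IsOpen s) (hsym : γ.IsSymm)
    (hγ : γ.det ≠ 0) (hdet : ∀ v ∈ s, (E v).det ≠ 0) {z : CoordSpace m} (hz : z ∈ s) :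
    scal γ γ⁻¹ γ⁻¹ (E z) (fun a => partialM E a z) (fun a b => partialM (partialM E a) b z) =
      4 * (E z).det ^ 6 * scalarCurv (fun v => met γ (E v)) z := by
  have h0 := hdet z hz
  have hs1 : (conj γ⁻¹ (E z)).IsSymm := by
    unfold Matrix.IsSymm conj
    simp only [transpose_mul, transpose_transpose, transpose_nonsing_inv, hsym.eq,
      Matrix.mul_assoc]
  unfold scal scalarCurv
  simp only [riem_eq hE hs hsym hγ hdet hz, met_inv h0, Finset.mul_sum]
  refine Finset.sum_congr rfl fun i _ => Finset.sum_congr rfl fun j _ =>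
    Finset.sum_congr rfl fun k _ => Finset.sum_congr rfl fun l _ => ?_
  rw [hs1.apply i l, hs1.apply j k]
  simp only [Matrix.smul_apply, smul_eq_mul]
  field_simp

theorem endo_mul_met_inv {E₀ : Matrix (Fin m) (Fin m) ℝ} (hE₀ : E₀.det ≠ 0)
    (J₀ : Matrix (Fin m) (Fin m) ℝ) :
    (E₀⁻¹ * J₀ * E₀) * (met γ E₀)⁻¹ = ((E₀.det) ^ 2)⁻¹ • conj (J₀ * γ⁻¹) E₀ := by
  have h : E₀ * E₀.adjugate = E₀.det • 1 := mul_adjugate E₀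
  rw [met_inv hE₀, conj, conj, inv_eq_smul_adjugate E₀]
  simp only [Matrix.smul_mul, Matrix.mul_smul, smul_smul, Matrix.mul_assoc]
  rw [← Matrix.mul_assoc E₀ E₀.adjugate, h]
  simp only [Matrix.smul_mul, Matrix.mul_smul, smul_smul, Matrix.one_mul]
  congr 1
  field_simp

/-- Moving the two endomorphisms onto the inverse metrics shows that τ⋆ is the same contraction with
the bivector J₀γ⁻¹ in place of γ⁻¹; conjugation by the frame respects this product. -/
theorem scal_eq_starScalarCurv (hE : SmoothM E s) (hs : IsOpen s) (hsym : γ.IsSymm)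
    (hγ : γ.det ≠ 0) (hdet : ∀ v ∈ s, (E v).det ≠ 0) {z : CoordSpace m} (hz : z ∈ s)
    (σ : ℝ) (J₀ : Matrix (Fin m) (Fin m) ℝ) :
    -σ * scal γ γ⁻¹ (J₀ * γ⁻¹) (E z) (fun a => partialM E a z)
      (fun a b => partialM (partialM E a) b z) =
      4 * (E z).det ^ 6 * starScalarCurv σ (fun v => met γ (E v))
        (fun v => (E v)⁻¹ * J₀ * E v) z := by
  have h0 := hdet z hz
  have hs1 : ((met γ (E z))⁻¹).IsSymm := by
    have := isSymm_met hsym (E z)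
    unfold Matrix.IsSymm at this ⊢
    rw [transpose_nonsing_inv, this]
  have hc : ∀ p q, conj (J₀ * γ⁻¹) (E z) p q =
      (E z).det ^ 2 * ∑ k, ((E z)⁻¹ * J₀ * E z) p k * (met γ (E z))⁻¹ k q := by
    intro p q
    rw [← Matrix.mul_apply, endo_mul_met_inv h0, Matrix.smul_apply, smul_eq_mul,
      mul_inv_cancel_left₀ (pow_ne_zero 2 h0)]
  set K := (E z)⁻¹ * J₀ * E z with hK
  set g := (met γ (E z))⁻¹ with hg
  simp only [scal, starScalarCurv, ← hg, ← hK]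
  rw [mul_left_comm (4 * (E z).det ^ 6)]
  congr 1
  have hR : ∀ i j, ∑ k, ∑ l, g i l * g j k * ∑ p, ∑ q, K p k * K q l *
      curvLow (fun v => met γ (E v)) i j p q z = ∑ p, ∑ q, (∑ k, K p k * g k j) *
      (∑ l, K q l * g l i) * curvLow (fun v => met γ (E v)) i j p q z := by
    intro i j
    simp only [Finset.mul_sum, Finset.sum_mul]
    calc _ = ∑ k, ∑ p, ∑ q, ∑ l, g i l * g j k *
          (K p k * K q l * curvLow (fun v => met γ (E v)) i j p q z) :=
          Finset.sum_congr rfl fun k _ => by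
            rw [Finset.sum_comm]
            exact Finset.sum_congr rfl fun p _ => Finset.sum_comm
      _ = ∑ p, ∑ q, ∑ k, ∑ l, g i l * g j k *
          (K p k * K q l * curvLow (fun v => met γ (E v)) i j p q z) := by
          rw [Finset.sum_comm]
          exact Finset.sum_congr rfl fun p _ => Finset.sum_comm
      _ = _ := Finset.sum_congr rfl fun p _ => Finset.sum_congr rfl fun q _ => by
          rw [Finset.sum_comm]
          refine Finset.sum_congr rfl fun k _ => Finset.sum_congr rfl fun l _ => ?_
          rw [hs1.apply i k, hs1.apply j l]
          ring
  simp only [hR]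
  simp only [riem_eq hE hs hsym hγ hdet hz, hc, Finset.mul_sum (a := 4 * (E z).det ^ 6)]
  refine Finset.sum_congr rfl fun i _ => Finset.sum_congr rfl fun j _ =>
    Finset.sum_congr rfl fun k _ => Finset.sum_congr rfl fun l _ => ?_
  ring

end Analytic

end FrameJet

namespace FrameJet

open Matrix

/-! ### Frames depending polynomially on a jet -/

section Frame

variable {A B : Type*} [CommRing A] [CommRing B] [Algebra ℝ A] [Algebra ℝ B] {m k : ℕ}

/-- A constant matrix. -/
def cst (A : Type*) [CommRing A] [Algebra ℝ A] {m : ℕ} (M : Matrix (Fin m) (Fin m) ℝ) :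
    Matrix (Fin m) (Fin m) A :=
  M.map (algebraMap ℝ A)

variable (Q : Fin m → Fin m → Matrix (Fin m) (Fin m) ℝ) (N : Fin k → Matrix (Fin m) (Fin m) ℝ)
  (x : JetVar m k → A)

/-- The frame `1 + ∑ z_c z_d Q_cd + ∑ u_j N_j`. -/
def frame₀ : Matrix (Fin m) (Fin m) A :=
  1 + ∑ c, ∑ d, (x (.pt c) * x (.pt d)) • cst A (Q c d) + ∑ j, x (.val j) • cst A (N j)

/-- The first derivatives of `frame₀`. -/
def frame₁ (a : Fin m) : Matrix (Fin m) (Fin m) A :=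
  ∑ d, x (.pt d) • cst A (Q a d + Q d a) + ∑ j, x (.d1 j a) • cst A (N j)

/-- The second derivatives of `frame₀`. -/
def frame₂ (a b : Fin m) : Matrix (Fin m) (Fin m) A :=
  cst A (Q a b + Q b a) + ∑ j, x (.d2 j a b) • cst A (N j)

/-- The contraction `scal` for the frame `frame₀`. -/
def scalJet (γ η X : Matrix (Fin m) (Fin m) ℝ) : A :=
  scal (cst A γ) (cst A η) (cst A X) (frame₀ Q N x) (frame₁ Q N x) (frame₂ Q N x)

theorem cst_map (f : A →ₐ[ℝ] B) (M : Matrix (Fin m) (Fin m) ℝ) :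
    (cst A M).map (f : A →+* B) = cst B M := by
  ext i j; simp [cst]

theorem cst_real (M : Matrix (Fin m) (Fin m) ℝ) : cst ℝ M = M := by
  ext i j; simp [cst]

theorem frame₀_map (f : A →ₐ[ℝ] B) :
    (frame₀ Q N x).map (f : A →+* B) = frame₀ Q N (fun i => f (x i)) := by
  ext i j
  simp [frame₀, cst, Matrix.sum_apply, Matrix.one_apply, apply_ite f]

theorem frame₁_map (f : A →ₐ[ℝ] B) (a : Fin m) :
    (frame₁ Q N x a).map (f : A →+* B) = frame₁ Q N (fun i => f (x i)) a := by
  ext i j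
  simp [frame₁, cst, Matrix.sum_apply]

theorem frame₂_map (f : A →ₐ[ℝ] B) (a b : Fin m) :
    (frame₂ Q N x a b).map (f : A →+* B) = frame₂ Q N (fun i => f (x i)) a b := by
  ext i j
  simp [frame₂, cst, Matrix.sum_apply]

theorem scalJet_map (f : A →ₐ[ℝ] B) (γ η X : Matrix (Fin m) (Fin m) ℝ) :
    f (scalJet Q N x γ η X) = scalJet Q N (fun i => f (x i)) γ η X := by
  have := map_scal (f : A →+* B) (cst A γ) (cst A η) (cst A X) (frame₀ Q N x) (frame₁ Q N x)
    (frame₂ Q N x)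
  simp only [cst_map, frame₀_map, frame₁_map, frame₂_map] at this
  exact this

theorem eval_scalJet (y : JetVar m k → ℝ) (γ η X : Matrix (Fin m) (Fin m) ℝ) :
    MvPolynomial.eval y (scalJet Q N MvPolynomial.X γ η X) = scalJet Q N y γ η X := by
  have := scalJet_map Q N MvPolynomial.X (MvPolynomial.aeval y) γ η X
  simpa [MvPolynomial.aeval_eq_eval] using this

theorem eval_det_frame₀ (y : JetVar m k → ℝ) :
    MvPolynomial.eval y (frame₀ Q N MvPolynomial.X).det = (frame₀ Q N y).det := by
  have h := map_det_apply ((MvPolynomial.aeval y : MvPolynomial (JetVar m k) ℝ →ₐ[ℝ] ℝ) :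
    MvPolynomial (JetVar m k) ℝ →+* ℝ) (frame₀ Q N MvPolynomial.X)
  rw [frame₀_map] at h
  simpa [MvPolynomial.aeval_eq_eval] using h

end Frame

/-! ### The frame along the jets of functions -/

section FrameFunction

open Coord

variable {m k : ℕ} (Q : Fin m → Fin m → Matrix (Fin m) (Fin m) ℝ)
  (N : Fin k → Matrix (Fin m) (Fin m) ℝ) {u : Fin k → CoordSpace m → ℝ}
  {s : Set (CoordSpace m)}

theorem frame₀_jetAt_apply (z : CoordSpace m) (i j : Fin m) : frame₀ Q N (jetAt u z) i j =
    (1 : Matrix (Fin m) (Fin m) ℝ) i j + ∑ c, ∑ d, (z c * z d) * Q c d i j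
      + ∑ l, u l z * N l i j := by
  simp [frame₀, jetAt, jetOf, cst_real, Matrix.sum_apply]

theorem frame₁_jetAt_apply (z : CoordSpace m) (a i j : Fin m) : frame₁ Q N (jetAt u z) a i j =
    ∑ d, z d * (Q a d i j + Q d a i j) + ∑ l, partialD (u l) a z * N l i j := by
  simp [frame₁, jetAt, jetOf, cst_real, Matrix.sum_apply, mul_add]

theorem frame₂_jetAt_apply (z : CoordSpace m) (a b i j : Fin m) :
    frame₂ Q N (jetAt u z) a b i j =
    (Q a b i j + Q b a i j) + ∑ l, partialD (partialD (u l) a) b z * N l i j := by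
  simp [frame₂, jetAt, jetOf, cst_real, Matrix.sum_apply]

theorem contDiff_coord (c : Fin m) : ContDiff ℝ ∞ fun v : CoordSpace m => v c :=
  (EuclideanSpace.proj c : CoordSpace m →L[ℝ] ℝ).contDiff

theorem smoothM_frame₀ (hu : ∀ j, ContDiffOn ℝ ∞ (u j) s) :
    SmoothM (fun v => frame₀ Q N (jetAt u v)) s := by
  intro i j
  simp only [frame₀_jetAt_apply]
  refine (contDiffOn_const.add (ContDiffOn.sum fun c _ => ContDiffOn.sum fun d _ => ?_)).add
    (ContDiffOn.sum fun l _ => (hu l).mul contDiffOn_const)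
  exact (((contDiff_coord c).mul (contDiff_coord d)).contDiffOn).mul contDiffOn_const

theorem partialM_frame₀ (hu : ∀ j, ContDiffOn ℝ ∞ (u j) s) (hs : IsOpen s) {z : CoordSpace m}
    (hz : z ∈ s) (a : Fin m) :
    partialM (fun v => frame₀ Q N (jetAt u v)) a z = frame₁ Q N (jetAt u z) a := by
  have hc : ∀ c : Fin m, DifferentiableAt ℝ (fun v : CoordSpace m => v c) z := fun c =>
    (contDiff_coord c).contDiffAt.differentiableAt (by simp)
  have hud : ∀ j, DifferentiableAt ℝ (u j) z := fun j =>
    ((hu j).contDiffAt (hs.mem_nhds hz)).differentiableAt (by simp)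
  have hq : ∀ c d, DifferentiableAt ℝ (fun v : CoordSpace m => v c * v d) z := fun c d =>
    (hc c).fun_mul (hc d)
  have h1 : ∀ i j c, DifferentiableAt ℝ
      (fun v : CoordSpace m => ∑ d, (v c * v d) * Q c d i j) z := fun i j c =>
    DifferentiableAt.fun_sum fun d _ => (hq c d).mul_const _
  have h2 : ∀ i j, DifferentiableAt ℝ
      (fun v : CoordSpace m => ∑ c, ∑ d, (v c * v d) * Q c d i j) z := fun i j =>
    DifferentiableAt.fun_sum fun c _ => h1 i j c
  have h3 : ∀ i j, DifferentiableAt ℝ (fun v : CoordSpace m => ∑ l, u l v * N l i j) z :=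
    fun i j => DifferentiableAt.fun_sum fun l _ => (hud l).mul_const _
  ext i j
  simp only [partialM, Matrix.of_apply, frame₀_jetAt_apply, frame₁_jetAt_apply]
  rw [partialD_add ((differentiableAt_const _).fun_add (h2 i j)) (h3 i j),
    partialD_add (differentiableAt_const _) (h2 i j), partialD_const, zero_add,
    partialD_sum _ fun c _ => h1 i j c, partialD_sum _ fun l _ => (hud l).mul_const _]
  congr 1
  · have : ∀ c, partialD (fun v : CoordSpace m => ∑ d, (v c * v d) * Q c d i j) a z =
        ∑ d, (if c = a then z d * Q c d i j else 0) + z c * Q c a i j := by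
      intro c
      rw [partialD_sum _ fun d _ => (hq c d).mul_const _]
      have h4 : ∀ d, partialD (fun v : CoordSpace m => v c * v d * Q c d i j) a z =
          (if c = a then z d * Q c d i j else 0) + (if d = a then z c * Q c d i j else 0) := by
        intro d
        rw [partialD_mul (hq c d) (differentiableAt_const _), partialD_const,
          partialD_mul (hc c) (hc d), partialD_coord, partialD_coord]
        split_ifs <;> ring
      rw [Finset.sum_congr rfl fun d _ => h4 d, Finset.sum_add_distrib]
      congr 1
      simp
    rw [Finset.sum_congr rfl fun c _ => this c, Finset.sum_add_distrib, Finset.sum_comm]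
    simp [mul_add, Finset.sum_add_distrib]
  · refine Finset.sum_congr rfl fun l _ => ?_
    rw [partialD_mul (hud l) (differentiableAt_const _), partialD_const, mul_zero, add_zero]

theorem partialM_partialM_frame₀ (hu : ∀ j, ContDiffOn ℝ ∞ (u j) s) (hs : IsOpen s)
    {z : CoordSpace m} (hz : z ∈ s) (a b : Fin m) :
    partialM (partialM (fun v => frame₀ Q N (jetAt u v)) a) b z =
      frame₂ Q N (jetAt u z) a b := by
  have hc : ∀ c : Fin m, DifferentiableAt ℝ (fun v : CoordSpace m => v c) z := fun c =>
    (contDiff_coord c).contDiffAt.differentiableAt (by simp)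
  have hud : ∀ j, DifferentiableAt ℝ (partialD (u j) a) z := fun j =>
    ((contDiffOn_partialD hs (hu j) a).contDiffAt (hs.mem_nhds hz)).differentiableAt (by simp)
  have h1 : partialM (fun v => frame₀ Q N (jetAt u v)) a =ᶠ[nhds z]
      fun v => frame₁ Q N (jetAt u v) a := by
    filter_upwards [hs.mem_nhds hz] with v hv
    exact partialM_frame₀ Q N hu hs hv a
  rw [partialM_congr h1]
  ext i j
  simp only [partialM, Matrix.of_apply, frame₁_jetAt_apply, frame₂_jetAt_apply]
  rw [partialD_add (DifferentiableAt.fun_sum fun d _ => (hc d).mul_const _)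
    (DifferentiableAt.fun_sum fun l _ => (hud l).mul_const _),
    partialD_sum _ fun d _ => (hc d).mul_const _, partialD_sum _ fun l _ => (hud l).mul_const _]
  congr 1
  · have : ∀ d, partialD (fun v : CoordSpace m => v d * (Q a d i j + Q d a i j)) b z =
        if d = b then Q a d i j + Q d a i j else 0 := fun d => by
      rw [partialD_mul (hc d) (differentiableAt_const _), partialD_const, partialD_coord]
      split_ifs <;> ring
    rw [Finset.sum_congr rfl fun d _ => this d]
    simp
  · refine Finset.sum_congr rfl fun l _ => ?_
    rw [partialD_mul (hud l) (differentiableAt_const _), partialD_const, mul_zero, add_zero]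

end FrameFunction

/-! ### Pure jets -/

section Pure

variable {m k : ℕ}

/-- The linear part of `scal` at the trivial frame; `h a b` is the matrix of second derivatives
of the metric. -/
def linScal (X : Matrix (Fin m) (Fin m) ℝ) (h : Fin m → Fin m → Matrix (Fin m) (Fin m) ℝ) : ℝ :=
  ∑ i, ∑ j, ∑ k, ∑ l, X l i * X k j * (2 * (h j i k l + h k i j l - h l i j k
    - (h i j k l + h k j i l - h l j i k)))

theorem riem_one (γ η : Matrix (Fin m) (Fin m) ℝ)
    (E₂ : Fin m → Fin m → Matrix (Fin m) (Fin m) ℝ) (i j k l : Fin m) :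
    riem γ η 1 0 E₂ i j k l = 2 * (((E₂ j i)ᵀ * γ + γ * E₂ j i) k l
      + ((E₂ k i)ᵀ * γ + γ * E₂ k i) j l - ((E₂ l i)ᵀ * γ + γ * E₂ l i) j k
      - (((E₂ i j)ᵀ * γ + γ * E₂ i j) k l + ((E₂ k j)ᵀ * γ + γ * E₂ k j) i l
        - ((E₂ l j)ᵀ * γ + γ * E₂ l j) i k)) := by
  simp [riem, chr, met₁, chr₁, met₂]

theorem scal_one (γ η X : Matrix (Fin m) (Fin m) ℝ)
    (E₂ : Fin m → Fin m → Matrix (Fin m) (Fin m) ℝ) :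
    scal γ η X 1 0 E₂ = linScal X fun a b => (E₂ a b)ᵀ * γ + γ * E₂ a b := by
  simp [scal, linScal, riem_one, conj]

theorem linScal_add (X : Matrix (Fin m) (Fin m) ℝ)
    (h h' : Fin m → Fin m → Matrix (Fin m) (Fin m) ℝ) :
    linScal X (fun a b => h a b + h' a b) = linScal X h + linScal X h' := by
  simp only [linScal, ← Finset.sum_add_distrib, Matrix.add_apply]
  refine Finset.sum_congr rfl fun i _ => Finset.sum_congr rfl fun j _ =>
    Finset.sum_congr rfl fun k _ => Finset.sum_congr rfl fun l _ => by ring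

/-- This is the principal symbol of the contraction at the covector dz_t. Four index patterns
survive, and they agree in pairs. -/
theorem linScal_pure (X H : Matrix (Fin m) (Fin m) ℝ) (t : Fin m) :
    linScal X (fun a b => if a = t ∧ b = t then H else 0) =
      4 * ((X * H * X) t t - X t t * (X * H).trace) := by
  have hif : ∀ a b i j : Fin m, (if a = t ∧ b = t then H else 0) i j =
      if a = t then (if b = t then H i j else 0) else 0 := by
    intro a b i j
    by_cases ha : a = t <;> by_cases hb : b = t <;> simp [ha, hb]
  have hR : ∀ i j k l, X l i * X k j * (2 * ((if j = t ∧ i = t then H else 0) k l +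
      (if k = t ∧ i = t then H else 0) j l - (if l = t ∧ i = t then H else 0) j k -
      ((if i = t ∧ j = t then H else 0) k l + (if k = t ∧ j = t then H else 0) i l -
        (if l = t ∧ j = t then H else 0) i k))) =
      2 * ((if i = t then (if k = t then X l i * X k j * H j l else 0) else 0) -
      (if i = t then (if l = t then X l i * X k j * H j k else 0) else 0) -
      (if j = t then (if k = t then X l i * X k j * H i l else 0) else 0) +
      (if j = t then (if l = t then X l i * X k j * H i k else 0) else 0)) := by
    intro i j k l
    simp only [hif]
    by_cases hi : i = t <;> by_cases hj : j = t <;> by_cases hk : k = t <;>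
      by_cases hl : l = t <;> simp [hi, hj, hk, hl] <;> ring
  unfold linScal
  simp only [hR, ← Finset.mul_sum, Finset.sum_sub_distrib, Finset.sum_add_distrib]
  have h1 : ∑ i, ∑ j, ∑ k, ∑ l, (if i = t then (if k = t then X l i * X k j * H j l else 0)
      else 0) = (X * H * X) t t := by
    simp only [Finset.sum_ite_irrel, Finset.sum_const_zero, Finset.sum_ite_eq', Finset.mem_univ,
      if_true, Matrix.mul_apply, Finset.sum_mul]
    rw [Finset.sum_comm]
    exact Finset.sum_congr rfl fun _ _ => Finset.sum_congr rfl fun _ _ => by ring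
  have h2 : ∑ i, ∑ j, ∑ k, ∑ l, (if i = t then (if l = t then X l i * X k j * H j k else 0)
      else 0) = X t t * (X * H).trace := by
    simp only [Finset.sum_ite_irrel, Finset.sum_const_zero, Finset.sum_ite_eq', Finset.mem_univ,
      if_true, Matrix.trace, Matrix.diag, Matrix.mul_apply, Finset.mul_sum]
    rw [Finset.sum_comm]
    exact Finset.sum_congr rfl fun _ _ => Finset.sum_congr rfl fun _ _ => by ring
  have h3 : ∑ i, ∑ j, ∑ k, ∑ l, (if j = t then (if k = t then X l i * X k j * H i l else 0)
      else 0) = X t t * (X * H).trace := by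
    simp only [Finset.sum_ite_irrel, Finset.sum_const_zero, Finset.sum_ite_eq', Finset.mem_univ,
      if_true, Matrix.trace, Matrix.diag, Matrix.mul_apply, Finset.mul_sum]
    rw [Finset.sum_comm]
    exact Finset.sum_congr rfl fun _ _ => Finset.sum_congr rfl fun _ _ => by ring
  have h4 : ∑ i, ∑ j, ∑ k, ∑ l, (if j = t then (if l = t then X l i * X k j * H i k else 0)
      else 0) = (X * H * X) t t := by
    simp only [Finset.sum_ite_irrel, Finset.sum_const_zero, Finset.sum_ite_eq', Finset.mem_univ,
      if_true, Matrix.mul_apply, Finset.sum_mul]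
    rw [Finset.sum_comm]
    exact Finset.sum_congr rfl fun _ _ => Finset.sum_congr rfl fun _ _ => by ring
  rw [h1, h2, h3, h4]
  ring

theorem frame₀_jetPure (Q : Fin m → Fin m → Matrix (Fin m) (Fin m) ℝ)
    (N : Fin k → Matrix (Fin m) (Fin m) ℝ) (t : Fin m) (w : Fin k → ℝ) :
    frame₀ Q N (jetPure t w) = 1 := by
  simp [frame₀, jetPure, jetOf]

theorem frame₁_jetPure (Q : Fin m → Fin m → Matrix (Fin m) (Fin m) ℝ)
    (N : Fin k → Matrix (Fin m) (Fin m) ℝ) (t : Fin m) (w : Fin k → ℝ) :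
    frame₁ Q N (jetPure t w) = 0 := by
  funext a
  simp [frame₁, jetPure, jetOf]

theorem frame₂_jetPure (Q : Fin m → Fin m → Matrix (Fin m) (Fin m) ℝ)
    (N : Fin k → Matrix (Fin m) (Fin m) ℝ) (t : Fin m) (w : Fin k → ℝ) (a b : Fin m) :
    frame₂ Q N (jetPure t w) a b =
      Q a b + Q b a + if a = t ∧ b = t then ∑ j, w j • N j else 0 := by
  simp only [frame₂, jetPure, jetOf, cst_real]
  split_ifs <;> simp

/-- On a pure jet the frame is trivial and its first derivatives vanish, so the quadratic
Christoffel term disappears and the dependence on `w` is affine, with the symbol as coefficient. -/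
theorem scalJet_jetPure (Q : Fin m → Fin m → Matrix (Fin m) (Fin m) ℝ)
    (N : Fin k → Matrix (Fin m) (Fin m) ℝ) (t : Fin m) (w : Fin k → ℝ)
    (γ η X : Matrix (Fin m) (Fin m) ℝ) :
    scalJet Q N (jetPure t w) γ η X = scalJet Q N (jetPure t 0) γ η X +
      ∑ j, w j * (4 * ((X * ((N j)ᵀ * γ + γ * N j) * X) t t
        - X t t * (X * ((N j)ᵀ * γ + γ * N j)).trace)) := by
  have h : ∀ w : Fin k → ℝ, scalJet Q N (jetPure t w) γ η X =
      linScal X (fun a b => (Q a b + Q b a)ᵀ * γ + γ * (Q a b + Q b a)) +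
      4 * ((X * (∑ j, w j • ((N j)ᵀ * γ + γ * N j)) * X) t t
        - X t t * (X * ∑ j, w j • ((N j)ᵀ * γ + γ * N j)).trace) := by
    intro w
    unfold scalJet
    rw [frame₀_jetPure, frame₁_jetPure, scal_one, ← linScal_pure, ← linScal_add]
    congr 1
    funext a b
    rw [frame₂_jetPure, cst_real]
    split_ifs
    · simp only [transpose_add, Matrix.add_mul, Matrix.mul_add, transpose_sum, Matrix.sum_mul,
        Matrix.mul_sum, transpose_smul, Matrix.smul_mul, Matrix.mul_smul, smul_add,
        Finset.sum_add_distrib]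
      abel
    · simp
  rw [h w, h 0]
  simp only [Pi.zero_apply, zero_smul, Finset.sum_const_zero, Matrix.zero_mul,
    Matrix.trace_zero, Matrix.zero_apply, mul_zero, sub_zero, add_zero, add_right_inj]
  simp only [Matrix.sum_mul, Matrix.mul_smul, Matrix.smul_mul, Matrix.sum_apply,
    Matrix.smul_apply, smul_eq_mul, Matrix.trace_sum, Matrix.trace_smul, Finset.mul_sum,
    ← Finset.sum_sub_distrib]
  exact Finset.sum_congr rfl fun j _ => by ring

end Pure

end FrameJet

namespace FrameJet

open Matrix Coord

/-! ### Compatible pairs of matrices -/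

/-- The matrices of an inner product and of a compatible (para-)complex structure. -/
structure CompatPair (σ : ℝ) {m : ℕ} (γ J₀ : Matrix (Fin m) (Fin m) ℝ) : Prop where
  sq_one : σ * σ = 1
  symm : γᵀ = γ
  det_ne_zero : γ.det ≠ 0
  sq : J₀ * J₀ = σ • 1
  compat : J₀ᵀ * γ * J₀ = -σ • γ

namespace CompatPair

variable {σ : ℝ} {m : ℕ} {γ J₀ : Matrix (Fin m) (Fin m) ℝ} (h : CompatPair σ γ J₀)
include h

theorem inv_mul : γ⁻¹ * γ = 1 := nonsing_inv_mul _ (isUnit_iff_ne_zero.mpr h.det_ne_zero)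

theorem mul_inv : γ * γ⁻¹ = 1 := mul_nonsing_inv _ (isUnit_iff_ne_zero.mpr h.det_ne_zero)

theorem inv_symm : (γ⁻¹)ᵀ = γ⁻¹ := by rw [transpose_nonsing_inv, h.symm]

/-- Compatibility is multiplied on the right by J₀; since σ² = 1, it becomes skewness of J₀ for γ.
-/
theorem transpose_mul_metric : J₀ᵀ * γ = -(γ * J₀) := by
  have h1 : J₀ᵀ * γ * J₀ * J₀ = σ • (J₀ᵀ * γ) := by
    rw [Matrix.mul_assoc, h.sq, Matrix.mul_smul, Matrix.mul_one]
  rw [h.compat, Matrix.smul_mul] at h1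
  have h2 := congrArg (fun M => σ • M) h1
  simp only [smul_smul, h.sq_one, one_smul] at h2
  rw [← h2, mul_neg, h.sq_one, neg_one_smul]

theorem bivector_transpose : (J₀ * γ⁻¹)ᵀ = -(J₀ * γ⁻¹) := by
  have h1 : γ⁻¹ * (J₀ᵀ * γ) * γ⁻¹ = -(γ⁻¹ * (γ * J₀) * γ⁻¹) := by
    rw [h.transpose_mul_metric]; simp
  rw [transpose_mul, h.inv_symm]
  calc _ = γ⁻¹ * (J₀ᵀ * γ) * γ⁻¹ := by
        simp only [Matrix.mul_assoc, h.mul_inv, Matrix.mul_one]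
    _ = _ := by rw [h1, ← Matrix.mul_assoc, h.inv_mul, Matrix.one_mul]

theorem bivector_diag (t : Fin m) : (J₀ * γ⁻¹) t t = 0 := by
  have := congrFun (congrFun h.bivector_transpose t) t
  simp only [transpose_apply, Matrix.neg_apply] at this
  linarith

theorem bivector_metric_bivector : J₀ * γ⁻¹ * γ * (J₀ * γ⁻¹) = σ • γ⁻¹ := by
  rw [Matrix.mul_assoc J₀, h.inv_mul, Matrix.mul_one, ← Matrix.mul_assoc, h.sq, Matrix.smul_mul,
    Matrix.one_mul]

theorem trace_eq_zero : J₀.trace = 0 := by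
  have h1 : J₀.trace = (J₀ * γ⁻¹ * γ).trace := by rw [Matrix.mul_assoc, h.inv_mul, Matrix.mul_one]
  have h2 : (J₀ * γ⁻¹ * γ).trace = -(J₀ * γ⁻¹ * γ).trace := by
    conv_lhs => rw [← trace_transpose, transpose_mul, h.bivector_transpose, h.symm, trace_mul_comm]
    simp
  rw [h1]; linarith

end CompatPair

/-! ### The deformation in the direction of a non-null covector -/

section Deformation

variable {σ : ℝ} {m : ℕ} {γ J₀ : Matrix (Fin m) (Fin m) ℝ}

theorem mul_single_mul_apply (X Y : Matrix (Fin m) (Fin m) ℝ) (t i j : Fin m) :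
    (X * single t t (1 : ℝ) * Y) i j = X i t * Y t j := by
  rw [Matrix.mul_apply, Finset.sum_eq_single t]
  · simp
  · intro b _ hb
    simp [hb]
  · simp

theorem trace_mul_single (X : Matrix (Fin m) (Fin m) ℝ) (t : Fin m) :
    (X * single t t (1 : ℝ)).trace = X t t := by
  rw [Matrix.trace, Finset.sum_eq_single t]
  · simp
  · intro b _ hb
    simp [hb]
  · simp

/-- The contravariant form `n ⊗ n - σ J n ⊗ J n`, where `n` is the gradient of `z_t`. -/
noncomputable def planeForm (σ : ℝ) (γ J₀ : Matrix (Fin m) (Fin m) ℝ) (t : Fin m) :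
    Matrix (Fin m) (Fin m) ℝ :=
  γ⁻¹ * single t t 1 * γ⁻¹ + σ • (J₀ * γ⁻¹ * single t t 1 * (J₀ * γ⁻¹))

variable (h : CompatPair σ γ J₀) (t : Fin m)
include h

theorem planeForm_transpose : (planeForm σ γ J₀ t)ᵀ = planeForm σ γ J₀ t := by
  have h1 := h.bivector_transpose
  unfold planeForm
  generalize J₀ * γ⁻¹ = B at h1 ⊢
  simp only [transpose_add, transpose_smul, transpose_mul, h1, h.inv_symm, transpose_single,
    Matrix.mul_assoc, Matrix.neg_mul, Matrix.mul_neg, neg_neg]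

theorem endo_mul_planeForm : J₀ * planeForm σ γ J₀ t =
    J₀ * γ⁻¹ * single t t 1 * γ⁻¹ + γ⁻¹ * single t t 1 * (J₀ * γ⁻¹) := by
  have h1 : J₀ * (J₀ * γ⁻¹) = σ • γ⁻¹ := by
    rw [← Matrix.mul_assoc, h.sq, Matrix.smul_mul, Matrix.one_mul]
  unfold planeForm
  rw [Matrix.mul_add, Matrix.mul_smul]
  congr 1
  · simp only [Matrix.mul_assoc]
  · rw [← Matrix.mul_assoc J₀ _ (J₀ * γ⁻¹), ← Matrix.mul_assoc J₀ (J₀ * γ⁻¹), h1,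
      Matrix.smul_mul, Matrix.smul_mul, smul_smul, h.sq_one, one_smul]

theorem planeForm_mul_transpose :
    planeForm σ γ J₀ t * J₀ᵀ = -(J₀ * planeForm σ γ J₀ t) := by
  have h1 : planeForm σ γ J₀ t * J₀ᵀ = (J₀ * planeForm σ γ J₀ t)ᵀ := by
    rw [transpose_mul, planeForm_transpose h]
  have h2 := h.bivector_transpose
  rw [h1, endo_mul_planeForm h]
  generalize J₀ * γ⁻¹ = B at h2 ⊢
  simp only [transpose_add, transpose_mul, h2, h.inv_symm, transpose_single,
    Matrix.mul_assoc, Matrix.neg_mul, Matrix.mul_neg, neg_add]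
  rw [add_comm]

/-- The form `planeForm` is supported on a J-invariant span and is compatible with J. Hence this
deformation, like the conformal one, does not disturb a constant J. -/
theorem endo_comm_planeForm_mul :
    J₀ * (planeForm σ γ J₀ t * γ) = planeForm σ γ J₀ t * γ * J₀ := by
  have h1 : γ * J₀ = -(J₀ᵀ * γ) := by rw [h.transpose_mul_metric, neg_neg]
  rw [Matrix.mul_assoc, h1, Matrix.mul_neg, ← Matrix.mul_assoc (planeForm σ γ J₀ t),
    planeForm_mul_transpose h, Matrix.neg_mul, neg_neg, Matrix.mul_assoc]

theorem metric_planeForm :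
    (planeForm σ γ J₀ t * γ)ᵀ * γ + γ * (planeForm σ γ J₀ t * γ) =
      (2 : ℝ) • (γ * planeForm σ γ J₀ t * γ) := by
  rw [transpose_mul, planeForm_transpose h, h.symm, ← Matrix.mul_assoc, two_smul]

theorem inv_metric_planeForm_inv :
    γ⁻¹ * (γ * planeForm σ γ J₀ t * γ) * γ⁻¹ = planeForm σ γ J₀ t := by
  rw [← Matrix.mul_assoc, ← Matrix.mul_assoc, h.inv_mul, Matrix.one_mul, Matrix.mul_assoc,
    h.mul_inv, Matrix.mul_one]

/-- With n the gradient of z_t, the t-component of n is γ^{tt}, while that of Jn is zero because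
J₀γ⁻¹ is skew. -/
theorem planeForm_apply_self : planeForm σ γ J₀ t t t = γ⁻¹ t t * γ⁻¹ t t := by
  unfold planeForm
  rw [Matrix.add_apply, Matrix.smul_apply, mul_single_mul_apply, mul_single_mul_apply,
    h.bivector_diag]
  simp

/-- Since ⟨Jn, Jn⟩ = -σ⟨n, n⟩ and the second summand carries -σ, the two summands contribute
equally. -/
theorem trace_metric_planeForm :
    (γ⁻¹ * (γ * planeForm σ γ J₀ t * γ)).trace = 2 * γ⁻¹ t t := by
  rw [← Matrix.mul_assoc, ← Matrix.mul_assoc, h.inv_mul, Matrix.one_mul]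
  unfold planeForm
  rw [Matrix.add_mul, trace_add, Matrix.mul_assoc _ γ⁻¹ γ, h.inv_mul, Matrix.mul_one,
    trace_mul_single, Matrix.smul_mul, trace_smul, Matrix.mul_assoc, trace_mul_comm,
    ← Matrix.mul_assoc]
  have : J₀ * γ⁻¹ * γ * (J₀ * γ⁻¹) * single t t (1 : ℝ) = σ • (γ⁻¹ * single t t 1) := by
    rw [h.bivector_metric_bivector, Matrix.smul_mul]
  rw [this, trace_smul, trace_mul_single, smul_smul, h.sq_one, one_smul]
  ring

theorem bivector_metric_planeForm_apply :
    (J₀ * γ⁻¹ * (γ * planeForm σ γ J₀ t * γ) * (J₀ * γ⁻¹)) t t =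
      σ * (γ⁻¹ t t * γ⁻¹ t t) := by
  have h1 : J₀ * γ⁻¹ * (γ * planeForm σ γ J₀ t * γ) * (J₀ * γ⁻¹) =
      J₀ * planeForm σ γ J₀ t * (γ * (J₀ * γ⁻¹)) := by
    calc _ = J₀ * (γ⁻¹ * γ) * planeForm σ γ J₀ t * (γ * (J₀ * γ⁻¹)) := by
          simp only [Matrix.mul_assoc]
      _ = _ := by rw [h.inv_mul, Matrix.mul_one]
  have h2 : J₀ * γ⁻¹ * single t t 1 * γ⁻¹ * (γ * (J₀ * γ⁻¹)) =
      J₀ * γ⁻¹ * single t t 1 * (J₀ * γ⁻¹) := by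
    calc _ = J₀ * γ⁻¹ * single t t 1 * (γ⁻¹ * γ) * (J₀ * γ⁻¹) := by
          simp only [Matrix.mul_assoc]
      _ = _ := by rw [h.inv_mul, Matrix.mul_one]
  have h3 : γ⁻¹ * single t t 1 * (J₀ * γ⁻¹) * (γ * (J₀ * γ⁻¹)) =
      σ • (γ⁻¹ * single t t 1 * γ⁻¹) := by
    calc _ = γ⁻¹ * single t t 1 * (J₀ * γ⁻¹ * γ * (J₀ * γ⁻¹)) := by
          simp only [Matrix.mul_assoc]
      _ = _ := by rw [h.bivector_metric_bivector, Matrix.mul_smul]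
  rw [h1, endo_mul_planeForm h, Matrix.add_mul, h2, h3, Matrix.add_apply, Matrix.smul_apply,
    mul_single_mul_apply, mul_single_mul_apply, h.bivector_diag]
  simp

end Deformation

/-! ### Dimension two -/

section DimTwo

/-- For a formal jet this symmetry is not automatic: it relies on the second derivatives of the
frame being symmetric, whence `hE`. -/
theorem riem_antisymm_right {A : Type*} [CommRing A] {m : ℕ} {γ η E₀ : Matrix (Fin m) (Fin m) A}
    {E₁ : Fin m → Matrix (Fin m) (Fin m) A} {E₂ : Fin m → Fin m → Matrix (Fin m) (Fin m) A}
    (hγ : γᵀ = γ) (hη : ηᵀ = η) (hE : ∀ a b, E₂ a b = E₂ b a) (a b c d : Fin m) :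
    riem γ η E₀ E₁ E₂ a b d c = -riem γ η E₀ E₁ E₂ a b c d := by
  have hs : ∀ a b, met₂ γ E₀ E₁ E₂ a b = met₂ γ E₀ E₁ E₂ b a := fun a b => by
    unfold met₂; rw [hE a b]; abel
  have ht : ∀ a b c d, met₂ γ E₀ E₁ E₂ a b c d = met₂ γ E₀ E₁ E₂ a b d c := fun a b c d => by
    have : (met₂ γ E₀ E₁ E₂ a b)ᵀ = met₂ γ E₀ E₁ E₂ a b := by
      unfold met₂
      simp only [transpose_add, transpose_mul, transpose_transpose, hγ, Matrix.mul_assoc]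
      abel
    exact congrFun (congrFun this d) c
  have hc : ∀ e f, conj η E₀ e f = conj η E₀ f e := fun e f => by
    have : (conj η E₀)ᵀ = conj η E₀ := by
      unfold conj
      simp only [transpose_mul, transpose_transpose, hη, Matrix.mul_assoc]
    exact congrFun (congrFun this f) e
  have h1 : chr₁ γ E₀ E₁ E₂ a b d c - chr₁ γ E₀ E₁ E₂ b a d c =
      -(chr₁ γ E₀ E₁ E₂ a b c d - chr₁ γ E₀ E₁ E₂ b a c d) := by
    simp only [chr₁]
    rw [hs b a, ht a b d c]
    ring
  have h2 : ∑ e, ∑ f, conj η E₀ e f * (chr γ E₀ E₁ b d e * chr γ E₀ E₁ a c f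
      - chr γ E₀ E₁ a d e * chr γ E₀ E₁ b c f) =
      -∑ e, ∑ f, conj η E₀ e f * (chr γ E₀ E₁ b c e * chr γ E₀ E₁ a d f
      - chr γ E₀ E₁ a c e * chr γ E₀ E₁ b d f) := by
    rw [Finset.sum_comm, ← Finset.sum_neg_distrib]
    refine Finset.sum_congr rfl fun e _ => ?_
    rw [← Finset.sum_neg_distrib]
    refine Finset.sum_congr rfl fun f _ => ?_
    rw [hc f e]
    ring
  unfold riem
  rw [h1, h2]
  ring

theorem riem_antisymm_left {A : Type*} [CommRing A] {m : ℕ} (γ η E₀ : Matrix (Fin m) (Fin m) A)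
    (E₁ : Fin m → Matrix (Fin m) (Fin m) A) (E₂ : Fin m → Fin m → Matrix (Fin m) (Fin m) A)
    (a b c d : Fin m) :
    riem γ η E₀ E₁ E₂ b a c d = -riem γ η E₀ E₁ E₂ a b c d := by
  have h2 : ∑ e, ∑ f, conj η E₀ e f * (chr γ E₀ E₁ a c e * chr γ E₀ E₁ b d f
      - chr γ E₀ E₁ b c e * chr γ E₀ E₁ a d f) =
      -∑ e, ∑ f, conj η E₀ e f * (chr γ E₀ E₁ b c e * chr γ E₀ E₁ a d f
      - chr γ E₀ E₁ a c e * chr γ E₀ E₁ b d f) := by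
    simp only [← Finset.sum_neg_distrib]
    exact Finset.sum_congr rfl fun e _ => Finset.sum_congr rfl fun f _ => by ring
  unfold riem
  rw [h2]
  ring

/-- In dimension two the curvature symmetries leave a single component, and contracting it with two
copies of a matrix produces the determinant of that matrix. -/
theorem scal_dim_two {γ η X E₀ : Matrix (Fin 2) (Fin 2) ℝ}
    {E₁ : Fin 2 → Matrix (Fin 2) (Fin 2) ℝ} {E₂ : Fin 2 → Fin 2 → Matrix (Fin 2) (Fin 2) ℝ}
    (hγ : γᵀ = γ) (hη : ηᵀ = η) (hE : ∀ a b, E₂ a b = E₂ b a) :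
    scal γ η X E₀ E₁ E₂ = -2 * riem γ η E₀ E₁ E₂ 0 1 0 1 * E₀.adjugate.det ^ 2 * X.det := by
  set R := riem γ η E₀ E₁ E₂ with hR
  have hl : ∀ a b c d, R b a c d = -R a b c d := fun a b c d => riem_antisymm_left ..
  have hr : ∀ a b c d, R a b d c = -R a b c d := fun a b c d =>
    riem_antisymm_right hγ hη hE a b c d
  have h1 : ∀ a c d, R a a c d = 0 := fun a c d => by linarith [hl a a c d]
  have h2 : ∀ a b c, R a b c c = 0 := fun a b c => by linarith [hr a b c c]
  have hdet : (conj X E₀).det = E₀.adjugate.det ^ 2 * X.det := by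
    rw [conj, det_mul, det_mul, det_transpose]; ring
  unfold scal
  rw [mul_assoc, ← hdet, det_fin_two]
  simp only [← hR, Fin.sum_univ_two, h1, h2, hl 0 1, hr 0 1 0 1]
  ring

/-- A traceless 2×2 matrix with square σ has determinant -σ, which is the ratio of the determinants
of the two contracting matrices. So the two scalar curvature equations are proportional on surfaces.
-/
theorem CompatPair.scal_bivector {σ : ℝ} {γ J₀ E₀ : Matrix (Fin 2) (Fin 2) ℝ}
    (h : CompatPair σ γ J₀)
    {E₁ : Fin 2 → Matrix (Fin 2) (Fin 2) ℝ} {E₂ : Fin 2 → Fin 2 → Matrix (Fin 2) (Fin 2) ℝ}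
    (hE : ∀ a b, E₂ a b = E₂ b a) :
    scal γ γ⁻¹ (J₀ * γ⁻¹) E₀ E₁ E₂ = -σ * scal γ γ⁻¹ γ⁻¹ E₀ E₁ E₂ := by
  have hJ : J₀.det = -σ := by
    have h1 := congrFun (congrFun h.sq 0) 0
    have h2 := h.trace_eq_zero
    simp only [Matrix.mul_apply, Fin.sum_univ_two, Matrix.smul_apply, Matrix.one_apply_eq,
      smul_eq_mul, mul_one] at h1
    simp only [Matrix.trace, Matrix.diag, Fin.sum_univ_two] at h2
    rw [det_fin_two]
    linear_combination (J₀ 0 0) * h2 - h1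
  rw [scal_dim_two h.symm h.inv_symm hE, scal_dim_two h.symm h.inv_symm hE, det_mul, hJ]
  ring

end DimTwo

end FrameJet

/-! ### Symmetry of second derivatives. -/

namespace Coord

theorem partialD_comm {m : ℕ} {f : CoordSpace m → ℝ} {s : Set (CoordSpace m)} (hs : IsOpen s)
    (hf : ContDiffOn ℝ ∞ f s) {z : CoordSpace m} (hz : z ∈ s) (a b : Fin m) :
    partialD (partialD f a) b z = partialD (partialD f b) a z := by
  have hf' := hf.contDiffAt (hs.mem_nhds hz)
  have hd : DifferentiableAt ℝ (fderiv ℝ f) z :=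
    (hf'.fderiv_right (m := 1) (by norm_cast)).differentiableAt (by simp)
  have h : ∀ a b, partialD (partialD f a) b z =
      fderiv ℝ (fderiv ℝ f) z (EuclideanSpace.single b 1) (EuclideanSpace.single a 1) := by
    intro a b
    have := fderiv_clm_apply hd (differentiableAt_const (EuclideanSpace.single a (1 : ℝ)))
    change fderiv ℝ (fun v => fderiv ℝ f v (EuclideanSpace.single a 1)) z _ = _
    rw [this]
    simp
  rw [h, h]
  have h2 : minSmoothness ℝ 2 ≤ ∞ := by
    rw [minSmoothness_of_isRCLikeNormedField]
    exact WithTop.coe_le_coe.2 (le_top : (2 : ℕ∞) ≤ ⊤)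
  exact (hf'.isSymmSndFDerivAt h2).eq _ _

end Coord

/-! ### The system for constant scalar and star-scalar curvature. -/

namespace FrameJet

open Matrix Coord

variable {σ : ℝ} {m : ℕ} {γ J₀ : Matrix (Fin m) (Fin m) ℝ}

/-- The two deformations of the frame: a plane rescaling and a conformal one. -/
noncomputable def deform (σ : ℝ) (γ J₀ : Matrix (Fin m) (Fin m) ℝ) (t : Fin m) :
    Fin 2 → Matrix (Fin m) (Fin m) ℝ :=
  ![planeForm σ γ J₀ t * γ, 1]

theorem CompatPair.scalJet_metric_jetPure (h : CompatPair σ γ J₀) (t : Fin m)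
    (Q : Fin m → Fin m → Matrix (Fin m) (Fin m) ℝ) (w : Fin 2 → ℝ) :
    scalJet Q (deform σ γ J₀ t) (jetPure t w) γ γ⁻¹ γ⁻¹ =
      scalJet Q (deform σ γ J₀ t) (jetPure t 0) γ γ⁻¹ γ⁻¹
        - 8 * γ⁻¹ t t * (γ⁻¹ t t * w 0 + (m - 1) * w 1) := by
  rw [scalJet_jetPure, Fin.sum_univ_two]
  simp only [deform, cons_val_zero, cons_val_one, metric_planeForm h, transpose_one,
    Matrix.one_mul, Matrix.mul_one, ← two_smul ℝ γ, Matrix.mul_smul, Matrix.smul_mul,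
    Matrix.smul_apply, smul_eq_mul, trace_smul, inv_metric_planeForm_inv h,
    planeForm_apply_self h, trace_metric_planeForm h, h.inv_mul, trace_one, Fintype.card_fin]
  ring

/-- The trace term of the symbol drops out, because the bivector has no diagonal entries. This
leaves the coefficient 1 at `w 1` where the metric contraction has m - 1, so the two rows are
independent unless m = 2. -/
theorem CompatPair.scalJet_bivector_jetPure (h : CompatPair σ γ J₀) (t : Fin m)
    (Q : Fin m → Fin m → Matrix (Fin m) (Fin m) ℝ) (w : Fin 2 → ℝ) :
    scalJet Q (deform σ γ J₀ t) (jetPure t w) γ γ⁻¹ (J₀ * γ⁻¹) =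
      scalJet Q (deform σ γ J₀ t) (jetPure t 0) γ γ⁻¹ (J₀ * γ⁻¹)
        + 8 * σ * γ⁻¹ t t * (γ⁻¹ t t * w 0 + w 1) := by
  rw [scalJet_jetPure, Fin.sum_univ_two]
  simp only [deform, cons_val_zero, cons_val_one, metric_planeForm h, transpose_one,
    Matrix.one_mul, Matrix.mul_one, ← two_smul ℝ γ, Matrix.mul_smul, Matrix.smul_mul,
    Matrix.smul_apply, smul_eq_mul, h.bivector_diag,
    bivector_metric_planeForm_apply h, h.bivector_metric_bivector]
  ring

/-- The polynomial equation expressing that a contracted curvature agrees with its value at the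
origin. -/
noncomputable def scalEq (Q : Fin m → Fin m → Matrix (Fin m) (Fin m) ℝ)
    (N : Fin 2 → Matrix (Fin m) (Fin m) ℝ) (t : Fin m) (γ X : Matrix (Fin m) (Fin m) ℝ) :
    MvPolynomial (JetVar m 2) ℝ :=
  scalJet Q N MvPolynomial.X γ γ⁻¹ X -
    MvPolynomial.C (scalJet Q N (jetPure t 0) γ γ⁻¹ X) * (frame₀ Q N MvPolynomial.X).det ^ 6

theorem eval_scalEq (Q : Fin m → Fin m → Matrix (Fin m) (Fin m) ℝ)
    (N : Fin 2 → Matrix (Fin m) (Fin m) ℝ) (t : Fin m) (γ X : Matrix (Fin m) (Fin m) ℝ)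
    (y : JetVar m 2 → ℝ) : MvPolynomial.eval y (scalEq Q N t γ X) =
      scalJet Q N y γ γ⁻¹ X - scalJet Q N (jetPure t 0) γ γ⁻¹ X * (frame₀ Q N y).det ^ 6 := by
  simp only [scalEq, map_sub, map_mul, map_pow, MvPolynomial.eval_C, eval_scalJet,
    eval_det_frame₀]

theorem frame₂_symm (Q : Fin m → Fin m → Matrix (Fin m) (Fin m) ℝ)
    (N : Fin 2 → Matrix (Fin m) (Fin m) ℝ) {y : JetVar m 2 → ℝ}
    (hy : ∀ j a b, y (.d2 j a b) = y (.d2 j b a)) (a b : Fin m) :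
    frame₂ Q N y a b = frame₂ Q N y b a := by
  unfold frame₂
  rw [add_comm (Q a b)]
  simp only [hy _ a b]

/-- Functions whose jets make both contracted curvatures of the deformed frame constant. -/
theorem CompatPair.exists_deformation (h : CompatPair σ γ J₀) (t : Fin m) (ht : γ⁻¹ t t ≠ 0)
    (Q : Fin m → Fin m → Matrix (Fin m) (Fin m) ℝ) :
    ∃ r > 0, ∃ u : Fin 2 → CoordSpace m → ℝ,
      (∀ j, ContDiffOn ℝ ∞ (u j) (Metric.ball 0 r)) ∧ jetAt u 0 = jetPure t 0 ∧
      ∀ z ∈ Metric.ball (0 : CoordSpace m) r,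
        MvPolynomial.eval (jetAt u z) (scalEq Q (deform σ γ J₀ t) t γ γ⁻¹) = 0 ∧
        MvPolynomial.eval (jetAt u z) (scalEq Q (deform σ γ J₀ t) t γ (J₀ * γ⁻¹)) = 0 := by
  obtain ⟨c, hc⟩ : ∃ c, c = γ⁻¹ t t := ⟨_, rfl⟩
  have hc0 : c ≠ 0 := hc ▸ ht
  have h1 : ∀ w : Fin 2 → ℝ, MvPolynomial.eval (jetPure t w)
      (scalEq Q (deform σ γ J₀ t) t γ γ⁻¹) = -8 * c * (c * w 0 + (m - 1) * w 1) := fun w => by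
    rw [eval_scalEq, h.scalJet_metric_jetPure, frame₀_jetPure, det_one, ← hc]; ring
  have h2 : ∀ w : Fin 2 → ℝ, MvPolynomial.eval (jetPure t w)
      (scalEq Q (deform σ γ J₀ t) t γ (J₀ * γ⁻¹)) = 8 * σ * c * (c * w 0 + w 1) := fun w => by
    rw [eval_scalEq, h.scalJet_bivector_jetPure, frame₀_jetPure, det_one, ← hc]; ring
  set P := scalEq Q (deform σ γ J₀ t) t γ γ⁻¹ with hP
  set P' := scalEq Q (deform σ γ J₀ t) t γ (J₀ * γ⁻¹) with hP'
  -- The determinant of the two linear forms in `w` is a nonzero multiple of m - 2.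
  by_cases hm : m = 2
  · subst hm
    -- Only one equation is independent here, so the system is completed by ∂_t² u₁ = 0.
    set F₁ : MvPolynomial (JetVar 2 2) ℝ := MvPolynomial.X (.d2 1 t t)
    set F₀ : MvPolynomial (JetVar 2 2) ℝ :=
      MvPolynomial.C c⁻¹ * (MvPolynomial.C (-(8 * c)⁻¹) * P - F₁)
    obtain ⟨r, hr, u, hu, hu0, hsol⟩ := exists_solution_of_polynomial_jet_equation t ![F₀, F₁]
      (by
        intro w i
        have e1 : MvPolynomial.eval (jetPure t w) F₁ = w 1 := by
          simp [F₁, jetPure, jetOf]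
        fin_cases i
        · simp only [Fin.zero_eta, cons_val_zero, F₀, map_mul, map_sub, MvPolynomial.eval_C,
            e1, h1]
          field_simp
          push_cast
          ring
        · exact e1)
    refine ⟨r, hr, u, hu, hu0, fun z hz => ?_⟩
    have e1 : MvPolynomial.eval (jetAt u z) F₁ = 0 := hsol z hz 1
    have e0 : MvPolynomial.eval (jetAt u z) F₀ = 0 := hsol z hz 0
    have e2 : MvPolynomial.eval (jetAt u z) P = 0 := by
      simp only [F₀, map_mul, map_sub, MvPolynomial.eval_C, e1, sub_zero] at e0
      simpa [hc0] using e0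
    refine ⟨e2, ?_⟩
    -- The proportionality of the two contractions fails for arbitrary jets. It is therefore applied
    -- to the jet of the solution, where second derivatives commute.
    have hsym : ∀ j a b, jetAt u z (.d2 j a b) = jetAt u z (.d2 j b a) := fun j a b =>
      partialD_comm Metric.isOpen_ball (hu j) hz a b
    have e3 : scalJet Q (deform σ γ J₀ t) (jetAt u z) γ γ⁻¹ (J₀ * γ⁻¹) =
        -σ * scalJet Q (deform σ γ J₀ t) (jetAt u z) γ γ⁻¹ γ⁻¹ := by
      simp only [scalJet, cst_real]
      exact h.scal_bivector (frame₂_symm Q _ hsym)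
    have e4 : scalJet Q (deform σ γ J₀ t) (jetPure t 0) γ γ⁻¹ (J₀ * γ⁻¹) =
        -σ * scalJet Q (deform σ γ J₀ t) (jetPure t 0) γ γ⁻¹ γ⁻¹ := by
      simp only [scalJet, cst_real]
      exact h.scal_bivector (frame₂_symm Q _ (by simp [jetPure, jetOf]))
    rw [hP, eval_scalEq] at e2
    rw [hP', eval_scalEq, e3, e4]
    linear_combination -σ * e2
  · have hm2 : (m : ℝ) - 2 ≠ 0 := by
      intro h0
      exact hm (by exact_mod_cast (sub_eq_zero.mp h0 : (m : ℝ) = 2))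
    have hσ0 : σ ≠ 0 := fun h0 => by simpa [h0] using h.sq_one
    -- Elimination: since σ² = 1, adding σ times the star equation cancels `w 0` and leaves -8c(m -
    -- 2) `w 1`; substituting back isolates `w 0`.
    set F₁ : MvPolynomial (JetVar m 2) ℝ :=
      MvPolynomial.C (-(8 * c * (m - 2))⁻¹) * (P + MvPolynomial.C σ * P')
    set F₀ : MvPolynomial (JetVar m 2) ℝ :=
      MvPolynomial.C c⁻¹ * (MvPolynomial.C (σ * (8 * c)⁻¹) * P' - F₁)
    obtain ⟨r, hr, u, hu, hu0, hsol⟩ := exists_solution_of_polynomial_jet_equation t ![F₀, F₁]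
      (by
        intro w i
        have e1 : MvPolynomial.eval (jetPure t w) F₁ = w 1 := by
          simp only [F₁, map_mul, map_add, MvPolynomial.eval_C, h1, h2]
          field_simp
          linear_combination (-(c * w 0 + w 1)) * h.sq_one
        fin_cases i
        · simp only [Fin.zero_eta, cons_val_zero, F₀, map_mul, map_sub, MvPolynomial.eval_C,
            e1, h2]
          field_simp
          linear_combination (c * w 0 + w 1) * h.sq_one
        · exact e1)
    refine ⟨r, hr, u, hu, hu0, fun z hz => ?_⟩
    have e1 : MvPolynomial.eval (jetAt u z) F₁ = 0 := hsol z hz 1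
    have e0 : MvPolynomial.eval (jetAt u z) F₀ = 0 := hsol z hz 0
    have e2 : MvPolynomial.eval (jetAt u z) P' = 0 := by
      simp only [F₀, map_mul, map_sub, MvPolynomial.eval_C, e1, sub_zero] at e0
      simpa [hc0, hσ0] using e0
    refine ⟨?_, e2⟩
    simp only [F₁, map_mul, map_add, MvPolynomial.eval_C, e2, mul_zero, add_zero] at e1
    simpa [hc0, hm2] using e1

/-- A smooth frame with prescribed 2-jet at the origin whose metric and (para-)complex structure
have constant scalar and `⋆`-scalar curvature. -/
structure GoodFrame (σ : ℝ) (γ J₀ : Matrix (Fin m) (Fin m) ℝ)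
    (Q : Fin m → Fin m → Matrix (Fin m) (Fin m) ℝ) (r : ℝ)
    (E : CoordSpace m → Matrix (Fin m) (Fin m) ℝ) : Prop where
  pos : 0 < r
  smooth : SmoothM E (Metric.ball 0 r)
  det_ne_zero : ∀ v ∈ Metric.ball 0 r, (E v).det ≠ 0
  origin : E 0 = 1
  partial_origin : ∀ a, partialM E a 0 = 0
  partial₂_origin : ∀ a b, partialM (partialM E a) b 0 = Q a b + Q b a
  scalar : ∃ c, ∀ v ∈ Metric.ball 0 r, scalarCurv (fun v => met γ (E v)) v = c
  starScalar : ∃ c, ∀ v ∈ Metric.ball 0 r,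
    starScalarCurv σ (fun v => met γ (E v)) (fun v => (E v)⁻¹ * J₀ * E v) v = c
  comm : (∀ a b, J₀ * Q a b = Q a b * J₀) → ∀ v, J₀ * E v = E v * J₀

/-- After shrinking the ball so that det E ≠ 0, its sixth power can be cancelled from the polynomial
equations, and both scalar curvatures equal their values on the trivial jet. Commutation with J₀
holds because E is a combination of 1, the Q's and the two deformations. -/
theorem CompatPair.exists_goodFrame (h : CompatPair σ γ J₀) (t : Fin m) (ht : γ⁻¹ t t ≠ 0)
    (Q : Fin m → Fin m → Matrix (Fin m) (Fin m) ℝ) : ∃ r E, GoodFrame σ γ J₀ Q r E := by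
  obtain ⟨r₀, hr₀, u, hu, hu0, hsol⟩ := h.exists_deformation t ht Q
  set N := deform σ γ J₀ t with hN
  set E : CoordSpace m → Matrix (Fin m) (Fin m) ℝ := fun v => frame₀ Q N (jetAt u v) with hE
  have hsm : SmoothM E (Metric.ball 0 r₀) := smoothM_frame₀ Q N hu
  have hE0 : E 0 = 1 := by rw [hE]; simp only [hu0, frame₀_jetPure]
  have hdet0 : ∀ᶠ v in nhds (0 : CoordSpace m), (E v).det ≠ 0 := by
    have hc : ContinuousAt (fun v => (E v).det) 0 :=
      (hsm.det.contDiffAt (Metric.ball_mem_nhds 0 hr₀)).continuousAt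
    refine hc.eventually_ne ?_
    simp [hE0]
  obtain ⟨r₁, hr₁, hball⟩ := Metric.eventually_nhds_iff_ball.mp hdet0
  have hsub : Metric.ball (0 : CoordSpace m) (min r₀ r₁) ⊆ Metric.ball 0 r₀ :=
    Metric.ball_subset_ball (min_le_left _ _)
  have hdet : ∀ v ∈ Metric.ball (0 : CoordSpace m) (min r₀ r₁), (E v).det ≠ 0 := fun v hv =>
    hball v (Metric.ball_subset_ball (min_le_right _ _) hv)
  have hsm' : SmoothM E (Metric.ball 0 (min r₀ r₁)) := fun i j => (hsm i j).mono hsub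
  have hsymm : γ.IsSymm := h.symm
  have h0 : (0 : CoordSpace m) ∈ Metric.ball (0 : CoordSpace m) r₀ := Metric.mem_ball_self hr₀
  have hval : ∀ X, ∀ v ∈ Metric.ball (0 : CoordSpace m) r₀, scalJet Q N (jetAt u v) γ γ⁻¹ X =
      scal γ γ⁻¹ X (E v) (fun a => partialM E a v) (fun a b => partialM (partialM E a) b v) := by
    intro X v hv
    simp only [scalJet, cst_real]
    congr 1
    · funext a; exact (partialM_frame₀ Q N hu Metric.isOpen_ball hv a).symm
    · funext a b; exact (partialM_partialM_frame₀ Q N hu Metric.isOpen_ball hv a b).symm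
  refine ⟨min r₀ r₁, E, lt_min hr₀ hr₁, hsm', hdet, hE0, fun a => ?_, fun a b => ?_, ?_, ?_, ?_⟩
  · rw [partialM_frame₀ Q N hu Metric.isOpen_ball h0, hu0, frame₁_jetPure]; rfl
  · rw [partialM_partialM_frame₀ Q N hu Metric.isOpen_ball h0, hu0, frame₂_jetPure]
    simp
  · refine ⟨scalJet Q N (jetPure t 0) γ γ⁻¹ γ⁻¹ / 4, fun v hv => ?_⟩
    have e := (hsol v (hsub hv)).1
    rw [eval_scalEq, hval _ v (hsub hv), scal_eq_scalarCurv hsm' Metric.isOpen_ball hsymm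
      h.det_ne_zero hdet hv] at e
    have hd : (E v).det ^ 6 ≠ 0 := pow_ne_zero 6 (hdet v hv)
    have e' : (E v).det ^ 6 * (4 * scalarCurv (fun v => met γ (E v)) v -
        scalJet Q N (jetPure t 0) γ γ⁻¹ γ⁻¹) = 0 := by rw [← e]; ring
    have := (mul_eq_zero.mp e').resolve_left hd
    linarith
  · refine ⟨-σ * scalJet Q N (jetPure t 0) γ γ⁻¹ (J₀ * γ⁻¹) / 4, fun v hv => ?_⟩
    have e := (hsol v (hsub hv)).2
    have e2 := scal_eq_starScalarCurv hsm' Metric.isOpen_ball hsymm h.det_ne_zero hdet hv σ J₀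
    rw [eval_scalEq, hval _ v (hsub hv)] at e
    have hd : (E v).det ^ 6 ≠ 0 := pow_ne_zero 6 (hdet v hv)
    have e' : (E v).det ^ 6 * (4 * starScalarCurv σ (fun v => met γ (E v))
        (fun v => (E v)⁻¹ * J₀ * E v) v - -σ * scalJet Q N (jetPure t 0) γ γ⁻¹ (J₀ * γ⁻¹)) = 0 := by
      change _ - _ * (E v).det ^ 6 = 0 at e
      linear_combination -e2 - σ * e
    have := (mul_eq_zero.mp e').resolve_left hd
    linarith
  · intro hQ v
    simp only [hE, frame₀, cst_real, Matrix.mul_add, Matrix.add_mul, Matrix.mul_one,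
      Matrix.one_mul, Matrix.mul_sum, Matrix.sum_mul, Matrix.mul_smul, Matrix.smul_mul, hQ,
      Fin.sum_univ_two]
    simp only [hN, deform, cons_val_zero, cons_val_one, endo_comm_planeForm_mul h,
      Matrix.mul_one, Matrix.one_mul]

end FrameJet

/-! ### Manifolds with a single chart -/

section SingleChart

open scoped Topology

variable {m : ℕ} {M : Type*} [TopologicalSpace M] [ChartedSpace (CoordSpace m) M]

/-- All preferred charts agree with the global chart `f`, whose image is `s`. -/
structure IsSingleChart (f : M → CoordSpace m) (s : Set (CoordSpace m)) : Prop where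
  coe : ∀ p q : M, extChartAt 𝓘(ℝ, CoordSpace m) p q = f q
  source : ∀ p : M, (extChartAt 𝓘(ℝ, CoordSpace m) p).source = Set.univ
  target : ∀ p : M, (extChartAt 𝓘(ℝ, CoordSpace m) p).target = s

namespace IsSingleChart

variable {f : M → CoordSpace m} {s : Set (CoordSpace m)} (h : IsSingleChart f s)
include h

theorem apply_symm (p : M) {u : CoordSpace m} (hu : u ∈ s) :
    f ((extChartAt 𝓘(ℝ, CoordSpace m) p).symm u) = u := by
  rw [← h.coe p]
  exact (extChartAt 𝓘(ℝ, CoordSpace m) p).right_inv (by rwa [h.target])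

theorem mem (q : M) : f q ∈ s := by
  rw [← h.coe q, ← h.target q]
  exact mem_extChartAt_target q

theorem isOpen (p : M) : IsOpen s := by
  rw [← h.target p]
  exact isOpen_extChartAt_target p

variable [IsManifold 𝓘(ℝ, CoordSpace m) ∞ M]

/-- All preferred charts being the same map, the coordinate change at any point is the identity, and
so is the identification of the tangent space with the model. -/
theorem coordComp_eq (p q : M) (v : TangentSpace 𝓘(ℝ, CoordSpace m) q) : coordComp p q v = v := by
  have : IsManifold 𝓘(ℝ, CoordSpace m) 1 M := .of_le (n := ∞) (by simp)
  have hd : MDifferentiableAt 𝓘(ℝ, CoordSpace m) 𝓘(ℝ, CoordSpace m)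
      (extChartAt 𝓘(ℝ, CoordSpace m) p) q := mdifferentiableAt_extChartAt (by
    rw [← extChartAt_source 𝓘(ℝ, CoordSpace m), h.source]; trivial)
  have hw : writtenInExtChartAt 𝓘(ℝ, CoordSpace m) 𝓘(ℝ, CoordSpace m) q
      (extChartAt 𝓘(ℝ, CoordSpace m) p) =ᶠ[𝓝 (extChartAt 𝓘(ℝ, CoordSpace m) q q)] id := by
    filter_upwards [(h.isOpen p).mem_nhds (by rw [h.coe]; exact h.mem q)] with v hv
    change extChartAt 𝓘(ℝ, CoordSpace m) p ((extChartAt 𝓘(ℝ, CoordSpace m) q).symm v) = v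
    rw [h.coe, h.apply_symm q hv]
  have hr : Set.range 𝓘(ℝ, CoordSpace m) = Set.univ := by simp
  unfold coordComp
  rw [hd.mfderiv, hr, fderivWithin_univ, hw.fderiv_eq, fderiv_id]
  rfl

theorem coordVec_eq (p : M) {u : CoordSpace m} (hu : u ∈ s) (a : Fin m) :
    coordVec p u a = (EuclideanSpace.single a (1 : ℝ) : CoordSpace m) := by
  have : IsManifold 𝓘(ℝ, CoordSpace m) 1 M := .of_le (n := ∞) (by simp)
  have hr : Set.range 𝓘(ℝ, CoordSpace m) = Set.univ := by simp
  have hd : MDifferentiableAt 𝓘(ℝ, CoordSpace m) 𝓘(ℝ, CoordSpace m)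
      (extChartAt 𝓘(ℝ, CoordSpace m) p).symm u := by
    have := mdifferentiableWithinAt_extChartAt_symm (I := 𝓘(ℝ, CoordSpace m)) (x := p) (z := u)
      (by rwa [h.target])
    rwa [hr, mdifferentiableWithinAt_univ] at this
  have hw : writtenInExtChartAt 𝓘(ℝ, CoordSpace m) 𝓘(ℝ, CoordSpace m) u
      (extChartAt 𝓘(ℝ, CoordSpace m) p).symm =ᶠ[𝓝 u] id := by
    filter_upwards [(h.isOpen p).mem_nhds hu] with v hv
    change extChartAt 𝓘(ℝ, CoordSpace m) ((extChartAt 𝓘(ℝ, CoordSpace m) p).symm u)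
      ((extChartAt 𝓘(ℝ, CoordSpace m) p).symm v) = v
    rw [h.coe, h.apply_symm p hv]
  unfold coordVec
  rw [hd.mfderiv, hr, fderivWithin_univ, show extChartAt 𝓘(ℝ, CoordSpace m) u u = u from rfl,
    hw.fderiv_eq, fderiv_id]
  rfl

end IsSingleChart

end SingleChart

/-! ### Bilinear forms and endomorphisms given by matrices. -/

/-- The bilinear form with a given matrix. -/
noncomputable def matForm {m : ℕ} (X : Matrix (Fin m) (Fin m) ℝ) :
    CoordSpace m →ₗ[ℝ] CoordSpace m →ₗ[ℝ] ℝ :=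
  LinearMap.mk₂ ℝ (fun x y => WithLp.ofLp x ⬝ᵥ X.mulVec (WithLp.ofLp y))
    (by simp) (by simp) (by simp [Matrix.mulVec_add]) (by simp [Matrix.mulVec_smul])

theorem matForm_apply {m : ℕ} (X : Matrix (Fin m) (Fin m) ℝ) (x y : CoordSpace m) :
    matForm X x y = WithLp.ofLp x ⬝ᵥ X.mulVec (WithLp.ofLp y) := rfl

theorem matForm_single {m : ℕ} (X : Matrix (Fin m) (Fin m) ℝ) (a b : Fin m) :
    matForm X (EuclideanSpace.single a (1 : ℝ)) (EuclideanSpace.single b (1 : ℝ)) = X a b := by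
  simp [matForm_apply]

theorem matForm_toEuclideanLin {m : ℕ} (X Y : Matrix (Fin m) (Fin m) ℝ) (x y : CoordSpace m) :
    matForm X (Matrix.toEuclideanLin Y x) (Matrix.toEuclideanLin Y y) =
      matForm (Y.transpose * X * Y) x y := by
  simp only [matForm_apply, Matrix.toLpLin_apply, ← Matrix.mulVec_mulVec]
  rw [Matrix.dotProduct_mulVec x.ofLp Y.transpose, Matrix.vecMul_transpose]

theorem toEuclideanLin_toEuclideanLin {m : ℕ} (X Y : Matrix (Fin m) (Fin m) ℝ)
    (x : CoordSpace m) :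
    Matrix.toEuclideanLin X (Matrix.toEuclideanLin Y x) = Matrix.toEuclideanLin (X * Y) x := by
  simp only [Matrix.toLpLin_apply, Matrix.mulVec_mulVec]

theorem toEuclideanLin_one_apply {m : ℕ} (x : CoordSpace m) :
    Matrix.toEuclideanLin (1 : Matrix (Fin m) (Fin m) ℝ) x = x := by
  simp

theorem eq_zero_of_matForm_eq_zero {m : ℕ} {X : Matrix (Fin m) (Fin m) ℝ} (hX : X.det ≠ 0)
    {x : CoordSpace m} (h : ∀ y, matForm X x y = 0) : x = 0 := by
  have h1 : Matrix.vecMul x.ofLp X = 0 := by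
    refine dotProduct_eq_zero _ fun w => ?_
    rw [← Matrix.dotProduct_mulVec]
    exact h (WithLp.toLp 2 w)
  have h2 := Matrix.eq_zero_of_vecMul_eq_zero hX h1
  ext i
  exact congrFun h2 i

theorem matForm_symm {m : ℕ} {X : Matrix (Fin m) (Fin m) ℝ} (hX : X.transpose = X)
    (x y : CoordSpace m) : matForm X x y = matForm X y x := by
  rw [matForm_apply, matForm_apply, Matrix.dotProduct_mulVec, ← Matrix.mulVec_transpose, hX,
    dotProduct_comm]

/-! ### Locality of the curvature -/

namespace Coord

open scoped Topology

variable {m : ℕ} {G G' K K' : CoordSpace m → Matrix (Fin m) (Fin m) ℝ} {z : CoordSpace m}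

theorem christoffel_congr (h : G =ᶠ[𝓝 z] G') (a b c : Fin m) :
    christoffel G a b c z = christoffel G' a b c z := by
  have h' : ∀ a b, (fun v => G v a b) =ᶠ[𝓝 z] fun v => G' v a b := fun a b => by
    filter_upwards [h] with v hv
    rw [hv]
  simp only [christoffel, christoffelLow, h.eq_of_nhds, partialD_congr (h' _ _)]

theorem curvLow_congr (h : G =ᶠ[𝓝 z] G') (a b c d : Fin m) :
    curvLow G a b c d z = curvLow G' a b c d z := by
  have h' : ∀ a b c, christoffel G a b c =ᶠ[𝓝 z] christoffel G' a b c := fun a b c => by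
    filter_upwards [h.eventually_nhds] with v hv using christoffel_congr hv a b c
  simp only [curvLow, curvUp, h.eq_of_nhds, partialD_congr (h' _ _ _), (h' _ _ _).eq_of_nhds]

theorem scalarCurv_congr (h : G =ᶠ[𝓝 z] G') : scalarCurv G z = scalarCurv G' z := by
  simp only [scalarCurv, h.eq_of_nhds, curvLow_congr h]

theorem starScalarCurv_congr (h : G =ᶠ[𝓝 z] G') (hK : K z = K' z) (σ : ℝ) :
    starScalarCurv σ G K z = starScalarCurv σ G' K' z := by
  simp only [starScalarCurv, h.eq_of_nhds, curvLow_congr h, hK]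

theorem nijenhuis_congr (h : K =ᶠ[𝓝 z] K') (a b d : Fin m) :
    nijenhuis K a b d z = nijenhuis K' a b d z := by
  have h' : ∀ a b, (fun v => K v a b) =ᶠ[𝓝 z] fun v => K' v a b := fun a b => by
    filter_upwards [h] with v hv
    rw [hv]
  simp only [nijenhuis, h.eq_of_nhds, partialD_congr (h' _ _)]

theorem dKaehlerForm_eq_zero (h : ∀ a b c, partialM (fun v => G v * K v) a z b c = 0)
    (a b c : Fin m) : dKaehlerForm G K a b c z = 0 := by
  have h' : ∀ a b c, partialD (kaehlerForm G K b c) a z = 0 := fun a b c => h a b c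
  simp only [dKaehlerForm, h', add_zero]

end Coord

/-! ### The almost (para-)Hermitian structure of a frame. -/

namespace FrameJet

open Matrix Coord

open scoped Topology

variable {σ : ℝ} {m : ℕ} {γ J₀ : Matrix (Fin m) (Fin m) ℝ}
  {Q : Fin m → Fin m → Matrix (Fin m) (Fin m) ℝ} {r : ℝ}
  {E : CoordSpace m → Matrix (Fin m) (Fin m) ℝ}

theorem met_mul (γ X Y : Matrix (Fin m) (Fin m) ℝ) : met γ (X * Y) = Yᵀ * met γ X * Y := by
  simp only [met, transpose_mul, Matrix.mul_assoc]

/-- The (para-)complex structure which is constant with respect to the frame. -/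
noncomputable def frameEndo (J₀ E₀ : Matrix (Fin m) (Fin m) ℝ) : Matrix (Fin m) (Fin m) ℝ :=
  E₀⁻¹ * J₀ * E₀

section

variable {E₀ : Matrix (Fin m) (Fin m) ℝ} (hE₀ : E₀.det ≠ 0)
include hE₀

theorem mul_frameEndo : E₀ * frameEndo J₀ E₀ = J₀ * E₀ := by
  rw [frameEndo, ← Matrix.mul_assoc, ← Matrix.mul_assoc,
    mul_nonsing_inv _ (isUnit_iff_ne_zero.mpr hE₀), Matrix.one_mul]

theorem frameEndo_sq (h : CompatPair σ γ J₀) :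
    frameEndo J₀ E₀ * frameEndo J₀ E₀ = σ • 1 := by
  nth_rw 1 [frameEndo]
  rw [Matrix.mul_assoc, mul_frameEndo hE₀, Matrix.mul_assoc, ← Matrix.mul_assoc J₀, h.sq,
    Matrix.smul_mul, Matrix.mul_smul, Matrix.one_mul,
    nonsing_inv_mul _ (isUnit_iff_ne_zero.mpr hE₀)]

theorem frameEndo_compat (h : CompatPair σ γ J₀) :
    (frameEndo J₀ E₀)ᵀ * met γ E₀ * frameEndo J₀ E₀ = -σ • met γ E₀ := by
  rw [← met_mul, mul_frameEndo hE₀, met_mul, met, h.compat, met]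
  simp only [Matrix.mul_smul, Matrix.smul_mul]

theorem frameEndo_apply_sq (h : CompatPair σ γ J₀) (x : CoordSpace m) :
    toEuclideanLin (frameEndo J₀ E₀) (toEuclideanLin (frameEndo J₀ E₀) x) = σ • x := by
  rw [toEuclideanLin_toEuclideanLin, frameEndo_sq hE₀ h, map_smul, LinearMap.smul_apply,
    toEuclideanLin_one_apply]

theorem frameEndo_apply_compat (h : CompatPair σ γ J₀) (x y : CoordSpace m) :
    matForm (met γ E₀) (toEuclideanLin (frameEndo J₀ E₀) x)
      (toEuclideanLin (frameEndo J₀ E₀) y) = -σ * matForm (met γ E₀) x y := by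
  rw [matForm_toEuclideanLin, frameEndo_compat hE₀ h, matForm_apply, matForm_apply,
    smul_mulVec, dotProduct_smul, smul_eq_mul]

/-- Both metrics are pullbacks of the same γ, so E₁⁻¹E₀ is an isometry. This gives constant
signature. -/
theorem exists_isometry {E₁ : Matrix (Fin m) (Fin m) ℝ} (hE₁ : E₁.det ≠ 0) :
    ∃ e : CoordSpace m ≃ₗ[ℝ] CoordSpace m, ∀ x y,
      matForm (met γ E₁) (e x) (e y) = matForm (met γ E₀) x y := by
  have hp := isUnit_iff_ne_zero.mpr hE₀
  have hq := isUnit_iff_ne_zero.mpr hE₁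
  have h1 : E₁⁻¹ * E₀ * (E₀⁻¹ * E₁) = 1 := by
    rw [Matrix.mul_assoc, ← Matrix.mul_assoc E₀, mul_nonsing_inv _ hp, Matrix.one_mul,
      nonsing_inv_mul _ hq]
  have h2 : E₀⁻¹ * E₁ * (E₁⁻¹ * E₀) = 1 := by
    rw [Matrix.mul_assoc, ← Matrix.mul_assoc E₁, mul_nonsing_inv _ hq, Matrix.one_mul,
      nonsing_inv_mul _ hp]
  refine ⟨LinearEquiv.ofLinearMap (toEuclideanLin (E₁⁻¹ * E₀)) (toEuclideanLin (E₀⁻¹ * E₁))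
    (LinearMap.ext fun x => ?_) (LinearMap.ext fun x => ?_), fun x y => ?_⟩
  · change toEuclideanLin _ (toEuclideanLin _ x) = x
    rw [toEuclideanLin_toEuclideanLin, h1, toEuclideanLin_one_apply]
  · change toEuclideanLin _ (toEuclideanLin _ x) = x
    rw [toEuclideanLin_toEuclideanLin, h2, toEuclideanLin_one_apply]
  · change matForm _ (toEuclideanLin _ x) (toEuclideanLin _ y) = matForm _ x y
    rw [matForm_toEuclideanLin, ← met_mul, ← Matrix.mul_assoc, mul_nonsing_inv _ hq,
      Matrix.one_mul]

theorem riemannian_met (hγ : ∀ x, x ≠ 0 → 0 < matForm γ x x) {x : CoordSpace m} (hx : x ≠ 0) :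
    0 < matForm (met γ E₀) x x := by
  rw [met, ← matForm_toEuclideanLin]
  refine hγ _ fun h0 => hx ?_
  have := congrArg (toEuclideanLin E₀⁻¹) h0
  rwa [toEuclideanLin_toEuclideanLin, nonsing_inv_mul _ (isUnit_iff_ne_zero.mpr hE₀),
    toEuclideanLin_one_apply, map_zero] at this

end

variable {M : Type*} [TopologicalSpace M] [ChartedSpace (CoordSpace m) M]
  [IsManifold 𝓘(ℝ, CoordSpace m) ∞ M] {f : M → CoordSpace m}

theorem metricMatrix_eq {s : Set (CoordSpace m)} (hf : IsSingleChart f s)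
    (G : CoordSpace m → Matrix (Fin m) (Fin m) ℝ) (p : M) {u : CoordSpace m} (hu : u ∈ s) :
    metricMatrix (fun p : M => matForm (G (f p))) p u = G u := by
  ext a b
  simp only [metricMatrix, of_apply]
  rw [hf.coordVec_eq p hu, hf.coordVec_eq p hu]
  exact (matForm_single _ a b).trans (by rw [hf.apply_symm p hu])

theorem endoMatrix_eq {s : Set (CoordSpace m)} (hf : IsSingleChart f s)
    (K : CoordSpace m → Matrix (Fin m) (Fin m) ℝ) (p : M) {u : CoordSpace m} (hu : u ∈ s) :
    endoMatrix (fun p : M => toEuclideanLin (K (f p))) p u = K u := by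
  ext a b
  simp only [endoMatrix, of_apply]
  rw [hf.coordVec_eq p hu, hf.coordComp_eq]
  change (toEuclideanLin _ (EuclideanSpace.single b (1 : ℝ))) a = _
  rw [hf.apply_symm p hu]
  simp [toLpLin_apply]

theorem contDiffOn_metricMatrix {s : Set (CoordSpace m)} (hf : IsSingleChart f s)
    {G : CoordSpace m → Matrix (Fin m) (Fin m) ℝ} (hG : SmoothM G s) (p : M) (a b : Fin m) :
    ContDiffOn ℝ ∞ (fun u => metricMatrix (fun p : M => matForm (G (f p))) p u a b)
      (extChartAt 𝓘(ℝ, CoordSpace m) p).target := by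
  rw [hf.target]
  exact hG.congr (F := metricMatrix (fun p : M => matForm (G (f p))) p)
    (fun u hu => metricMatrix_eq hf G p hu) a b

theorem contDiffOn_endoMatrix {s : Set (CoordSpace m)} (hf : IsSingleChart f s)
    {K : CoordSpace m → Matrix (Fin m) (Fin m) ℝ} (hK : SmoothM K s) (p : M) (a b : Fin m) :
    ContDiffOn ℝ ∞ (fun u => endoMatrix (fun p : M => toEuclideanLin (K (f p))) p u a b)
      (extChartAt 𝓘(ℝ, CoordSpace m) p).target := by
  rw [hf.target]
  exact hK.congr (F := endoMatrix (fun p : M => toEuclideanLin (K (f p))) p)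
    (fun u hu => endoMatrix_eq hf K p hu) a b

/-- The almost (para-)Hermitian structure determined by a frame. -/
noncomputable def GoodFrame.toAlmostHermitian (hE : GoodFrame σ γ J₀ Q r E)
    (h : CompatPair σ γ J₀) (hf : IsSingleChart f (Metric.ball 0 r)) :
    AlmostHermitian σ m M where
  g q := matForm (met γ (E (f q)))
  g_symm _ x y := matForm_symm (isSymm_met h.symm _) x y
  g_nondeg q _ hx := eq_zero_of_matForm_eq_zero
    (det_met_ne_zero h.det_ne_zero (hE.det_ne_zero _ (hf.mem q))) hx
  g_signature p q := exists_isometry (hE.det_ne_zero _ (hf.mem p)) (hE.det_ne_zero _ (hf.mem q))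
  g_smooth p a b := contDiffOn_metricMatrix hf (G := fun v => met γ (E v)) (smoothM_met hE.smooth γ)
    p a b
  J p := toEuclideanLin (frameEndo J₀ (E (f p)))
  J_sq p x := frameEndo_apply_sq (hE.det_ne_zero _ (hf.mem p)) h x
  J_compat p x y := frameEndo_apply_compat (hE.det_ne_zero _ (hf.mem p)) h x y
  J_smooth p a b := contDiffOn_endoMatrix hf (K := fun v => frameEndo J₀ (E v))
    (((hE.smooth.inv hE.det_ne_zero).mul (SmoothM.const J₀)).mul hE.smooth) p a b

namespace GoodFrame

variable (hE : GoodFrame σ γ J₀ Q r E) (h : CompatPair σ γ J₀)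
  (hf : IsSingleChart f (Metric.ball 0 r))
include hE h hf

theorem metricMatrix_toAlmostHermitian (p q : M) :
    metricMatrix (hE.toAlmostHermitian h hf).g p =ᶠ[𝓝 (f q)] fun v => met γ (E v) := by
  filter_upwards [Metric.isOpen_ball.mem_nhds (hf.mem q)] with v hv
  exact metricMatrix_eq hf (fun v => met γ (E v)) p hv

theorem endoMatrix_toAlmostHermitian (p q : M) :
    endoMatrix (hE.toAlmostHermitian h hf).J p =ᶠ[𝓝 (f q)] fun v => frameEndo J₀ (E v) := by
  filter_upwards [Metric.isOpen_ball.mem_nhds (hf.mem q)] with v hv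
  exact endoMatrix_eq hf (fun v => frameEndo J₀ (E v)) p hv

theorem constantScalarCurvatures : (hE.toAlmostHermitian h hf).ConstantScalarCurvatures := by
  obtain ⟨c, hc⟩ := hE.scalar
  obtain ⟨d, hd⟩ := hE.starScalar
  refine ⟨⟨c, fun p => ?_⟩, ⟨d, fun p => ?_⟩⟩
  · rw [AlmostHermitian.scalarCurvature, hf.coe,
      scalarCurv_congr (hE.metricMatrix_toAlmostHermitian h hf p p)]
    exact hc _ (hf.mem p)
  · rw [AlmostHermitian.starScalarCurvature, hf.coe,
      starScalarCurv_congr (K' := fun v => frameEndo J₀ (E v))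
        (hE.metricMatrix_toAlmostHermitian h hf p p)
        (hE.endoMatrix_toAlmostHermitian h hf p p).eq_of_nhds]
    exact hd _ (hf.mem p)

theorem riemannian (hγ : ∀ x, x ≠ 0 → 0 < matForm γ x x) :
    (hE.toAlmostHermitian h hf).Riemannian := by
  exact fun p _ hx => riemannian_met (hE.det_ne_zero _ (hf.mem p)) hγ hx

/-- If each Q commutes with J₀, so does E, and the structure E⁻¹J₀E is the constant J₀. -/
theorem integrable (hQ : ∀ a b, J₀ * Q a b = Q a b * J₀) :
    (hE.toAlmostHermitian h hf).Integrable := by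
  intro p a b d
  have hK : endoMatrix (hE.toAlmostHermitian h hf).J p =ᶠ[𝓝 (f p)] fun _ => J₀ := by
    filter_upwards [hE.endoMatrix_toAlmostHermitian h hf p p,
      Metric.isOpen_ball.mem_nhds (hf.mem p)] with v hv hv'
    rw [hv, frameEndo, Matrix.mul_assoc, hE.comm hQ, ← Matrix.mul_assoc,
      nonsing_inv_mul _ (isUnit_iff_ne_zero.mpr (hE.det_ne_zero v hv')), Matrix.one_mul]
  rw [hf.coe, nijenhuis_congr hK]
  simp [nijenhuis, partialD_const]

/-- The Kähler form has matrix Eᵀ(γJ₀)E, whose first derivatives vanish where those of E do. -/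
theorem kaehlerAt {p : M} (hp : f p = 0) : (hE.toAlmostHermitian h hf).KaehlerAt p := by
  refine dKaehlerForm_eq_zero fun a b c => ?_
  rw [hf.coe, hp]
  have h0 : (0 : CoordSpace m) ∈ Metric.ball (0 : CoordSpace m) r := Metric.mem_ball_self hE.pos
  have heq : (fun v => metricMatrix (hE.toAlmostHermitian h hf).g p v *
      endoMatrix (hE.toAlmostHermitian h hf).J p v) =ᶠ[𝓝 0] fun v => met (γ * J₀) (E v) := by
    filter_upwards [hp ▸ hE.metricMatrix_toAlmostHermitian h hf p p,
      hp ▸ hE.endoMatrix_toAlmostHermitian h hf p p, Metric.isOpen_ball.mem_nhds h0]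
      with v h1 h2 h3
    rw [h1, h2, met, Matrix.mul_assoc, mul_frameEndo (hE.det_ne_zero v h3), met]
    simp only [Matrix.mul_assoc]
  rw [partialM_congr heq, partialM_met hE.smooth Metric.isOpen_ball h0, met₁,
    hE.partial_origin]
  simp

theorem curvature_eq {p : M} (hp : f p = 0) (x y z w : CoordSpace m) :
    (hE.toAlmostHermitian h hf).curvature p x y z w =
      ∑ a, ∑ b, ∑ c, ∑ d, curvLow (fun v => met γ (E v)) a b c d 0 * x a * y b * z c * w d := by
  have h1 := hp ▸ hE.metricMatrix_toAlmostHermitian h hf p p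
  have h2 : ∀ v : CoordSpace m, coordComp p p v = v := fun v => hf.coordComp_eq p p v
  have hx := h2 x
  have hy := h2 y
  have hz := h2 z
  have hw := h2 w
  unfold AlmostHermitian.curvature
  rw [hf.coe p, hp, hx, hy, hz, hw]
  simp only [curvLow_congr h1]

theorem realizes {p : M} (hp : f p = 0) {V : Type*} [AddCommGroup V] [Module ℝ V]
    {C : CurvatureModel σ V} (φ : V ≃ₗ[ℝ] CoordSpace m)
    (hip : ∀ x y, matForm γ (φ x) (φ y) = C.ip x y)
    (hJ : ∀ x, toEuclideanLin J₀ (φ x) = φ (C.J x))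
    (hA : ∀ x y z w, ∑ a, ∑ b, ∑ c, ∑ d, curvLow (fun v => met γ (E v)) a b c d 0 *
      φ x a * φ y b * φ z c * φ w d = C.A x y z w) :
    (hE.toAlmostHermitian h hf).Realizes p C := by
  refine ⟨φ, fun x y => ?_, fun x => ?_, fun x y z w => ?_⟩
  · rw [← hip]
    change matForm (met γ (E (f p))) (φ x) (φ y) = _
    rw [hp, hE.origin, met, transpose_one, Matrix.one_mul, Matrix.mul_one]
  · refine Eq.trans ?_ (hJ x)
    change toEuclideanLin (frameEndo J₀ (E (f p))) (φ x) = _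
    rw [hp, hE.origin, frameEndo, inv_one, Matrix.one_mul, Matrix.mul_one]
  · rw [← hA]
    exact hE.curvature_eq h hf hp _ _ _ _

end GoodFrame

theorem GoodFrame.exists_manifold (hE : GoodFrame σ γ J₀ Q r E) :
    ∃ (M : Type) (_ : TopologicalSpace M) (_ : T2Space M) (_ : SecondCountableTopology M)
        (_ : ChartedSpace (CoordSpace m) M) (_ : IsManifold 𝓘(ℝ, CoordSpace m) ∞ M)
        (f : M → CoordSpace m) (_ : IsSingleChart f (Metric.ball 0 r)) (P : M), f P = 0 := by
  have hopen : IsOpen (Metric.ball (0 : CoordSpace m) r) := Metric.isOpen_ball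
  have h0 : (0 : CoordSpace m) ∈ Metric.ball (0 : CoordSpace m) r := Metric.mem_ball_self hE.pos
  have : Nonempty (Metric.ball (0 : CoordSpace m) r) := ⟨⟨0, h0⟩⟩
  have e := hopen.isOpenEmbedding_subtypeVal
  refine ⟨Metric.ball (0 : CoordSpace m) r, inferInstance, inferInstance, inferInstance,
    e.singletonChartedSpace, e.isManifold_singleton, Subtype.val, ?_, ⟨0, h0⟩, rfl⟩
  let _ := e.singletonChartedSpace
  refine ⟨fun p q => ?_, fun p => ?_, fun p => ?_⟩
  · rw [extChartAt_coe, Function.comp_apply, e.singletonChartedSpace_chartAt_eq]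
    rfl
  · rw [extChartAt_source]
    exact OpenPartialHomeomorph.singletonChartedSpace_chartAt_source _ (by simp)
  · rw [extChartAt_target, ModelWithCorners.range_eq_univ, Set.inter_univ]
    change (chartAt (CoordSpace m) p).target = _
    have h1 : chartAt (CoordSpace m) p = e.toOpenPartialHomeomorph Subtype.val :=
      OpenPartialHomeomorph.singletonChartedSpace_chartAt_eq _ (by simp)
    rw [h1, Topology.IsOpenEmbedding.toOpenPartialHomeomorph_target, Subtype.range_coe]

end FrameJet

/-! ### Frames with a prescribed Hessian. -/

namespace FrameJet

open Matrix Coord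

section ZeroDim

/-- Without coordinates there is no direction `t` in which to solve, so this case stands apart. -/
theorem GoodFrame.of_dim_zero (σ : ℝ) (γ J₀ : Matrix (Fin 0) (Fin 0) ℝ)
    (Q : Fin 0 → Fin 0 → Matrix (Fin 0) (Fin 0) ℝ) : GoodFrame σ γ J₀ Q 1 fun _ => 1 where
  pos := one_pos
  smooth i := i.elim0
  det_ne_zero _ _ := by simp
  origin := rfl
  partial_origin a := a.elim0
  partial₂_origin a := a.elim0
  scalar := ⟨0, fun _ _ => by simp [scalarCurv]⟩
  starScalar := ⟨0, fun _ _ => by simp [starScalarCurv]⟩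
  comm _ _ := Subsingleton.elim _ _

end ZeroDim

variable {σ : ℝ} {m : ℕ} {γ J₀ : Matrix (Fin m) (Fin m) ℝ}

/-- In an orthogonal basis every coordinate covector is non-null, so every coordinate direction is
noncharacteristic. -/
theorem CompatPair.diag_inv_ne_zero (h : CompatPair σ γ J₀)
    (hγ : ∀ a b, a ≠ b → γ a b = 0) (t : Fin m) : γ⁻¹ t t ≠ 0 := by
  intro h0
  have h1 := congrFun (congrFun h.inv_mul t) t
  rw [Matrix.mul_apply, Finset.sum_eq_single t (fun s _ hs => by rw [hγ s t hs, mul_zero])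
    (by simp), h0, zero_mul, one_apply_eq] at h1
  exact zero_ne_one h1

theorem CompatPair.exists_goodFrame_of_diagonal (h : CompatPair σ γ J₀)
    (hγ : ∀ a b, a ≠ b → γ a b = 0) (Q : Fin m → Fin m → Matrix (Fin m) (Fin m) ℝ) :
    ∃ r E, GoodFrame σ γ J₀ Q r E := by
  rcases m with _ | m
  · exact ⟨1, _, GoodFrame.of_dim_zero σ γ J₀ Q⟩
  · exact h.exists_goodFrame 0 (h.diag_inv_ne_zero hγ 0) Q

/-- The factor 1/2 in the frame makes the second derivatives of the metric equal to 2S. The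
Christoffel products vanish at the origin, and the constant 4 of `riem` then cancels exactly. -/
theorem GoodFrame.curvLow_origin {S : Fin m → Fin m → Matrix (Fin m) (Fin m) ℝ} {r : ℝ}
    {E : CoordSpace m → Matrix (Fin m) (Fin m) ℝ} (h : CompatPair σ γ J₀)
    (hE : GoodFrame σ γ J₀ (fun a b => (1 / 2 : ℝ) • (γ⁻¹ * S a b)) r E)
    (hS : ∀ a b, (S a b)ᵀ = S a b) (hS' : ∀ a b, S a b = S b a) (i j k l : Fin m) :
    curvLow (fun v => met γ (E v)) i j k l 0 = S k i j l - S l i j k - S k j i l + S l j i k := by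
  have h0 : (0 : CoordSpace m) ∈ Metric.ball (0 : CoordSpace m) r := Metric.mem_ball_self hE.pos
  have h1 := riem_eq hE.smooth Metric.isOpen_ball h.symm h.det_ne_zero hE.det_ne_zero h0 i j k l
  have h2 : (fun a => partialM E a 0) = 0 := funext hE.partial_origin
  have h3 : ∀ a b, (γ⁻¹ * S a b)ᵀ * γ + γ * (γ⁻¹ * S a b) = (2 : ℝ) • S a b := fun a b => by
    rw [transpose_mul, h.inv_symm, Matrix.mul_assoc, h.inv_mul, ← Matrix.mul_assoc, h.mul_inv,
      hS, Matrix.mul_one, Matrix.one_mul, two_smul]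
  have h4 : ∀ a b, (partialM (partialM E a) b 0)ᵀ * γ + γ * partialM (partialM E a) b 0 =
      (2 : ℝ) • S a b := fun a b => by
    rw [hE.partial₂_origin, hS' b a, ← two_smul ℝ, smul_smul, mul_one_div_cancel two_ne_zero,
      one_smul, h3]
  rw [h2, hE.origin, riem_one] at h1
  simp only [h4, Matrix.smul_apply, smul_eq_mul, det_one, hS' i j] at h1
  linarith
end FrameJet

/-! ### From a curvature model to matrices and back. -/

namespace CurvatureModel

open Matrix FrameJet

variable {σ : ℝ} {V : Type*} [AddCommGroup V] [Module ℝ V] {m : ℕ}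

theorem compatPair (hσ : σ * σ = 1) (C : CurvatureModel σ V) (b : Module.Basis (Fin m) ℝ V) :
    CompatPair σ (LinearMap.toMatrix₂ b b C.ip) (LinearMap.toMatrix b b C.J) where
  sq_one := hσ
  symm := by
    ext i j
    simp [LinearMap.toMatrix₂_apply, C.ip_symm (b j)]
  det_ne_zero := by
    rw [← LinearMap.separatingLeft_iff_det_ne_zero]
    exact C.ip_nondeg
  sq := by
    rw [← LinearMap.toMatrix_comp, ← LinearMap.toMatrix_one b, ← map_smul]
    congr 1
    ext x
    exact C.J_sq x
  compat := by
    rw [← LinearMap.toMatrix₂_compl₁₂, ← map_smul]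
    congr 1
    ext x y
    exact C.J_compat x y

theorem basis_expansion {W : Type*} [AddCommMonoid W] [Module ℝ W] (b : Module.Basis (Fin m) ℝ V)
    (L : V →ₗ[ℝ] W) (x : V) : L x = ∑ a, b.repr x a • L (b a) := by
  conv_lhs => rw [← b.sum_repr x, map_sum]
  simp only [map_smul]

theorem sum_basis_mul (C : CurvatureModel σ V) (b : Module.Basis (Fin m) ℝ V) (x y z w : V) :
    ∑ i, ∑ j, ∑ k, ∑ l, C.A (b i) (b j) (b k) (b l) * b.repr x i * b.repr y j * b.repr z k *
      b.repr w l = C.A x y z w := by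
  have h4 : ∀ i j k, C.A (b i) (b j) (b k) w = ∑ l, b.repr w l • C.A (b i) (b j) (b k) (b l) :=
    fun i j k => basis_expansion b _ w
  have h3 : ∀ i j, C.A (b i) (b j) z = ∑ k, b.repr z k • C.A (b i) (b j) (b k) :=
    fun i j => basis_expansion b _ z
  have h2 : ∀ i, C.A (b i) y = ∑ j, b.repr y j • C.A (b i) (b j) := fun i =>
    basis_expansion b (C.A (b i)) y
  have h1 : C.A x = ∑ i, b.repr x i • C.A (b i) :=
    basis_expansion b C.A x
  rw [h1]
  simp only [LinearMap.sum_apply, LinearMap.smul_apply, h2, h3, h4, Finset.mul_sum, smul_eq_mul]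
  exact Finset.sum_congr rfl fun i _ => Finset.sum_congr rfl fun j _ =>
    Finset.sum_congr rfl fun k _ => Finset.sum_congr rfl fun l _ => by ring

/-- Realization by a metric whose second derivatives are prescribed by `S`. -/
theorem exists_realization [FiniteDimensional ℝ V] (hσ : σ * σ = 1) (C : CurvatureModel σ V)
    (S : V → V → V →ₗ[ℝ] V →ₗ[ℝ] ℝ) (hS : ∀ z w x y, S z w x y = S z w y x)
    (hS' : ∀ z w, S z w = S w z)
    (hA : ∀ x y z w, S z x y w - S w x y z - S z y x w + S w y x z = C.A x y z w) :
    ∃ (M : Type) (_ : TopologicalSpace M) (_ : T2Space M) (_ : SecondCountableTopology M)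
        (_ : ChartedSpace (CoordSpace (Module.finrank ℝ V)) M)
        (_ : IsManifold 𝓘(ℝ, CoordSpace (Module.finrank ℝ V)) ∞ M)
        (H : AlmostHermitian σ (Module.finrank ℝ V) M) (P : M),
      ((∀ z w x y, S z w (C.J x) y = -S z w x (C.J y)) → H.Integrable) ∧
      H.Realizes P C ∧ H.ConstantScalarCurvatures ∧ H.KaehlerAt P ∧
        (C.PosDef → H.Riemannian) := by
  -- Orthogonality is chosen for the Cauchy–Kovalevskaya step: it guarantees a non-null coordinate
  -- direction in every signature.
  obtain ⟨b, hb⟩ := LinearMap.BilinForm.exists_orthogonal_basis (B := C.ip)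
    ⟨fun x y => C.ip_symm x y⟩
  have h := C.compatPair hσ b
  set γ := LinearMap.toMatrix₂ b b C.ip with hγ
  set J₀ := LinearMap.toMatrix b b C.J with hJ₀
  have hdiag : ∀ i j, i ≠ j → γ i j = 0 := fun i j hij => by
    rw [hγ, LinearMap.toMatrix₂_apply]
    exact hb hij
  let T : Fin (Module.finrank ℝ V) → Fin (Module.finrank ℝ V) → Matrix _ _ ℝ :=
    fun i j => LinearMap.toMatrix₂ b b (S (b i) (b j))
  obtain ⟨r, E, hE⟩ := h.exists_goodFrame_of_diagonal hdiag
    fun i j => (1 / 2 : ℝ) • (γ⁻¹ * T i j)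
  obtain ⟨M, i₁, i₂, i₃, i₄, i₅, f, hf, P, hP⟩ := hE.exists_manifold
  let φ : V ≃ₗ[ℝ] CoordSpace (Module.finrank ℝ V) :=
    b.equivFun.trans (WithLp.linearEquiv 2 ℝ (Fin (Module.finrank ℝ V) → ℝ)).symm
  have hφ : ∀ x i, φ x i = b.repr x i := fun x i => rfl
  have hφ' : ∀ x, (φ x).ofLp = b.repr x := fun x => rfl
  have hip : ∀ x y, matForm γ (φ x) (φ y) = C.ip x y := fun x y => by
    rw [matForm_apply, hφ', hφ', hγ, apply_eq_dotProduct_toMatrix₂_mulVec b b C.ip]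
    rfl
  have hpos : C.PosDef → ∀ x, x ≠ 0 → 0 < matForm γ x x := fun hC x hx => by
    rw [← φ.apply_symm_apply x, hip]
    exact hC _ fun h0 => hx (φ.symm.map_eq_zero_iff.mp h0)
  refine ⟨M, i₁, i₂, i₃, i₄, i₅, hE.toAlmostHermitian h hf, P, fun hSJ => ?_, ?_,
    hE.constantScalarCurvatures h hf, hE.kaehlerAt h hf hP,
    fun hC => hE.riemannian h hf (hpos hC)⟩
  -- Skewness of J for the form `S` and skewness of J₀γ⁻¹ combine to show that γ⁻¹T commutes with
  -- J₀.
  · refine hE.integrable h hf fun i j => ?_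
    have h1 : J₀ᵀ * T i j = -(T i j * J₀) := by
      rw [hJ₀, ← LinearMap.toMatrix₂_comp, ← LinearMap.toMatrix₂_compl₂, ← map_neg]
      congr 1
      ext x y
      exact hSJ _ _ x y
    have h2 : γ⁻¹ * J₀ᵀ = -(J₀ * γ⁻¹) := by
      rw [← h.bivector_transpose, transpose_mul, h.inv_symm]
    rw [Matrix.mul_smul, Matrix.smul_mul, ← Matrix.mul_assoc, ← neg_neg (J₀ * γ⁻¹), ← h2,
      Matrix.neg_mul, Matrix.mul_assoc, h1, Matrix.mul_neg, neg_neg, Matrix.mul_assoc]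
  · refine hE.realizes h hf hP φ hip (fun x => ?_) fun x y z w => ?_
    · refine (WithLp.ofLp_injective 2) ?_
      rw [toLpLin_apply, hφ', hφ', hJ₀]
      exact LinearMap.toMatrix_mulVec_repr b b C.J x
    · rw [← C.sum_basis_mul b]
      refine Finset.sum_congr rfl fun i _ => Finset.sum_congr rfl fun j _ =>
        Finset.sum_congr rfl fun k _ => Finset.sum_congr rfl fun l _ => ?_
      rw [hE.curvLow_origin h]
      · simp only [T, LinearMap.toMatrix₂_apply, hφ, ← hA]
      · intro i j
        ext k l
        simp [T, LinearMap.toMatrix₂_apply, hS _ _ (b k)]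
      · intro i j
        simp only [T, hS' (b i)]

/-! ### Metric Hessians with prescribed curvature, general and Gray case. -/

section Potentials

variable (C : CurvatureModel σ V)

theorem swap_left (x y z w : V) : C.A y z x w = C.A x w y z := C.pair_symm y z x w

theorem swap_cross (x y z w : V) : C.A y w x z = C.A x z y w := C.pair_symm y w x z

theorem antisymm_right (x y z w : V) : C.A x y w z = -C.A x y z w := by
  rw [C.pair_symm, C.antisymm, C.pair_symm z]

theorem bianchi_right (x y z w : V) : C.A x w y z = C.A x z y w - C.A x y z w := by
  have h1 := C.bianchi y z x w
  have h2 := C.pair_symm y z x w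
  have h3 := C.antisymm z x y w
  linarith

/-- The second derivatives of a metric with curvature `A`. -/
noncomputable def potential (z w : V) : V →ₗ[ℝ] V →ₗ[ℝ] ℝ :=
  LinearMap.mk₂ ℝ (fun x y => (1 / 6) * (C.A x z y w + C.A x w y z))
    (fun _ _ _ => by simp only [map_add, LinearMap.add_apply]; ring)
    (fun _ _ _ => by simp only [map_smul, LinearMap.smul_apply, smul_eq_mul]; ring)
    (fun _ _ _ => by simp only [map_add, LinearMap.add_apply]; ring)
    (fun _ _ _ => by simp only [map_smul, LinearMap.smul_apply, smul_eq_mul]; ring)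

theorem potential_apply (z w x y : V) :
    C.potential z w x y = (1 / 6) * (C.A x z y w + C.A x w y z) := rfl

theorem potential_symm (z w x y : V) : C.potential z w x y = C.potential z w y x := by
  rw [potential_apply, potential_apply, C.pair_symm y z, C.pair_symm y w, add_comm]

theorem potential_comm (z w : V) : C.potential z w = C.potential w z := by
  ext x y
  rw [potential_apply, potential_apply, add_comm]

/-- Of the eight terms, four equal A(x, y, z, w) by antisymmetry, and the other four add up to twice
this value by the Bianchi identity; hence the constant 1/6. -/
theorem potential_curvature (x y z w : V) : C.potential z x y w - C.potential w x y z -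
    C.potential z y x w + C.potential w y x z = C.A x y z w := by
  simp only [potential_apply]
  have h1 := C.antisymm y x z w
  have h2 := C.antisymm_right y x z w
  have h3 := C.antisymm_right x y z w
  have h4 := C.antisymm_right y z x w
  have h5 := C.antisymm_right y w x z
  have h6 := C.antisymm_right x z y w
  have h7 := C.antisymm_right x w y z
  have h8 := C.swap_left x y z w
  have h9 := C.swap_cross x y z w
  have h10 := C.bianchi_right x y z w
  linarith

/-- Half of the second derivatives of a metric with curvature `A` and constant
(para-)complex structure. -/
noncomputable def grayHalf (x y z w : V) : ℝ :=
  (1 / 12) * (C.A x z y w - σ * C.A (C.J x) z (C.J y) w + σ * C.A x (C.J z) y (C.J w)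
      - C.A (C.J x) (C.J z) (C.J y) (C.J w))
    - (1 / 16) * (C.A x w z y - σ * C.A (C.J x) w z (C.J y) - σ * C.A x (C.J w) (C.J z) y
      + C.A (C.J x) (C.J w) (C.J z) (C.J y) + σ * (C.A (C.J x) w (C.J z) y
      - C.A x w (C.J z) (C.J y) - C.A (C.J x) (C.J w) z y + C.A x (C.J w) z (C.J y)))

/-- The second derivatives of a metric with curvature `A` and constant (para-)complex
structure, for `A` satisfying the (para-)Gray identity. -/
noncomputable def grayPotential (z w : V) : V →ₗ[ℝ] V →ₗ[ℝ] ℝ :=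
  LinearMap.mk₂ ℝ (fun x y => C.grayHalf x y z w + C.grayHalf x y w z)
    (fun _ _ _ => by simp only [grayHalf, map_add, LinearMap.add_apply]; ring)
    (fun _ _ _ => by simp only [grayHalf, map_smul, LinearMap.smul_apply, smul_eq_mul]; ring)
    (fun _ _ _ => by simp only [grayHalf, map_add, LinearMap.add_apply]; ring)
    (fun _ _ _ => by simp only [grayHalf, map_smul, LinearMap.smul_apply, smul_eq_mul]; ring)

theorem grayPotential_apply (z w x y : V) :
    C.grayPotential z w x y = C.grayHalf x y z w + C.grayHalf x y w z := rfl

/-- Up to σ² = 1, each summand of `grayHalf` is accompanied by -σ times itself with x, y replaced by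
Jx, Jy. The sum therefore has the form B(x, y) - σB(Jx, Jy), for which J is skew. -/
theorem grayHalf_J_left (hσ : σ * σ = 1) (x y z w : V) :
    C.grayHalf (C.J x) y z w = -C.grayHalf x (C.J y) z w := by
  simp only [grayHalf, C.J_sq, map_smul, LinearMap.smul_apply, smul_eq_mul]
  linear_combination (-(1 / 12 : ℝ) * (C.A x z (C.J y) w + C.A (C.J x) z y w)
    + (1 / 16) * (C.A x w z (C.J y) + C.A (C.J x) w z y)) * hσ

theorem flip (x y z w : V) : C.A y w z x = C.A x z w y := by
  rw [C.pair_symm, C.antisymm, C.antisymm_right, neg_neg]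

theorem grayPotential_symm (z w x y : V) : C.grayPotential z w x y = C.grayPotential z w y x := by
  -- Rewriting rules moving the argument built from x to the first slot, for every placement of J on
  -- x and y.
  have head : ∀ p ∈ [x, C.J x], ∀ q ∈ [y, C.J y], ∀ z w, C.A q z p w = C.A p w q z ∧
      C.A q z w p = C.A p w z q := fun p _ q _ z w => ⟨C.swap_left p q z w, C.flip p q w z⟩
  simp only [List.forall_mem_cons, List.not_mem_nil, false_imp_iff, implies_true, and_true,
    forall_and] at head
  simp only [grayPotential_apply, grayHalf, head]
  ring

theorem grayPotential_comm (z w : V) : C.grayPotential z w = C.grayPotential w z := by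
  ext x y
  rw [grayPotential_apply, grayPotential_apply, add_comm]

theorem grayPotential_J (hσ : σ * σ = 1) (z w x y : V) :
    C.grayPotential z w (C.J x) y = -C.grayPotential z w x (C.J y) := by
  rw [grayPotential_apply, grayPotential_apply, C.grayHalf_J_left hσ, C.grayHalf_J_left hσ]
  ring

/-- The curvature symmetries reduce everything to components with arguments in the orders x, y, z, w
and x, z, y, w, each with J inserted in some slots. The second kind cancels, and the difference of
the two sides is -1/8 of the Gray expression. -/
theorem grayPotential_curvature (hC : C.Gray) (x y z w : V) :
    C.grayPotential z x y w - C.grayPotential w x y z -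
      C.grayPotential z y x w + C.grayPotential w y x z = C.A x y z w := by
  have hG := hC x y z w
  have head : ∀ p ∈ [x, C.J x], ∀ q ∈ [y, C.J y], ∀ z w, C.A q z p w = C.A p w q z ∧
      C.A q p z w = -C.A p q z w ∧ C.A q z w p = -C.A p w q z := fun p _ q _ z w =>
    ⟨C.swap_left p q z w, C.antisymm q p z w, by rw [C.antisymm_right, C.swap_left]⟩
  -- With the x-argument in front, the Bianchi identity leaves two independent orders of the
  -- remaining three; these rules express the other orders through them.
  have tail : ∀ p ∈ [x, C.J x], ∀ q ∈ [y, C.J y], ∀ r ∈ [z, C.J z], ∀ s ∈ [w, C.J w],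
      C.A p q s r = -C.A p q r s ∧ C.A p s q r = C.A p r q s - C.A p q r s ∧
      C.A p s r q = C.A p q r s - C.A p r q s ∧ C.A p r s q = -C.A p r q s :=
    fun p _ q _ r _ s _ => ⟨C.antisymm_right p q r s, C.bianchi_right p q r s, by
      rw [C.antisymm_right, C.bianchi_right]; ring, C.antisymm_right p r q s⟩
  simp only [List.forall_mem_cons, List.not_mem_nil, false_imp_iff, implies_true, and_true,
    forall_and] at head tail
  simp only [grayPotential_apply, grayHalf, head]
  simp only [tail]
  linear_combination -(1 / 8 : ℝ) * hG

end Potentials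

end CurvatureModel

/-! ### Families of matrices indexed by the coordinate directions -/

namespace MatFamily

open Matrix

variable {m : ℕ}

/-- The family `a ↦ F (X ∂_a)`. -/
def contr (X : Matrix (Fin m) (Fin m) ℝ) (F : Fin m → Matrix (Fin m) (Fin m) ℝ) (a : Fin m) :
    Matrix (Fin m) (Fin m) ℝ := ∑ p, X p a • F p

/-- `F(x) y = F(y) x`. -/
def IsSym (F : Fin m → Matrix (Fin m) (Fin m) ℝ) : Prop := ∀ a b d, F a d b = F b d a

variable {X Y K K' : Matrix (Fin m) (Fin m) ℝ} {F F' : Fin m → Matrix (Fin m) (Fin m) ℝ}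

theorem contr_apply (X : Matrix (Fin m) (Fin m) ℝ) (F : Fin m → Matrix (Fin m) (Fin m) ℝ)
    (a i j : Fin m) : contr X F a i j = ∑ p, X p a * F p i j := by
  simp [contr, Matrix.sum_apply]

theorem contr_add (X : Matrix (Fin m) (Fin m) ℝ) (F F' : Fin m → Matrix (Fin m) (Fin m) ℝ)
    (a : Fin m) : contr X (fun a => F a + F' a) a = contr X F a + contr X F' a := by
  simp [contr, Finset.sum_add_distrib]

theorem contr_sub (X : Matrix (Fin m) (Fin m) ℝ) (F F' : Fin m → Matrix (Fin m) (Fin m) ℝ)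
    (a : Fin m) : contr X (fun a => F a - F' a) a = contr X F a - contr X F' a := by
  simp [contr, smul_sub, Finset.sum_sub_distrib]

theorem contr_mul_left (X Y : Matrix (Fin m) (Fin m) ℝ) (F : Fin m → Matrix (Fin m) (Fin m) ℝ)
    (a : Fin m) : contr X (fun a => Y * F a) a = Y * contr X F a := by
  simp [contr, Matrix.mul_sum]

theorem contr_mul_right (X Y : Matrix (Fin m) (Fin m) ℝ) (F : Fin m → Matrix (Fin m) (Fin m) ℝ)
    (a : Fin m) : contr X (fun a => F a * Y) a = contr X F a * Y := by
  simp [contr, Matrix.sum_mul]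

theorem contr_contr (X Y : Matrix (Fin m) (Fin m) ℝ) (F : Fin m → Matrix (Fin m) (Fin m) ℝ)
    (a : Fin m) : contr X (contr Y F) a = contr (Y * X) F a := by
  simp only [contr, Finset.smul_sum, smul_smul, Matrix.mul_apply, Finset.sum_smul]
  rw [Finset.sum_comm]
  exact Finset.sum_congr rfl fun p _ => Finset.sum_congr rfl fun q _ => by rw [mul_comm]

theorem add_contr (X Y : Matrix (Fin m) (Fin m) ℝ) (F : Fin m → Matrix (Fin m) (Fin m) ℝ)
    (a : Fin m) : contr (X + Y) F a = contr X F a + contr Y F a := by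
  simp [contr, add_smul, Finset.sum_add_distrib]

theorem sub_contr (X Y : Matrix (Fin m) (Fin m) ℝ) (F : Fin m → Matrix (Fin m) (Fin m) ℝ)
    (a : Fin m) : contr (X - Y) F a = contr X F a - contr Y F a := by
  simp [contr, sub_smul, Finset.sum_sub_distrib]

theorem contr_sum_smul (X : Matrix (Fin m) (Fin m) ℝ) (c : Fin m → ℝ)
    (W : Fin m → Fin m → Matrix (Fin m) (Fin m) ℝ) (a : Fin m) :
    contr X (fun a => ∑ p, c p • W p a) a = ∑ p, c p • contr X (W p) a := by
  simp only [contr, Finset.smul_sum]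
  rw [Finset.sum_comm]
  exact Finset.sum_congr rfl fun p _ => Finset.sum_congr rfl fun q _ => smul_comm ..

namespace IsSym

theorem add (hF : IsSym F) (hF' : IsSym F') : IsSym fun a => F a + F' a := fun a b d =>
  congrArg₂ (· + ·) (hF a b d) (hF' a b d)

theorem sub (hF : IsSym F) (hF' : IsSym F') : IsSym fun a => F a - F' a := fun a b d =>
  congrArg₂ (· - ·) (hF a b d) (hF' a b d)

theorem mul_left (hF : IsSym F) (Y : Matrix (Fin m) (Fin m) ℝ) : IsSym fun a => Y * F a :=
  fun a b d => by
    simp only [Matrix.mul_apply]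
    exact Finset.sum_congr rfl fun e _ => by rw [hF]

theorem contr_mul (hF : IsSym F) (X : Matrix (Fin m) (Fin m) ℝ) :
    IsSym fun a => contr X F a * X := fun a b d => by
  simp only [Matrix.mul_apply, contr_apply, Finset.sum_mul]
  rw [Finset.sum_comm]
  exact Finset.sum_congr rfl fun e _ => Finset.sum_congr rfl fun f _ => by
    rw [hF]; ring

theorem contr_add_mul (hF : IsSym F) (X : Matrix (Fin m) (Fin m) ℝ) :
    IsSym fun a => contr X F a + F a * X := fun a b d => by
  simp only [Matrix.add_apply, Matrix.mul_apply, contr_apply]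
  rw [add_comm]
  congr 1
  · exact Finset.sum_congr rfl fun e _ => by rw [hF, mul_comm]
  · exact Finset.sum_congr rfl fun e _ => by rw [hF, mul_comm]

end IsSym

/-- The family whose antisymmetrization is the Nijenhuis tensor. -/
def nij (K K' : Matrix (Fin m) (Fin m) ℝ) (F : Fin m → Matrix (Fin m) (Fin m) ℝ) (a : Fin m) :
    Matrix (Fin m) (Fin m) ℝ := contr K F a - K' * F a

theorem nij_add (K K' : Matrix (Fin m) (Fin m) ℝ) (F F' : Fin m → Matrix (Fin m) (Fin m) ℝ)
    (a : Fin m) : nij K K' (fun a => F a + F' a) a = nij K K' F a + nij K K' F' a := by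
  rw [nij, nij, nij, contr_add, Matrix.mul_add]
  abel

/-- Adding a commutator with a symmetric family does not change the antisymmetrization that defines
the Nijenhuis tensor. Applied to Christoffel symbols, this replaces ∂ by any torsion-free ∇. With
two different structures it absorbs the second derivatives of a coordinate change. -/
theorem isSym_nij_commutator (hF : IsSym F) :
    IsSym (nij K K' fun a => F a * K - K' * F a) := by
  have h1 := (hF.contr_mul K).sub ((hF.contr_add_mul K).mul_left K')
  have h2 := h1.add (hF.mul_left (K' * K'))
  convert h2 using 2 with a
  rw [nij, contr_sub, contr_mul_left, contr_mul_right]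
  noncomm_ring

/-- A trilinear form symmetric in one pair of slots and skew in an overlapping pair is zero, as in
the uniqueness of the Levi-Civita connection. -/
theorem eq_zero_of_isSym_of_skew {G : Matrix (Fin m) (Fin m) ℝ} (hG : G.det ≠ 0) (hF : IsSym F)
    (hskew : ∀ a, (G * F a)ᵀ = -(G * F a)) (a : Fin m) : F a = 0 := by
  have h1 : IsSym fun a => G * F a := hF.mul_left G
  have h2 : ∀ a b c, (G * F a) b c = -(G * F a) c b := fun a b c => by
    have := congrFun (congrFun (hskew a) c) b
    simpa using this
  have h3 : G * F a = 0 := by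
    ext b c
    have e1 := h2 a b c
    have e2 := h1 a b c
    have e3 := h2 b c a
    have e4 := h1 b c a
    have e5 := h2 c a b
    have e6 := h1 c a b
    simp only at e2 e4 e6
    simp only [Matrix.zero_apply]
    linarith
  have h4 := congrArg (fun M => G⁻¹ * M) h3
  simpa [← Matrix.mul_assoc, nonsing_inv_mul _ (isUnit_iff_ne_zero.mpr hG)] using h4

end MatFamily

/-! ### The Levi-Civita connection in matrix form. -/

namespace Coord

open Matrix MatFamily

open scoped Topology

variable {m : ℕ} {G K : CoordSpace m → Matrix (Fin m) (Fin m) ℝ} {s : Set (CoordSpace m)}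

theorem nijenhuis_eq_zero_iff {u : CoordSpace m} :
    (∀ a b d, nijenhuis K a b d u = 0) ↔ IsSym (nij (K u) (K u) fun a => partialM K a u) := by
  have h : ∀ a b d, nijenhuis K a b d u = nij (K u) (K u) (fun a => partialM K a u) a d b -
      nij (K u) (K u) (fun a => partialM K a u) b d a := fun a b d => by
    simp only [nij, Matrix.sub_apply, contr_apply, Matrix.mul_apply, nijenhuis, partialM,
      Matrix.of_apply, mul_add, mul_neg, Finset.sum_add_distrib, Finset.sum_sub_distrib,
      Finset.sum_neg_distrib]
    ring
  simp only [h, sub_eq_zero]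
  exact Iff.rfl

/-- The Christoffel symbols as a family of matrices, `∇_a ∂_b = ∑ d, (chrM G a) d b • ∂_d`. -/
noncomputable def chrM (G : CoordSpace m → Matrix (Fin m) (Fin m) ℝ) (a : Fin m)
    (v : CoordSpace m) : Matrix (Fin m) (Fin m) ℝ := of fun d b => christoffel G a b d v

/-- The covariant derivative of an endomorphism field. -/
noncomputable def covD (G K : CoordSpace m → Matrix (Fin m) (Fin m) ℝ) (a : Fin m)
    (v : CoordSpace m) : Matrix (Fin m) (Fin m) ℝ :=
  partialM K a v + (chrM G a v * K v - K v * chrM G a v)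

/-- The curvature operators `R(∂_a, ∂_b)`. -/
noncomputable def curvM (G : CoordSpace m → Matrix (Fin m) (Fin m) ℝ) (a b : Fin m)
    (v : CoordSpace m) : Matrix (Fin m) (Fin m) ℝ :=
  partialM (chrM G b) a v - partialM (chrM G a) b v
    + (chrM G a v * chrM G b v - chrM G b v * chrM G a v)

theorem curvM_apply (a b c d : Fin m) (v : CoordSpace m) :
    curvM G a b v d c = curvUp G a b c d v := by
  simp [curvM, curvUp, chrM, partialM, Matrix.mul_apply, Finset.sum_sub_distrib]

theorem mul_curvM_apply (a b c d : Fin m) (v : CoordSpace m) :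
    (G v * curvM G a b v) d c = curvLow G a b c d v := by
  simp only [Matrix.mul_apply, curvM_apply, curvLow]

theorem SmoothM.sub {E F : CoordSpace m → Matrix (Fin m) (Fin m) ℝ} (hE : SmoothM E s)
    (hF : SmoothM F s) : SmoothM (fun v => E v - F v) s :=
  fun i j => (hE i j).sub (hF i j)

theorem partialM_sub {E F : CoordSpace m → Matrix (Fin m) (Fin m) ℝ} (hE : SmoothM E s)
    (hF : SmoothM F s) (hs : IsOpen s) {z : CoordSpace m} (hz : z ∈ s) (a : Fin m) :
    partialM (fun v => E v - F v) a z = partialM E a z - partialM F a z := by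
  ext i j
  exact partialD_sub (hE.differentiableAt hs hz i j) (hF.differentiableAt hs hz i j) a

theorem partialM_comm (hs : IsOpen s) (hK : SmoothM K s) {z : CoordSpace m} (hz : z ∈ s)
    (a b : Fin m) : partialM (partialM K a) b z = partialM (partialM K b) a z := by
  ext i j
  exact partialD_comm hs (hK i j) hz a b

section

variable (hs : IsOpen s) (hG : SmoothM G s) (hK : SmoothM K s)
  (hsym : ∀ v ∈ s, (G v).IsSymm) (hdet : ∀ v ∈ s, (G v).det ≠ 0)
include hs hsym

theorem isSym_chrM {z : CoordSpace m} (hz : z ∈ s) : IsSym fun a => chrM G a z := by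
  have h : ∀ a b c, christoffelLow G a b c z = christoffelLow G b a c z := fun a b c => by
    have : partialD (fun v => G v a b) c z = partialD (fun v => G v b a) c z :=
      partialD_congr (by
        filter_upwards [hs.mem_nhds hz] with v hv
        exact (hsym v hv).apply _ _) c
    simp only [christoffelLow]
    rw [this]
    ring
  intro a b d
  simp only [chrM, of_apply, christoffel]
  exact Finset.sum_congr rfl fun c _ => by rw [h]

include hdet in
theorem partialM_metric {z : CoordSpace m} (hz : z ∈ s) (a : Fin m) :
    partialM G a z = G z * chrM G a z + (chrM G a z)ᵀ * G z := by
  ext d b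
  have h1 : (G z * chrM G a z) d b = christoffelLow G a b d z := by
    rw [Matrix.mul_apply]
    exact sum_mul_christoffel hsym hdet hz a b d
  have h2 : ((chrM G a z)ᵀ * G z) d b = christoffelLow G a d b z := by
    rw [← (hsym z hz).eq, ← transpose_mul, transpose_apply, Matrix.mul_apply]
    exact sum_mul_christoffel hsym hdet hz a d b
  rw [Matrix.add_apply, h1, h2, add_comm]
  exact partialD_metric hsym hs hz a d b

omit hsym in
include hG hdet in
theorem smoothM_chrM (a : Fin m) : SmoothM (chrM G a) s :=
  fun d b => contDiffOn_christoffel hG hs hdet a b d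

omit hsym in
include hG hdet hK in
theorem smoothM_covD (a : Fin m) : SmoothM (covD G K a) s :=
  (hK.partialM hs a).add (((smoothM_chrM hs hG hdet a).mul hK).sub
    (hK.mul (smoothM_chrM hs hG hdet a)))

omit hsym in
theorem covD_mul {E F : CoordSpace m → Matrix (Fin m) (Fin m) ℝ} (hE : SmoothM E s)
    (hF : SmoothM F s) {z : CoordSpace m} (hz : z ∈ s) (a : Fin m) :
    covD G (fun v => E v * F v) a z = covD G E a z * F z + E z * covD G F a z := by
  simp only [covD]
  rw [partialM_mul hE hF hs hz]
  noncomm_ring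

end

end Coord

/-! ### Covariant derivatives of an integrable structure and the Gray identity. -/

namespace Coord

open Matrix MatFamily

open scoped Topology

variable {m : ℕ} {σ : ℝ} {G K : CoordSpace m → Matrix (Fin m) (Fin m) ℝ} {s : Set (CoordSpace m)}

theorem covD_congr {E F : CoordSpace m → Matrix (Fin m) (Fin m) ℝ} {z : CoordSpace m}
    (h : E =ᶠ[𝓝 z] F) (a : Fin m) : covD G E a z = covD G F a z := by
  rw [covD, covD, partialM_congr h, h.eq_of_nhds]

theorem partialM_contr {X : CoordSpace m → Matrix (Fin m) (Fin m) ℝ}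
    {F : Fin m → CoordSpace m → Matrix (Fin m) (Fin m) ℝ} (hX : SmoothM X s)
    (hF : ∀ p, SmoothM (F p) s) (hs : IsOpen s) {z : CoordSpace m} (hz : z ∈ s) (a c : Fin m) :
    partialM (fun v => contr (X v) (fun p => F p v) a) c z =
      contr (partialM X c z) (fun p => F p z) a
        + contr (X z) (fun p => partialM (F p) c z) a := by
  ext i j
  simp only [Matrix.add_apply, contr_apply, partialM, of_apply]
  rw [partialD_sum _ fun p _ => (hX.differentiableAt hs hz p a).fun_mul
    ((hF p).differentiableAt hs hz i j), ← Finset.sum_add_distrib]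
  exact Finset.sum_congr rfl fun p _ =>
    partialD_mul (hX.differentiableAt hs hz p a) ((hF p).differentiableAt hs hz i j) c

/-- `covD` treats the index of a family as a label, so `X` is differentiated as a matrix of
functions; the Christoffel correction for that index is supplied in `hess`. -/
theorem covD_contr {X : CoordSpace m → Matrix (Fin m) (Fin m) ℝ}
    {F : Fin m → CoordSpace m → Matrix (Fin m) (Fin m) ℝ} (hX : SmoothM X s)
    (hF : ∀ p, SmoothM (F p) s) (hs : IsOpen s) {z : CoordSpace m} (hz : z ∈ s) (a c : Fin m) :
    covD G (fun v => contr (X v) (fun p => F p v) a) c z =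
      contr (partialM X c z) (fun p => F p z) a + contr (X z) (fun p => covD G (F p) c z) a := by
  simp only [covD]
  rw [partialM_contr hX hF hs hz, contr_add, contr_sub, contr_mul_left, contr_mul_right, add_assoc]

/-- A (para-)Hermitian structure on an open set of the model space. -/
structure HermitianOn (σ : ℝ) (G K : CoordSpace m → Matrix (Fin m) (Fin m) ℝ)
    (s : Set (CoordSpace m)) : Prop where
  isOpen : IsOpen s
  smooth_metric : SmoothM G s
  smooth_endo : SmoothM K s
  symm : ∀ v ∈ s, (G v).IsSymm
  det_ne_zero : ∀ v ∈ s, (G v).det ≠ 0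
  sq : ∀ v ∈ s, K v * K v = σ • 1
  skew : ∀ v ∈ s, (K v)ᵀ * G v = -(G v * K v)
  nij_symm : ∀ v ∈ s, IsSym (nij (K v) (K v) fun a => partialM K a v)

namespace HermitianOn

variable (h : HermitianOn σ G K s) {z : CoordSpace m} (hz : z ∈ s)
include h hz

theorem isSym_nij_covD : IsSym (nij (K z) (K z) fun a => covD G K a z) := by
  have h1 := (h.nij_symm z hz).add
    (isSym_nij_commutator (K := K z) (K' := K z) (isSym_chrM h.isOpen h.symm hz))
  convert h1 using 2 with a
  exact nij_add _ _ _ _ _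

theorem covD_anticomm (a : Fin m) : K z * covD G K a z = -(covD G K a z * K z) := by
  have h1 : (fun v => K v * K v) =ᶠ[𝓝 z] fun _ => σ • (1 : Matrix (Fin m) (Fin m) ℝ) := by
    filter_upwards [h.isOpen.mem_nhds hz] with v hv using h.sq v hv
  have h2 : covD G (fun v => K v * K v) a z = 0 := by
    rw [covD_congr h1, covD, partialM_const]
    simp
  rw [covD_mul h.isOpen h.smooth_endo h.smooth_endo hz] at h2
  exact (neg_eq_of_add_eq_zero_right h2).symm

/-- The matrix GK is skew and the metric is parallel, so skewness passes to the covariant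
derivative. -/
theorem covD_skew (a : Fin m) : (covD G K a z)ᵀ * G z = -(G z * covD G K a z) := by
  have h1 : partialM (fun v => G v * K v) a z =
      (G z * chrM G a z + (chrM G a z)ᵀ * G z) * K z + G z * partialM K a z := by
    rw [partialM_mul h.smooth_metric h.smooth_endo h.isOpen hz,
      partialM_metric h.isOpen h.symm h.det_ne_zero hz]
  have h2 : (partialM (fun v => G v * K v) a z)ᵀ = -partialM (fun v => G v * K v) a z := by
    rw [← partialM_transpose]
    have h3 : (fun v => (G v * K v)ᵀ) =ᶠ[𝓝 z] fun v => 0 - G v * K v := by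
      filter_upwards [h.isOpen.mem_nhds hz] with v hv
      rw [transpose_mul, (h.symm v hv).eq, h.skew v hv, zero_sub]
    rw [partialM_congr h3, partialM_sub (SmoothM.const 0)
      (h.smooth_metric.mul h.smooth_endo) h.isOpen hz, partialM_const, zero_sub]
  have h4 : G z * covD G K a z = partialM (fun v => G v * K v) a z
      - (chrM G a z)ᵀ * (G z * K z) - G z * K z * chrM G a z := by
    rw [h1, covD]
    noncomm_ring
  have h5 : (G z * K z)ᵀ = -(G z * K z) := by
    rw [transpose_mul, (h.symm z hz).eq, h.skew z hz]
  have h6 : (covD G K a z)ᵀ * G z = (G z * covD G K a z)ᵀ := by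
    rw [transpose_mul, (h.symm z hz).eq]
  rw [h6, h4, transpose_sub, transpose_sub, h2, transpose_mul, transpose_mul _ (chrM G a z), h5,
    transpose_transpose]
  noncomm_ring

/-- The difference of the two sides is symmetric in its two vector arguments by integrability, since
the connection has no torsion. It is also skew for the metric, as ∇K is skew and anticommutes with
K. Such a family vanishes. -/
theorem contr_covD (a : Fin m) :
    contr (K z) (fun a => covD G K a z) a = K z * covD G K a z := by
  refine sub_eq_zero.mp (eq_zero_of_isSym_of_skew (h.det_ne_zero z hz) (h.isSym_nij_covD hz)
    (fun a => ?_) a)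
  have h1 : (G z * contr (K z) (fun a => covD G K a z) a)ᵀ =
      -(G z * contr (K z) (fun a => covD G K a z) a) := by
    rw [transpose_mul, (h.symm z hz).eq, contr, transpose_sum, Finset.sum_mul, Matrix.mul_sum,
      ← Finset.sum_neg_distrib]
    refine Finset.sum_congr rfl fun p _ => ?_
    rw [transpose_smul, Matrix.smul_mul, h.covD_skew hz, Matrix.mul_smul, smul_neg]
  have h2 : (G z * (K z * covD G K a z))ᵀ = -(G z * (K z * covD G K a z)) := by
    rw [transpose_mul, transpose_mul, (h.symm z hz).eq, Matrix.mul_assoc, h.skew z hz,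
      Matrix.mul_neg, ← Matrix.mul_assoc, h.covD_skew hz, h.covD_anticomm hz]
    noncomm_ring
  rw [nij, Matrix.mul_sub, transpose_sub, h1, h2]
  abel

end HermitianOn

/-- The second covariant derivative `∇²_{c,a} K`. -/
noncomputable def hess (G K : CoordSpace m → Matrix (Fin m) (Fin m) ℝ) (c a : Fin m)
    (v : CoordSpace m) : Matrix (Fin m) (Fin m) ℝ :=
  covD G (covD G K a) c v - contr (chrM G c v) (fun a => covD G K a v) a

namespace HermitianOn

variable (h : HermitianOn σ G K s) {z : CoordSpace m} (hz : z ∈ s)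
include h hz

/-- The Ricci identity: the correction terms of `hess` cancel because the Christoffel symbols are
symmetric. -/
theorem hess_sub_hess (c a : Fin m) :
    hess G K c a z - hess G K a c z = curvM G c a z * K z - K z * curvM G c a z := by
  have hΓ := smoothM_chrM h.isOpen h.smooth_metric h.det_ne_zero
  have hK := h.smooth_endo
  have h1 : contr (chrM G c z) (fun a => covD G K a z) a =
      contr (chrM G a z) (fun a => covD G K a z) c :=
    Finset.sum_congr rfl fun p _ => by
      rw [show chrM G c z p a = chrM G a z p c from isSym_chrM h.isOpen h.symm hz c a p]
  have h2 : ∀ c a, covD G (covD G K a) c z = partialM (partialM K a) c z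
      + (partialM (chrM G a) c z * K z + chrM G a z * partialM K c z
      - (partialM K c z * chrM G a z + K z * partialM (chrM G a) c z))
      + (chrM G c z * covD G K a z - covD G K a z * chrM G c z) := by
    intro c a
    rw [covD]
    congr 1
    change partialM (fun v => partialM K a v + (chrM G a v * K v - K v * chrM G a v)) c z = _
    rw [partialM_add (hK.partialM h.isOpen a) (((hΓ a).mul hK).sub (hK.mul (hΓ a))) h.isOpen hz,
      partialM_sub ((hΓ a).mul hK) (hK.mul (hΓ a)) h.isOpen hz, partialM_mul (hΓ a) hK h.isOpen hz,
      partialM_mul hK (hΓ a) h.isOpen hz]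
  rw [hess, hess, h1, h2, h2, partialM_comm h.isOpen hK hz c a]
  simp only [covD, curvM]
  noncomm_ring

/-- This is the covariant derivative of `contr_covD`; the first-order terms record that K itself is
not parallel. -/
theorem contr_hess (c a : Fin m) :
    contr (covD G K c z) (fun a => covD G K a z) a + contr (K z) (fun a => hess G K c a z) a =
      covD G K c z * covD G K a z + K z * hess G K c a z := by
  have hL := smoothM_covD h.isOpen h.smooth_metric h.smooth_endo h.det_ne_zero
  have h1 : (fun v => contr (K v) (fun p => covD G K p v) a) =ᶠ[𝓝 z]
      fun v => K v * covD G K a v := by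
    filter_upwards [h.isOpen.mem_nhds hz] with v hv using h.contr_covD hv a
  have h2 := covD_congr (G := G) h1 c
  rw [covD_contr h.smooth_endo hL h.isOpen hz, covD_mul h.isOpen h.smooth_endo (hL a) hz] at h2
  have h3 : ∀ X, contr (X * K z) (fun a => covD G K a z) a =
      contr (K z) (contr X fun a => covD G K a z) a := fun X => (contr_contr ..).symm
  have h4 : contr (K z * chrM G c z) (fun a => covD G K a z) a =
      K z * contr (chrM G c z) (fun a => covD G K a z) a := by
    rw [← contr_contr, ← contr_mul_left]
    congr 1
    funext p
    exact h.contr_covD hz p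
  have h5 : contr (covD G K c z) (fun a => covD G K a z) a =
      contr (partialM K c z) (fun a => covD G K a z) a
        + (contr (chrM G c z * K z) (fun a => covD G K a z) a
        - contr (K z * chrM G c z) (fun a => covD G K a z) a) := by
    rw [← sub_contr, ← add_contr]
    rfl
  have h6 : contr (K z) (fun a => hess G K c a z) a =
      contr (K z) (fun a => covD G (covD G K a) c z) a
        - contr (K z) (contr (chrM G c z) fun a => covD G K a z) a := by
    rw [← contr_sub]
    rfl
  rw [h5, h6, h3, h4, hess, Matrix.mul_sub]
  rw [eq_sub_of_add_eq h2]
  abel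

/-- The Gray identity for the curvature operators, in terms of second derivatives. -/
theorem hess_identity (b a : Fin m) :
    contr (K z) (fun c => contr (K z) (fun p => hess G K c p z) a) b + σ • hess G K b a z =
      K z * (contr (K z) (fun c => hess G K c a z) b + contr (K z) (fun p => hess G K b p z) a) := by
  -- The differentiated relation is taken once multiplied by K and once in the direction Kb. By
  -- `contr_covD` the quadratic first-order terms coincide, so the comparison leaves only second
  -- derivatives.
  have h1 := congrArg (fun M => K z * M) (h.contr_hess hz b a)
  have h2 : contr (K z) (fun c => contr (covD G K c z) (fun a => covD G K a z) a) b =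
      K z * contr (covD G K b z) (fun a => covD G K a z) a := by
    have e : contr (K z) (fun c => contr (covD G K c z) (fun a => covD G K a z) a) b =
        contr (contr (K z) (fun c => covD G K c z) b) (fun a => covD G K a z) a := by
      simp only [contr, Matrix.sum_apply, Matrix.smul_apply, Finset.smul_sum, Finset.sum_smul,
        smul_eq_mul, mul_smul]
      exact Finset.sum_comm
    rw [e, h.contr_covD hz, ← contr_contr, ← contr_mul_left]
    congr 1
    funext p
    exact h.contr_covD hz p
  have h3 : contr (K z) (fun c => contr (covD G K c z) (fun a => covD G K a z) a
      + contr (K z) (fun p => hess G K c p z) a) b =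
      contr (K z) (fun c => covD G K c z * covD G K a z + K z * hess G K c a z) b := by
    congr 1
    funext c
    exact h.contr_hess hz c a
  rw [contr_add, contr_add, contr_mul_left, contr_mul_right, h2, h.contr_covD hz] at h3
  simp only [Matrix.mul_add, ← Matrix.mul_assoc, h.sq z hz, Matrix.smul_mul, Matrix.one_mul] at h1
  rw [Matrix.mul_add]
  have h4 := eq_sub_of_add_eq' h3
  rw [h4, eq_sub_of_add_eq' h1]
  abel

/-- Antisymmetrizing `hess_identity` in its two directions turns second derivatives into curvature
commutators. -/
theorem curvM_identity (b a : Fin m) {R : Fin m → Fin m → Matrix (Fin m) (Fin m) ℝ}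
    (hR : ∀ c a, R c a = curvM G c a z * K z - K z * curvM G c a z) :
    contr (K z) (fun c => contr (K z) (fun p => R c p) a) b + σ • R b a =
      K z * (contr (K z) (fun c => R c a) b + contr (K z) (fun p => R b p) a) := by
  have h1 := h.hess_identity hz b a
  have h2 := h.hess_identity hz a b
  have h3 : ∀ c a, R c a = hess G K c a z - hess G K a c z := fun c a => by
    rw [hR, h.hess_sub_hess hz]
  have h4 : contr (K z) (fun c => contr (K z) (fun p => hess G K p c z) a) b =
      contr (K z) (fun c => contr (K z) (fun p => hess G K c p z) b) a := by
    simp only [contr, Finset.smul_sum]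
    rw [Finset.sum_comm]
    exact Finset.sum_congr rfl fun _ _ => Finset.sum_congr rfl fun _ _ => smul_comm ..
  simp only [h3, contr_sub, h4, Matrix.mul_add, Matrix.mul_sub, smul_sub] at h1 h2 ⊢
  have e1 := eq_sub_of_add_eq h1
  have e2 := eq_sub_of_add_eq h2
  rw [e1, e2]
  abel

end HermitianOn

/-! ### Multilinear extension from coordinate directions to arbitrary vectors. -/

section Extend

/-- The linear extension of a family of matrices. -/
noncomputable def extend₁ (F : Fin m → Matrix (Fin m) (Fin m) ℝ) (x : Fin m → ℝ) :
    Matrix (Fin m) (Fin m) ℝ := ∑ a, x a • F a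

/-- The bilinear extension of a doubly indexed family of matrices. -/
noncomputable def extend (R : Fin m → Fin m → Matrix (Fin m) (Fin m) ℝ) (x y : Fin m → ℝ) :
    Matrix (Fin m) (Fin m) ℝ := extend₁ (fun a => extend₁ (R a) y) x

variable (R R' : Fin m → Fin m → Matrix (Fin m) (Fin m) ℝ) (X : Matrix (Fin m) (Fin m) ℝ)
  (x y : Fin m → ℝ)

theorem extend₁_mulVec (F : Fin m → Matrix (Fin m) (Fin m) ℝ) :
    extend₁ F (X *ᵥ x) = extend₁ (contr X F) x := by
  simp only [extend₁, contr, mulVec, dotProduct, Finset.sum_smul, Finset.smul_sum, smul_smul]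
  rw [Finset.sum_comm]
  simp only [mul_comm]

theorem extend_mulVec_right :
    extend R x (X *ᵥ y) = extend (fun b a => contr X (R b) a) x y := by
  simp only [extend, extend₁_mulVec]

theorem extend_mulVec_left :
    extend R (X *ᵥ x) y = extend (fun b a => contr X (fun c => R c a) b) x y := by
  simp only [extend, extend₁_mulVec]
  congr 1
  funext b
  exact contr_sum_smul X y (fun p c => R c p) b

theorem extend_add :
    extend (fun a b => R a b + R' a b) x y = extend R x y + extend R' x y := by
  simp only [extend, extend₁, smul_add, Finset.sum_add_distrib]

theorem extend_mul_left : extend (fun a b => X * R a b) x y = X * extend R x y := by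
  simp only [extend, extend₁, Matrix.mul_sum, Matrix.mul_smul]

theorem extend_smul (c : ℝ) : extend (fun a b => c • R a b) x y = c • extend R x y := by
  simp only [extend, extend₁, Finset.smul_sum, smul_comm c]

theorem extend_commutator :
    extend (fun a b => R a b * X - X * R a b) x y = extend R x y * X - X * extend R x y := by
  simp only [extend, extend₁, Matrix.mul_sum, Finset.sum_mul, Matrix.mul_smul, Matrix.smul_mul,
    smul_sub, Finset.sum_sub_distrib]

end Extend

/-- The curvature tensor at a point, as a function of four tangent vectors. -/
noncomputable def curvForm (G : CoordSpace m → Matrix (Fin m) (Fin m) ℝ) (v : CoordSpace m)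
    (x y z w : Fin m → ℝ) : ℝ :=
  w ⬝ᵥ (G v * extend (fun a b => curvM G a b v) x y) *ᵥ z

theorem curvForm_eq_sum (v : CoordSpace m) (x y z w : Fin m → ℝ) : curvForm G v x y z w =
    ∑ a, ∑ b, ∑ c, ∑ d, curvLow G a b c d v * x a * y b * z c * w d := by
  simp only [curvForm, extend, extend₁, Matrix.mul_smul, Matrix.sum_mulVec, Matrix.smul_mulVec, dotProduct_sum, dotProduct_smul, smul_eq_mul,
    Finset.mul_sum]
  refine Finset.sum_congr rfl fun a _ => Finset.sum_congr rfl fun b _ => ?_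
  simp only [dotProduct, mulVec, mul_curvM_apply, Finset.mul_sum]
  rw [Finset.sum_comm]
  exact Finset.sum_congr rfl fun c _ => Finset.sum_congr rfl fun d _ => by ring

/-- Expanding the commutators in `curvM_identity` gives eight terms. Pairing them with Kw and z, and
moving K across the metric by skewness, produces the eight terms of the identity. -/
theorem HermitianOn.gray (h : HermitianOn σ G K s) (hσ : σ * σ = 1) {v : CoordSpace m}
    (hv : v ∈ s) (x y z w : Fin m → ℝ) :
    curvForm G v x y z w
      + curvForm G v (K v *ᵥ x) (K v *ᵥ y) (K v *ᵥ z) (K v *ᵥ w)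
      + σ * (curvForm G v (K v *ᵥ x) (K v *ᵥ y) z w + curvForm G v (K v *ᵥ x) y (K v *ᵥ z) w
        + curvForm G v (K v *ᵥ x) y z (K v *ᵥ w) + curvForm G v x (K v *ᵥ y) (K v *ᵥ z) w
        + curvForm G v x (K v *ᵥ y) z (K v *ᵥ w) + curvForm G v x y (K v *ᵥ z) (K v *ᵥ w)) = 0 := by
  set R : Fin m → Fin m → Matrix (Fin m) (Fin m) ℝ :=
    fun c a => curvM G c a v * K v - K v * curvM G c a v with hR
  have h1 := congrArg (fun R => extend R x y)
    (funext fun b => funext fun a => h.curvM_identity hv b a (R := R) fun _ _ => rfl)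
  simp only [extend_add, extend_smul, extend_mul_left] at h1
  rw [← extend_mulVec_left _ _ _ _, ← extend_mulVec_left, ← extend_mulVec_right,
    ← extend_mulVec_right] at h1
  simp only [hR, extend_commutator] at h1
  have h3 : ∀ (u : Fin m → ℝ) (S : Matrix (Fin m) (Fin m) ℝ),
      (K v *ᵥ w) ⬝ᵥ (G v * (K v * S)) *ᵥ u = -σ * (w ⬝ᵥ (G v * S) *ᵥ u) := fun u S => by
    have e : (K v)ᵀ * (G v * (K v * S)) = -σ • (G v * S) := by
      rw [← Matrix.mul_assoc, h.skew v hv, Matrix.neg_mul, Matrix.mul_assoc, ← Matrix.mul_assoc (K v),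
        h.sq v hv]
      simp
    rw [← Matrix.vecMul_transpose, ← Matrix.dotProduct_mulVec, Matrix.mulVec_mulVec, e,
      Matrix.smul_mulVec, dotProduct_smul, smul_eq_mul]
  have h4 : ∀ (u : Fin m → ℝ) (S : Matrix (Fin m) (Fin m) ℝ),
      u ⬝ᵥ (G v * (S * K v)) *ᵥ z = u ⬝ᵥ (G v * S) *ᵥ (K v *ᵥ z) := fun u S => by
    rw [Matrix.mulVec_mulVec, Matrix.mul_assoc]
  have h5 : ∀ S : Matrix (Fin m) (Fin m) ℝ, K v * (K v * S) = σ • S := fun S => by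
    rw [← Matrix.mul_assoc, h.sq v hv, Matrix.smul_mul, Matrix.one_mul]
  have h2 := congrArg (fun M => (K v *ᵥ w) ⬝ᵥ (G v * M) *ᵥ z) h1
  simp only [Matrix.mul_add, Matrix.mul_sub, h5, Matrix.mul_smul, Matrix.add_mulVec,
    Matrix.sub_mulVec, Matrix.smul_mulVec, dotProduct_add, dotProduct_sub, dotProduct_smul,
    smul_eq_mul, h3, h4] at h2
  simp only [curvForm]
  linear_combination h2 -
    (w ⬝ᵥ (G v * extend (fun a b => curvM G a b v) x y) *ᵥ z) * hσ

end Coord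

/-! ### Change of charts -/

namespace MatFamily

open Matrix

variable {m : ℕ}

/-- Vanishing of the Nijenhuis tensor is invariant under coordinate changes. -/
theorem isSym_nij_of_conj {K K' Ψ : Matrix (Fin m) (Fin m) ℝ}
    {dK dK' dΨ : Fin m → Matrix (Fin m) (Fin m) ℝ} (hΨ : Ψ.det ≠ 0) (hconj : K' * Ψ = Ψ * K)
    (hsym : IsSym dΨ) (hnij : IsSym (nij K' K' dK'))
    (hd : ∀ c, contr Ψ dK' c * Ψ + K' * dΨ c = dΨ c * K + Ψ * dK c) : IsSym (nij K K dK) := by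
  have h1 : ∀ a, Ψ * nij K K dK a =
      contr Ψ (nij K' K' dK') a * Ψ - nij K K' (fun a => dΨ a * K - K' * dΨ a) a := by
    intro a
    have e1 : ∀ c, Ψ * dK c = contr Ψ dK' c * Ψ - (dΨ c * K - K' * dΨ c) := fun c => by
      rw [eq_sub_of_add_eq' (hd c).symm]
      abel
    have e2 : contr Ψ (nij K' K' dK') a =
        contr (Ψ * K) dK' a - K' * contr Ψ dK' a := by
      rw [← hconj, ← contr_contr, ← contr_mul_left, ← contr_sub]
      rfl
    rw [e2, nij, nij, Matrix.mul_sub, ← contr_mul_left, ← Matrix.mul_assoc, ← hconj,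
      Matrix.mul_assoc]
    simp only [e1]
    rw [contr_sub, contr_mul_right, contr_contr, hconj]
    noncomm_ring
  have h2 : IsSym fun a => Ψ * nij K K dK a := by
    simp only [h1]
    exact (hnij.contr_mul Ψ).sub (isSym_nij_commutator hsym)
  have h3 := h2.mul_left Ψ⁻¹
  simpa only [← Matrix.mul_assoc, nonsing_inv_mul _ (isUnit_iff_ne_zero.mpr hΨ),
    Matrix.one_mul] using h3

end MatFamily

namespace Coord

open Matrix MatFamily

open scoped Topology

variable {m : ℕ}

/-- The Jacobian matrix. -/
noncomputable def jac (ψ : CoordSpace m → CoordSpace m) (v : CoordSpace m) :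
    Matrix (Fin m) (Fin m) ℝ := of fun i a => partialD (fun v => ψ v i) a v

theorem fderiv_apply_single {ψ : CoordSpace m → CoordSpace m} {v : CoordSpace m}
    (h : DifferentiableAt ℝ ψ v) (i a : Fin m) :
    fderiv ℝ ψ v (EuclideanSpace.single a 1) i = jac ψ v i a := by
  have h1 : HasFDerivAt (fun v => ψ v i)
      ((EuclideanSpace.proj i : CoordSpace m →L[ℝ] ℝ).comp (fderiv ℝ ψ v)) v :=
    (EuclideanSpace.proj i : CoordSpace m →L[ℝ] ℝ).hasFDerivAt.comp v h.hasFDerivAt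
  simp only [jac, of_apply, partialD, h1.fderiv]
  rfl

theorem sum_single (ξ : CoordSpace m) : ξ = ∑ a, ξ a • EuclideanSpace.single a (1 : ℝ) := by
  ext i
  simp [Finset.sum_apply, Pi.single_apply]

theorem jac_mulVec {ψ : CoordSpace m → CoordSpace m} {v : CoordSpace m}
    (h : DifferentiableAt ℝ ψ v) (ξ : CoordSpace m) :
    jac ψ v *ᵥ ξ.ofLp = (fderiv ℝ ψ v ξ).ofLp := by
  ext i
  conv_rhs => rw [sum_single ξ, map_sum]
  simp only [mulVec, dotProduct, map_smul]
  simp [← fderiv_apply_single h, mul_comm]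

theorem partialD_comp {ψ : CoordSpace m → CoordSpace m} {v : CoordSpace m} {f : CoordSpace m → ℝ}
    (h : DifferentiableAt ℝ ψ v) (hf : DifferentiableAt ℝ f (ψ v)) (a : Fin m) :
    partialD (fun v => f (ψ v)) a v = ∑ i, jac ψ v i a * partialD f i (ψ v) := by
  have h1 : HasFDerivAt (fun v => f (ψ v)) ((fderiv ℝ f (ψ v)).comp (fderiv ℝ ψ v)) v :=
    hf.hasFDerivAt.comp v h.hasFDerivAt
  rw [partialD, h1.fderiv, ContinuousLinearMap.comp_apply,
    sum_single (fderiv ℝ ψ v (EuclideanSpace.single a 1)), map_sum]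
  simp only [map_smul, fderiv_apply_single h, smul_eq_mul]
  rfl

/-- Differentiating the conjugation relation by the Jacobian brings in second derivatives of ψ; they
are symmetric, so they do not affect the Nijenhuis condition. -/
theorem isSym_nij_of_coordChange {K K' : CoordSpace m → Matrix (Fin m) (Fin m) ℝ}
    {ψ : CoordSpace m → CoordSpace m} {s s' t : Set (CoordSpace m)}
    (hs' : IsOpen s') (ht : IsOpen t) {u : CoordSpace m} (hu : u ∈ t) (hts : t ⊆ s)
    (hψ : ContDiffOn ℝ ∞ ψ t) (hu' : ψ u ∈ s') (hK : SmoothM K s) (hK' : SmoothM K' s')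
    (hdet : (jac ψ u).det ≠ 0) (hconj : ∀ v ∈ t, K' (ψ v) * jac ψ v = jac ψ v * K v)
    (hnij : IsSym (nij (K' (ψ u)) (K' (ψ u)) fun a => partialM K' a (ψ u))) :
    IsSym (nij (K u) (K u) fun a => partialM K a u) := by
  have hψu : DifferentiableAt ℝ ψ u :=
    (hψ.contDiffAt (ht.mem_nhds hu)).differentiableAt (by simp)
  have hψi : ∀ i, ContDiffOn ℝ ∞ (fun v => ψ v i) t := fun i =>
    (EuclideanSpace.proj i : CoordSpace m →L[ℝ] ℝ).contDiff.comp_contDiffOn hψ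
  have hjac : SmoothM (jac ψ) t := fun i a => contDiffOn_partialD ht (hψi i) a
  have hsub : IsOpen (t ∩ ψ ⁻¹' s') := hψ.continuousOn.isOpen_inter_preimage ht hs'
  have hcomp : SmoothM (fun v => K' (ψ v)) (t ∩ ψ ⁻¹' s') := fun i j =>
    (hK' i j).comp (hψ.mono Set.inter_subset_left) fun v hv => hv.2
  refine isSym_nij_of_conj (dΨ := fun c => partialM (jac ψ) c u) hdet (hconj u hu)
    (fun a b d => ?_) hnij fun c => ?_
  · exact partialD_comm ht (hψi d) hu b a
  · have h1 : (fun v => K' (ψ v) * jac ψ v) =ᶠ[𝓝 u] fun v => jac ψ v * K v := by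
      filter_upwards [ht.mem_nhds hu] with v hv using hconj v hv
    have h2 := partialM_congr h1 c
    rw [partialM_mul hcomp (fun i a => (hjac i a).mono Set.inter_subset_left) hsub ⟨hu, hu'⟩,
      partialM_mul hjac (fun i a => (hK i a).mono hts) ht hu] at h2
    have h3 : partialM (fun v => K' (ψ v)) c u =
        contr (jac ψ u) (fun a => partialM K' a (ψ u)) c := by
      ext i j
      rw [contr_apply]
      exact partialD_comp hψu (hK'.differentiableAt hs' hu' i j) c
    rw [← h3, h2]

end Coord

section Chart

open Matrix

open scoped Topology

variable {m : ℕ} {M : Type*} [TopologicalSpace M] [ChartedSpace (CoordSpace m) M]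
  [IsManifold 𝓘(ℝ, CoordSpace m) ∞ M]

/-- The derivative of the inverse of a chart, as an isomorphism onto the tangent space. -/
noncomputable def chartEquiv (p : M) {u : CoordSpace m}
    (hu : u ∈ (extChartAt 𝓘(ℝ, CoordSpace m) p).target) :
    CoordSpace m ≃ₗ[ℝ]
      TangentSpace 𝓘(ℝ, CoordSpace m) ((extChartAt 𝓘(ℝ, CoordSpace m) p).symm u) :=
  have : IsManifold 𝓘(ℝ, CoordSpace m) 1 M := .of_le (n := ∞) (by simp)
  LinearEquiv.ofLinearMap
    (mfderiv 𝓘(ℝ, CoordSpace m) 𝓘(ℝ, CoordSpace m)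
      (extChartAt 𝓘(ℝ, CoordSpace m) p).symm u).toLinearMap
    (mfderiv 𝓘(ℝ, CoordSpace m) 𝓘(ℝ, CoordSpace m) (extChartAt 𝓘(ℝ, CoordSpace m) p)
      ((extChartAt 𝓘(ℝ, CoordSpace m) p).symm u)).toLinearMap
    (LinearMap.ext fun x => by
      have h := mfderivWithin_extChartAt_symm_comp_mfderiv_extChartAt (I := 𝓘(ℝ, CoordSpace m)) hu
      rw [ModelWithCorners.range_eq_univ, mfderivWithin_univ] at h
      exact DFunLike.congr_fun h x)
    (LinearMap.ext fun x => by
      have h := mfderiv_extChartAt_comp_mfderivWithin_extChartAt_symm (I := 𝓘(ℝ, CoordSpace m)) hu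
      rw [ModelWithCorners.range_eq_univ, mfderivWithin_univ] at h
      exact DFunLike.congr_fun h x)

theorem coordComp_self (p : M) (x : TangentSpace 𝓘(ℝ, CoordSpace m) p) :
    coordComp p p x = x := by
  have : IsManifold 𝓘(ℝ, CoordSpace m) 1 M := .of_le (n := ∞) (by simp)
  unfold coordComp
  rw [mfderiv_extChartAt_self]
  rfl

end Chart

/-! ### Passing from the manifold to a chart. -/

namespace AlmostHermitian

open Matrix FrameJet Coord MatFamily

open scoped Topology

variable {σ : ℝ} {m : ℕ}

section Abstract

variable {T : Type*} [AddCommGroup T] [Module ℝ T] (e : CoordSpace m ≃ₗ[ℝ] T)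

theorem compatPair_of_equiv (hσ : σ * σ = 1) (g : T →ₗ[ℝ] T →ₗ[ℝ] ℝ) (J : T →ₗ[ℝ] T)
    (h₁ : ∀ x y, g x y = g y x) (h₂ : ∀ x, (∀ y, g x y = 0) → x = 0)
    (h₃ : ∀ x, J (J x) = σ • x) (h₄ : ∀ x y, g (J x) (J y) = -σ * g x y) :
    CompatPair σ
      (of fun a b => g (e (EuclideanSpace.single a 1)) (e (EuclideanSpace.single b 1)))
      (of fun b a => e.symm (J (e (EuclideanSpace.single a 1))) b) := by
  -- Zero curvature makes a model out of the metric and the structure alone, so that the matrix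
  -- relations can be taken from `CurvatureModel.compatPair`.
  let C : CurvatureModel σ T :=
    { ip := g, ip_symm := h₁, ip_nondeg := h₂, J := J, J_sq := h₃, J_compat := h₄, A := 0
      bianchi := by simp
      antisymm := by simp
      pair_symm := by simp }
  have h := C.compatPair hσ ((EuclideanSpace.basisFun (Fin m) ℝ).toBasis.map e)
  convert h using 1
  · ext a b
    simp [LinearMap.toMatrix₂_apply, C]
  · ext a b
    simp [LinearMap.toMatrix_apply, C]

theorem mulVec_of_equiv (J : T →ₗ[ℝ] T) (x : T) :
    (of fun b a => e.symm (J (e (EuclideanSpace.single a 1))) b) *ᵥ (e.symm x).ofLp =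
      (e.symm (J x)).ofLp := by
  have h := LinearMap.toMatrix_mulVec_repr ((EuclideanSpace.basisFun (Fin m) ℝ).toBasis.map e)
    ((EuclideanSpace.basisFun (Fin m) ℝ).toBasis.map e) J x
  have h1 : LinearMap.toMatrix ((EuclideanSpace.basisFun (Fin m) ℝ).toBasis.map e)
      ((EuclideanSpace.basisFun (Fin m) ℝ).toBasis.map e) J =
      of fun b a => e.symm (J (e (EuclideanSpace.single a 1))) b := by
    ext a b
    simp [LinearMap.toMatrix_apply]
  rw [h1] at h
  exact h

end Abstract

variable {M : Type*} [TopologicalSpace M] [ChartedSpace (CoordSpace m) M]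
  [IsManifold 𝓘(ℝ, CoordSpace m) ∞ M] (H : AlmostHermitian σ m M)

theorem compatPair (hσ : σ * σ = 1) (p : M) {u : CoordSpace m}
    (hu : u ∈ (extChartAt 𝓘(ℝ, CoordSpace m) p).target) :
    CompatPair σ (metricMatrix H.g p u) (endoMatrix H.J p u) :=
  compatPair_of_equiv (chartEquiv p hu) hσ _ _ (H.g_symm _) (H.g_nondeg _) (H.J_sq _)
    (H.J_compat _)

theorem endoMatrix_mulVec {p q : M} (hq : q ∈ (extChartAt 𝓘(ℝ, CoordSpace m) p).source)
    (x : TangentSpace 𝓘(ℝ, CoordSpace m) q) :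
    endoMatrix H.J p (extChartAt 𝓘(ℝ, CoordSpace m) p q) *ᵥ (coordComp p q x).ofLp =
      (coordComp p q (H.J q x)).ofLp := by
  obtain ⟨u, hu, rfl⟩ : ∃ u ∈ (extChartAt 𝓘(ℝ, CoordSpace m) p).target,
      (extChartAt 𝓘(ℝ, CoordSpace m) p).symm u = q :=
    ⟨_, (extChartAt 𝓘(ℝ, CoordSpace m) p).map_source hq,
      (extChartAt 𝓘(ℝ, CoordSpace m) p).left_inv hq⟩
  rw [(extChartAt 𝓘(ℝ, CoordSpace m) p).right_inv hu]
  exact mulVec_of_equiv (chartEquiv p hu) (H.J _) x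

/-- The chain rule for the transition from the chart at `p` to the chart at `q`. -/
theorem coordComp_coordChange (p q : M) {v : CoordSpace m}
    (hv : v ∈ (extChartAt 𝓘(ℝ, CoordSpace m) p).target)
    (hv' : (extChartAt 𝓘(ℝ, CoordSpace m) p).symm v ∈ (extChartAt 𝓘(ℝ, CoordSpace m) q).source)
    (ξ : CoordSpace m) : coordComp q _ (chartEquiv p hv ξ) =
      fderiv ℝ (extChartAt 𝓘(ℝ, CoordSpace m) q ∘ (extChartAt 𝓘(ℝ, CoordSpace m) p).symm) v ξ := by
  have : IsManifold 𝓘(ℝ, CoordSpace m) 1 M := .of_le (n := ∞) (by simp)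
  have h1 : MDifferentiableAt 𝓘(ℝ, CoordSpace m) 𝓘(ℝ, CoordSpace m)
      (extChartAt 𝓘(ℝ, CoordSpace m) p).symm v := by
    have := mdifferentiableWithinAt_extChartAt_symm (I := 𝓘(ℝ, CoordSpace m)) hv
    rwa [ModelWithCorners.range_eq_univ, mdifferentiableWithinAt_univ] at this
  have h2 : MDifferentiableAt 𝓘(ℝ, CoordSpace m) 𝓘(ℝ, CoordSpace m)
      (extChartAt 𝓘(ℝ, CoordSpace m) q) ((extChartAt 𝓘(ℝ, CoordSpace m) p).symm v) :=
    mdifferentiableAt_extChartAt (by rwa [← extChartAt_source 𝓘(ℝ, CoordSpace m)])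
  rw [← mfderiv_eq_fderiv, mfderiv_comp v h2 h1]
  rfl

theorem endoMatrix_mul_jac (p q : M) {v : CoordSpace m}
    (hv : v ∈ (extChartAt 𝓘(ℝ, CoordSpace m) p).target)
    (hv' : (extChartAt 𝓘(ℝ, CoordSpace m) p).symm v ∈ (extChartAt 𝓘(ℝ, CoordSpace m) q).source)
    (hd : DifferentiableAt ℝ
      (extChartAt 𝓘(ℝ, CoordSpace m) q ∘ (extChartAt 𝓘(ℝ, CoordSpace m) p).symm) v) :
    endoMatrix H.J q ((extChartAt 𝓘(ℝ, CoordSpace m) q ∘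
        (extChartAt 𝓘(ℝ, CoordSpace m) p).symm) v) *
      jac (extChartAt 𝓘(ℝ, CoordSpace m) q ∘ (extChartAt 𝓘(ℝ, CoordSpace m) p).symm) v =
    jac (extChartAt 𝓘(ℝ, CoordSpace m) q ∘ (extChartAt 𝓘(ℝ, CoordSpace m) p).symm) v *
      endoMatrix H.J p v := by
  refine Matrix.ext_of_mulVec_single fun a => ?_
  have h1 : ∀ ξ : CoordSpace m, endoMatrix H.J p v *ᵥ ξ.ofLp =
      ((chartEquiv p hv).symm (H.J _ (chartEquiv p hv ξ))).ofLp := fun ξ => by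
    have := mulVec_of_equiv (chartEquiv p hv) (H.J _) (chartEquiv p hv ξ)
    rwa [LinearEquiv.symm_apply_apply] at this
  have h2 := h1 (WithLp.toLp 2 (Pi.single a 1))
  have h3 := H.endoMatrix_mulVec hv' (chartEquiv p hv (WithLp.toLp 2 (Pi.single a 1)))
  rw [coordComp_coordChange p q hv hv', ← jac_mulVec hd] at h3
  rw [← Matrix.mulVec_mulVec, ← Matrix.mulVec_mulVec]
  refine h3.trans ?_
  rw [h2, jac_mulVec hd, ← coordComp_coordChange p q hv hv', LinearEquiv.apply_symm_apply]

end AlmostHermitian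

namespace AlmostHermitian

open Matrix FrameJet Coord MatFamily

variable {σ : ℝ} {m : ℕ} {M : Type*} [TopologicalSpace M] [ChartedSpace (CoordSpace m) M]
  [IsManifold 𝓘(ℝ, CoordSpace m) ∞ M] (H : AlmostHermitian σ m M)

theorem det_jac_ne_zero (p : M) {v : CoordSpace m}
    (hv : v ∈ (extChartAt 𝓘(ℝ, CoordSpace m) p).target)
    (hd : DifferentiableAt ℝ (extChartAt 𝓘(ℝ, CoordSpace m)
      ((extChartAt 𝓘(ℝ, CoordSpace m) p).symm v) ∘ (extChartAt 𝓘(ℝ, CoordSpace m) p).symm) v) :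
    (jac (extChartAt 𝓘(ℝ, CoordSpace m) ((extChartAt 𝓘(ℝ, CoordSpace m) p).symm v) ∘
      (extChartAt 𝓘(ℝ, CoordSpace m) p).symm) v).det ≠ 0 := by
  intro h0
  obtain ⟨ξ, hξ, hξ'⟩ := Matrix.exists_mulVec_eq_zero_iff.mpr h0
  have h1 := jac_mulVec hd (WithLp.toLp 2 ξ)
  rw [← coordComp_coordChange p _ hv (mem_extChartAt_source _), coordComp_self] at h1
  have h2 : chartEquiv p hv (WithLp.toLp 2 ξ) = 0 := WithLp.ofLp_injective 2 (h1.symm.trans hξ')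
  exact hξ (congrArg WithLp.ofLp ((chartEquiv p hv).map_eq_zero_iff.mp h2))

/-- `Integrable` tests the Nijenhuis tensor only at the base point of each preferred chart. Any
point of the chart at `p` is the base point of its own chart, and the coordinate change carries the
condition back; this is needed because the argument differentiates the structure in a neighbourhood.
-/
theorem Integrable.hermitianOn {H : AlmostHermitian σ m M} (hH : H.Integrable) (hσ : σ * σ = 1)
    (p : M) : HermitianOn σ (metricMatrix H.g p) (endoMatrix H.J p)
      (extChartAt 𝓘(ℝ, CoordSpace m) p).target where
  isOpen := isOpen_extChartAt_target p
  smooth_metric := H.g_smooth p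
  smooth_endo := H.J_smooth p
  symm _ hv := (H.compatPair hσ p hv).symm
  det_ne_zero _ hv := (H.compatPair hσ p hv).det_ne_zero
  sq _ hv := (H.compatPair hσ p hv).sq
  skew _ hv := (H.compatPair hσ p hv).transpose_mul_metric
  nij_symm v hv := by
    set q := (extChartAt 𝓘(ℝ, CoordSpace m) p).symm v with hq
    have ht : IsOpen ((extChartAt 𝓘(ℝ, CoordSpace m) p).symm ≫
        extChartAt 𝓘(ℝ, CoordSpace m) q).source :=
      (continuousOn_extChartAt_symm p).isOpen_inter_preimage (isOpen_extChartAt_target p)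
        (isOpen_extChartAt_source q)
    have hψ := contDiffOn_ext_coord_change (I := 𝓘(ℝ, CoordSpace m)) (n := ∞) q p
    have hd : ∀ w ∈ ((extChartAt 𝓘(ℝ, CoordSpace m) p).symm ≫
        extChartAt 𝓘(ℝ, CoordSpace m) q).source, DifferentiableAt ℝ
        (extChartAt 𝓘(ℝ, CoordSpace m) q ∘ (extChartAt 𝓘(ℝ, CoordSpace m) p).symm) w :=
      fun w hw => (hψ.contDiffAt (ht.mem_nhds hw)).differentiableAt (by simp)
    have hvt : v ∈ ((extChartAt 𝓘(ℝ, CoordSpace m) p).symm ≫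
        extChartAt 𝓘(ℝ, CoordSpace m) q).source := ⟨hv, mem_extChartAt_source q⟩
    exact isSym_nij_of_coordChange (isOpen_extChartAt_target q) ht hvt (fun w hw => hw.1) hψ
      (mem_extChartAt_target q) (H.J_smooth p) (H.J_smooth q)
      (det_jac_ne_zero p hv (hd v hvt))
      (fun w hw => H.endoMatrix_mul_jac p q hw.1 hw.2 (hd w hw))
      (nijenhuis_eq_zero_iff.mp (hH q))

theorem curvature_eq_curvForm (p : M) (x y z w : CoordSpace m) :
    H.curvature p x y z w = curvForm (metricMatrix H.g p) (extChartAt 𝓘(ℝ, CoordSpace m) p p)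
      x.ofLp y.ofLp z.ofLp w.ofLp := by
  have h : ∀ v : CoordSpace m, coordComp p p v = v := coordComp_self p
  have hx := h x
  have hy := h y
  have hz := h z
  have hw := h w
  unfold curvature
  rw [curvForm_eq_sum, hx, hy, hz, hw]

theorem Integrable.gray {H : AlmostHermitian σ m M} (hH : H.Integrable) (hσ : σ * σ = 1) {p : M}
    {V : Type*} [AddCommGroup V] [Module ℝ V] {C : CurvatureModel σ V} (hC : H.Realizes p C) :
    C.Gray := by
  obtain ⟨φ, -, hJ, hA⟩ := hC
  let ψ : V → Fin m → ℝ := fun x => WithLp.ofLp (φ x : CoordSpace m)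
  have hA' : ∀ x y z w, C.A x y z w = curvForm (metricMatrix H.g p)
      (extChartAt 𝓘(ℝ, CoordSpace m) p p) (ψ x) (ψ y) (ψ z) (ψ w) := fun x y z w =>
    (hA x y z w).symm.trans (H.curvature_eq_curvForm p _ _ _ _)
  have hJ' : ∀ x, ψ (C.J x) =
      endoMatrix H.J p (extChartAt 𝓘(ℝ, CoordSpace m) p p) *ᵥ ψ x := fun x => by
    have h := H.endoMatrix_mulVec (mem_extChartAt_source p) (φ x)
    rw [coordComp_self, coordComp_self, hJ] at h
    exact h.symm
  intro x y z w
  simp only [hA', hJ']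
  exact (hH.hermitianOn hσ p).gray hσ (mem_extChartAt_target p) _ _ _ _

end AlmostHermitian
-- The theorem.
theorem mainTheorem4 {V : Type*} [AddCommGroup V] [Module ℝ V] [FiniteDimensional ℝ V]
    (σ : ℝ) (hσ : σ = -1 ∨ σ = 1) (C : CurvatureModel σ V) :
    -- every model is realized by an almost (para-)Hermitian manifold of the stated kind
    (∃ (M : Type) (_ : TopologicalSpace M) (_ : T2Space M) (_ : SecondCountableTopology M)
        (_ : ChartedSpace (CoordSpace (Module.finrank ℝ V)) M)
        (_ : IsManifold 𝓘(ℝ, CoordSpace (Module.finrank ℝ V)) ∞ M)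
        (H : AlmostHermitian σ (Module.finrank ℝ V) M) (P : M),
      H.Realizes P C ∧ H.ConstantScalarCurvatures ∧ H.KaehlerAt P ∧
        (C.PosDef → H.Riemannian)) ∧
    -- every model with the (para-)Gray identity is so realized with integrable `J`
    (C.Gray →
      ∃ (M : Type) (_ : TopologicalSpace M) (_ : T2Space M) (_ : SecondCountableTopology M)
        (_ : ChartedSpace (CoordSpace (Module.finrank ℝ V)) M)
        (_ : IsManifold 𝓘(ℝ, CoordSpace (Module.finrank ℝ V)) ∞ M)
        (H : AlmostHermitian σ (Module.finrank ℝ V) M) (P : M),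
      H.Integrable ∧ H.Realizes P C ∧ H.ConstantScalarCurvatures ∧ H.KaehlerAt P ∧
        (C.PosDef → H.Riemannian)) ∧
    -- the (para-)Gray identity is necessary for a realization with integrable `J`
    (∀ (m : ℕ) (M : Type*) [TopologicalSpace M] [T2Space M] [SecondCountableTopology M]
        [ChartedSpace (CoordSpace m) M] [IsManifold 𝓘(ℝ, CoordSpace m) ∞ M]
        (H : AlmostHermitian σ m M) (P : M),
      H.Integrable → H.Realizes P C → C.Gray) := by
  have hσ' : σ * σ = 1 := by rcases hσ with rfl | rfl <;> norm_num
  refine ⟨?_, fun hC => ?_, fun m M _ _ _ _ _ H P hH hP => ?_⟩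
  -- The first two assertions differ only in the Hessian supplied: `potential` realizes any A, while
  -- `grayPotential` also has J skew, which yields integrability.
  · obtain ⟨M, i₁, i₂, i₃, i₄, i₅, H, P, -, h⟩ := C.exists_realization hσ' C.potential
      C.potential_symm C.potential_comm C.potential_curvature
    exact ⟨M, i₁, i₂, i₃, i₄, i₅, H, P, h⟩
  · obtain ⟨M, i₁, i₂, i₃, i₄, i₅, H, P, hI, h⟩ := C.exists_realization hσ' C.grayPotential
      C.grayPotential_symm C.grayPotential_comm (C.grayPotential_curvature hC)
    exact ⟨M, i₁, i₂, i₃, i₄, i₅, H, P, hI (C.grayPotential_J hσ'), h⟩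
  · exact hH.gray hσ' hP
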